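/- **Setting.** Let $\mathcal C$ be a monoidal $\mathsf k$-linear category with $\operatorname{End}(\mathbb 1)=\mathsf k$ a field (written as if strict). A *$\Psi$-system* in $\mathcal C$ consists of objects $\{V_i\}_{i\in I}$ with $\operatorname{End}(V_i)=\mathsf k\operatorname{Id}$ and $\operatorname{Hom}(V_i,V_j)=0$ for $i\ne j$, an involution $i\mapsto i^*$ of $I$, and morphisms $b_i:\mathbb 1\to V_i\otimes V_{i^*}$, $d_i:V_i\otimes V_{i^*}\to\mathbb 1$ with $(\operatorname{Id}\otimes d_{i^*})(b_i\otimes\operatorname{Id})=\operatorname{Id}_{V_i}=(d_i\otimes\operatorname{Id})(\operatorname{Id}\otimes b_{i^*})$, such that, with $H^{ij}_k=\operatorname{Hom}(V_k,V_i\otimes V_j)$ and $H_{ij}^k=\operatorname{Hom}(V_i\otimes V_j,V_k)$, whenever $H^{ij}_k\neq0$ for some $k$, $\operatorname{Id}_{V_i\otimes V_j}$ lies in the image of $\bigoplus_k H^{ij}_k\otimes H_{ij}^k\to\operatorname{End}(V_i\otimes V_j)$, $x\otimes y\mapsto xy$. Put $\hat H=\bigoplus H_{ij}^k$, $\check H=\bigoplus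 H^{ij}_k$, $H=\hat H\oplus\check H$. For $f\in\operatorname{End}(V_i)$ write $f=\langle f\rangle\operatorname{Id}$. Define $A,B\in\operatorname{End}(H)$ by $Ax=(\operatorname{Id}_{V_{i^*}}\otimes x)(b_{i^*}\otimes\operatorname{Id}_{V_j})$, $Bx=(x\otimes\operatorname{Id}_{V_{j^*}})(\operatorname{Id}_{V_i}\otimes b_j)$ for $x\in H_{ij}^k$, and $Ax=(d_{i^*}\otimes\operatorname{Id}_{V_j})(\operatorname{Id}_{V_{i^*}}\otimes x)$, $Bx=(\operatorname{Id}_{V_i}\otimes d_j)(x\otimes\operatorname{Id}_{V_{j^*}})$ for $x\in H^{ij}_k$. Transposes $f^*$ are taken with respect to the symmetric form on $H$ that vanishes on $\hat H\times\hat H$ and $\check H\times\check H$ and is given by $\langle x,y\rangle=\langle xy\rangle$ for $x\in H_{ij}^k$, $y\in H^{ij}_k$, and by $0$ for components with different indices. Let $C=(AB)^3$ and $R=B^*B$. Let $T:H^{\otimes4}\to\mathsf k$ be $T(u\otimes v\otimes x\otimes y)=\sum_{i,j,k,l,m,n}\langle u_{kl}^m\,(v_{ij}^k\otimes\operatorname{Id}_{V_l})(\operatorname{Id}_{V_i}\otimes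 x^{jl}_n)\,y^{in}_m\rangle$, where $u_{kl}^m$, $v_{ij}^k$, $x^{jl}_n$, $y^{in}_m$ are the components of $u,v,x,y$ in $H_{kl}^m$, $H_{ij}^k$, $H^{jl}_n$, $H^{in}_m$; write $f_r$ for $f$ acting on the $r$-th factor, and call $f,g\in\operatorname{End}(H)$ *$T$-equal* if $Tf_r=Tg_r$ for $r=1,\dots,4$. A *$\widehat\Psi$-system* is a $\Psi$-system with invertible symmetric ($f^*=f$) operators $\sqrt C,\sqrt R$ on $H$, preserving every $H^{ij}_k$ and $H_{ij}^k$, such that $(\sqrt C)^2=C$, $A\sqrt CA=B\sqrt CB=(\sqrt C)^{-1}$, $(\sqrt R)^2=R$, $B\sqrt RB=(\sqrt R)^{-1}$, $\sqrt R\sqrt C=\sqrt C\sqrt R$ and, with $\sqrt L=BA(\sqrt R)^{-1}AB$, $$T\sqrt C_1\sqrt C_2=T\sqrt C_3\sqrt C_4,\quad T\sqrt R_1\sqrt L_2=T\sqrt R_3\sqrt L_4,\quad T\sqrt R_1\sqrt R_2=T\sqrt C_3\sqrt R_4,\quad T\sqrt L_1=T\sqrt C_2\sqrt L_3\sqrt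 L_4.$$ Its operator $q$ is $q=\sqrt R\,B\sqrt L\,B\,(\sqrt L)^{-1}(\sqrt C)^{-1}$, where $(\sqrt L)^{-1}=BA\sqrt R\,AB$. **The example.** Let $N\ge1$ be odd and $\varpi\in\mathbb C$ a primitive $N$-th root of unity. Let $B_\varpi=\mathbb C\langle a^{\pm1},b\mid ab=\varpi ba\rangle$ be the Hopf algebra with $\Delta(a)=a\otimes a$, $\Delta(b)=a\otimes b+b\otimes1$. Let $G=\mathbb R\times\mathbb R_{>0}$ with $(x,y)(u,v)=(x+yu,yv)$ and $I=\{(x,y)\in G: x\ne0\}$. For $g=(x,y)$ put $u_g=\sqrt[N]{y}$, $v_g=\sqrt[N]{x}$ (real roots). For $g\in I$ let $V_g$ be the $B_\varpi$-module with basis $\{w_i\}_{i\in\mathbb Z/N}$ and $aw_i=u_g\varpi^iw_i$, $bw_i=v_gw_{i+1}$. Put $\Phi_m=\varpi^{m(m-1)/2}$, $g^*=g^{-1}$, $d_g(w_i\otimes w_j)=\Phi_i$ if $i+j=0$ and $0$ otherwise, $b_g(1)=\sum_i\Phi_{-i}^{-1}w_i\otimes w_{-i}$. On $\mathbb C^N$,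 with standard basis $\{e_i\}_{i\in\mathbb Z/N}$, let $Xe_i=\varpi^ie_i$, $Ye_i=e_{i+1}$, and for $g,h\in I$ with $gh\in I$ let $$S_{g,h}=\Big(\sum_{m=0}^{N-1}\psi_m\,(Y^{-1}X\otimes Y)^m\Big)\cdot\frac1N\sum_{i,j=0}^{N-1}\varpi^{ij}\,Y^i\otimes X^j,\qquad \psi_m=\prod_{j=1}^{m}\frac{-u_gv_h}{v_g-v_{gh}\varpi^j}.$$ **Theorem.** In the monoidal category of $B_\varpi$-modules the following hold. 1. The modules $\{V_g\}_{g\in I}$, with $g^*$, $b_g$, $d_g$ as above, form a $\Psi$-system, and $H^{g,h}_l=0$ unless $l=gh$. 2. For $g,h,gh\in I$, $S_{g,h}$ is invertible, $H^{g,h}_{gh}$ has the basis $e_i(x)=S_{g,h}(x\otimes e_i)$, and $H_{g,h}^{gh}$ has the basis $e_i^*$ given by $e_i^*(S_{g,h}(x\otimes y))=y_ix$ ($i\in\mathbb Z/N$); in particular both spaces have dimension $N$. 3. This $\Psi$-system extends to a $\widehat\Psi$-system with $\sqrt C=\operatorname{Id}_H$ and $\sqrt R$ given by $$\sqrt R\,e_i=\varpi^{-\frac{N+1}2i}\Big(\frac{v_g}{v_{gh}}\Big)^{\frac{N-1}2}e_i,\qquad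 \sqrt R\,e_i^*=\varpi^{-\frac{N+1}2i}\Big(\frac{v_g}{v_{gh}}\Big)^{\frac{N-1}2}e_i^*.$$ 4. Put $I_g=\{g\}$ for $g\in I$, $I_g=\emptyset$ for $g\in G\setminus I$, and $\mathsf b(i)=1/N$ for all $i\in I$. Then: (a) $i\in I_g$ implies $i^*\in I_{g^{-1}}$; (b) $H^{i_1i_2}_k=0$ for $i_1\in I_{g_1}$, $i_2\in I_{g_2}$, $k\in I\setminus I_{g_1g_2}$; (c) for $i_1\in I_{g_1}$, $i_2\in I_{g_2}$, either $I_{g_1g_2}=\emptyset$ or $H^{i_1i_2}_k\ne0$ for some $k\in I_{g_1g_2}$; (d) for every finite family $(g_r)$ in $G$ there is $g\in G$ with $I_{gg_r}\ne\emptyset$ for all $r$; (e) $\mathsf b(i)=\mathsf b(i^*)$, and $\sum_{i_1\in I_{g_1},i_2\in I_{g_2}}\mathsf b(i_1)\mathsf b(i_2)\dim H^{i_1i_2}_k=\mathsf b(k)$ whenever $I_{g_1},I_{g_2}\ne\emptyset$ and $k\in I_{g_1g_2}$. 5. $q=(-1)^{(N-1)/2}\big(\varpi^{-a}\operatorname{Id}_{\hat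 H}\oplus\varpi^{a}\operatorname{Id}_{\check H}\big)$ with $a=\frac{N^2-1}8$. In particular, there is a nonzero $\widetilde q\in\mathbb C$ such that $q$ is $T$-equal to $\widetilde q\operatorname{Id}_{\hat H}\oplus\widetilde q^{-1}\operatorname{Id}_{\check H}$. -/

import Mathlib

open CategoryTheory MonoidalCategory
open scoped TensorProduct DirectSum

universe w v u

/-! ### `Ψ`-systems in a `k`-linear monoidal category -/

/-- The data of a `Ψ`-system: objects `V i`, an involution of the index set, and duality morphisms
`b i : 𝟙 ⟶ V i ⊗ V i*` and `d i : V i ⊗ V i* ⟶ 𝟙`. -/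
structure PsiData (C : Type u) [Category.{v} C] [MonoidalCategory C] (I : Type w) where
  V : I → C
  star : I → I
  star_star : ∀ i, star (star i) = i
  b : ∀ i, 𝟙_ C ⟶ V i ⊗ V (star i)
  d : ∀ i, V i ⊗ V (star i) ⟶ 𝟙_ C

/-- The scalar `⟨f⟩` with `f = ⟨f⟩ • 𝟙` (and `0` if `f` is not a multiple of the identity, which
does not happen when `X` is simple). -/
noncomputable def bracket (k : Type*) [Field k] {C : Type u} [Category.{v} C] [Preadditive C]
    [Linear k C] {X : C} (f : X ⟶ X) : k :=
  open Classical in if h : ∃ c : k, f = c • 𝟙 X then h.choose else 0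

namespace PsiData

variable {C : Type u} [Category.{v} C] [MonoidalCategory C] {I : Type w}

/-- `b_{i*}`, with its target rewritten by means of `i** = i`. -/
def bStar (D : PsiData C I) (i : I) : 𝟙_ C ⟶ D.V (D.star i) ⊗ D.V i :=
  D.b (D.star i) ≫ D.V (D.star i) ◁ eqToHom (congrArg D.V (D.star_star i))

/-- `d_{i*}`, with its source rewritten by means of `i** = i`. -/
def dStar (D : PsiData C I) (i : I) : D.V (D.star i) ⊗ D.V i ⟶ 𝟙_ C :=
  D.V (D.star i) ◁ eqToHom (congrArg D.V (D.star_star i).symm) ≫ D.d (D.star i)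

/-- `H_{ij}^l = Hom(V_i ⊗ V_j, V_l)` for `t = (i, j, l)`. -/
abbrev HLow (D : PsiData C I) (t : I × I × I) : Type v := D.V t.1 ⊗ D.V t.2.1 ⟶ D.V t.2.2

/-- `H^{ij}_l = Hom(V_l, V_i ⊗ V_j)` for `t = (i, j, l)`. -/
abbrev HUp (D : PsiData C I) (t : I × I × I) : Type v := D.V t.2.2 ⟶ D.V t.1 ⊗ D.V t.2.1

variable [Preadditive C]

/-- `Ĥ`, the direct sum of all `H_{ij}^l`. -/
abbrev HHat (D : PsiData C I) : Type (max w v) := ⨁ t : I × I × I, D.HLow t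

/-- `Ȟ`, the direct sum of all `H^{ij}_l`. -/
abbrev HCheck (D : PsiData C I) : Type (max w v) := ⨁ t : I × I × I, D.HUp t

/-- `H = Ĥ ⊕ Ȟ`. -/
abbrev H (D : PsiData C I) : Type (max w v) := D.HHat × D.HCheck

variable (k : Type*) [Field k] [Linear k C]

/-- The inclusion of `H_{ij}^l` in `H`. -/
noncomputable def inLow (D : PsiData C I) (i j l : I) :
    (D.V i ⊗ D.V j ⟶ D.V l) →ₗ[k] D.H :=
  open Classical in
  LinearMap.inl k D.HHat D.HCheck ∘ₗ DirectSum.lof k (I × I × I) D.HLow (i, j, l)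

/-- The inclusion of `H^{ij}_l` in `H`. -/
noncomputable def inUp (D : PsiData C I) (i j l : I) :
    (D.V l ⟶ D.V i ⊗ D.V j) →ₗ[k] D.H :=
  open Classical in
  LinearMap.inr k D.HHat D.HCheck ∘ₗ DirectSum.lof k (I × I × I) D.HUp (i, j, l)

/-- The linear endomorphism of `H` with given restrictions to all `H_{ij}^l` and `H^{ij}_l`. -/
noncomputable def endOfComponents (D : PsiData C I)
    (f : ∀ i j l : I, (D.V i ⊗ D.V j ⟶ D.V l) →ₗ[k] D.H)
    (g : ∀ i j l : I, (D.V l ⟶ D.V i ⊗ D.V j) →ₗ[k] D.H) : Module.End k D.H :=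
  open Classical in
  LinearMap.coprod
    (DirectSum.toModule k (I × I × I) D.H fun t => f t.1 t.2.1 t.2.2)
    (DirectSum.toModule k (I × I × I) D.H fun t => g t.1 t.2.1 t.2.2)

section AB

variable [MonoidalPreadditive C] [MonoidalLinear k C]

/-- `A : H_{ij}^l → H^{i*l}_j`. -/
noncomputable def aLow (D : PsiData C I) (i j l : I) :
    (D.V i ⊗ D.V j ⟶ D.V l) →ₗ[k] (D.V j ⟶ D.V (D.star i) ⊗ D.V l) where
  toFun x := (λ_ (D.V j)).inv ≫ D.bStar i ▷ D.V j ≫ (α_ (D.V (D.star i)) (D.V i) (D.V j)).hom ≫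
    D.V (D.star i) ◁ x
  map_add' := by simp
  map_smul' := by simp

/-- `A : H^{ij}_l → H_{i*l}^j`. -/
noncomputable def aUp (D : PsiData C I) (i j l : I) :
    (D.V l ⟶ D.V i ⊗ D.V j) →ₗ[k] (D.V (D.star i) ⊗ D.V l ⟶ D.V j) where
  toFun x := D.V (D.star i) ◁ x ≫ (α_ (D.V (D.star i)) (D.V i) (D.V j)).inv ≫
    D.dStar i ▷ D.V j ≫ (λ_ (D.V j)).hom
  map_add' := by simp
  map_smul' := by simp

/-- `B : H_{ij}^l → H^{lj*}_i`. -/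
noncomputable def bLow (D : PsiData C I) (i j l : I) :
    (D.V i ⊗ D.V j ⟶ D.V l) →ₗ[k] (D.V i ⟶ D.V l ⊗ D.V (D.star j)) where
  toFun x := (ρ_ (D.V i)).inv ≫ D.V i ◁ D.b j ≫ (α_ (D.V i) (D.V j) (D.V (D.star j))).inv ≫
    x ▷ D.V (D.star j)
  map_add' := by simp
  map_smul' := by simp

/-- `B : H^{ij}_l → H_{lj*}^i`. -/
noncomputable def bUp (D : PsiData C I) (i j l : I) :
    (D.V l ⟶ D.V i ⊗ D.V j) →ₗ[k] (D.V l ⊗ D.V (D.star j) ⟶ D.V i) where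
  toFun x := x ▷ D.V (D.star j) ≫ (α_ (D.V i) (D.V j) (D.V (D.star j))).hom ≫
    D.V i ◁ D.d j ≫ (ρ_ (D.V i)).hom
  map_add' := by simp
  map_smul' := by simp

/-- The operator `A` on `H`. -/
noncomputable def opA (D : PsiData C I) : Module.End k D.H :=
  D.endOfComponents k
    (fun i j l => D.inUp k (D.star i) l j ∘ₗ D.aLow k i j l)
    (fun i j l => D.inLow k (D.star i) l j ∘ₗ D.aUp k i j l)

/-- The operator `B` on `H`. -/
noncomputable def opB (D : PsiData C I) : Module.End k D.H :=
  D.endOfComponents k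
    (fun i j l => D.inUp k l (D.star j) i ∘ₗ D.bLow k i j l)
    (fun i j l => D.inLow k l (D.star j) i ∘ₗ D.bUp k i j l)

/-- The operator `C = (AB)³`. -/
noncomputable def opC (D : PsiData C I) : Module.End k D.H := (D.opA k * D.opB k) ^ 3

end AB

/-- The symmetric bilinear pairing on `H`. -/
noncomputable def pairing (D : PsiData C I) (x y : D.H) : k :=
  ∑ᶠ t : I × I × I, (bracket k (y.2 t ≫ x.1 t) + bracket k (x.2 t ≫ y.1 t))

/-- `g` is a transpose of `f`. -/
def IsTranspose (D : PsiData C I) (f g : Module.End k D.H) : Prop :=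
  ∀ x y : D.H, D.pairing k (f x) y = D.pairing k x (g y)

/-- `f` preserves every summand `H_{ij}^l` and `H^{ij}_l` of `H`. -/
def IsGradingPreserving (D : PsiData C I) (f : Module.End k D.H) : Prop :=
  (∀ i j l (x : D.V i ⊗ D.V j ⟶ D.V l), ∃ y, f (D.inLow k i j l x) = D.inLow k i j l y) ∧
  (∀ i j l (x : D.V l ⟶ D.V i ⊗ D.V j), ∃ y, f (D.inUp k i j l x) = D.inUp k i j l y)

/-- The contribution of the indices `i, j, k, l, m, n` to the tetrahedral form (`k` is called `p`
here): the scalar of `u ∘ (v ⊗ Id_l) ∘ (Id_i ⊗ x) ∘ y` in `End(V_m)`, with `u`, `v`, `x`, `y`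
replaced by their components in `H_{pl}^m`, `H_{ij}^p`, `H^{jl}_n`, `H^{in}_m`. -/
noncomputable def tetTerm (D : PsiData C I) (i j p l m n : I) (u v x y : D.H) : k :=
  bracket k ((show D.V m ⟶ D.V i ⊗ D.V n from y.2 (i, n, m)) ≫
    D.V i ◁ (show D.V n ⟶ D.V j ⊗ D.V l from x.2 (j, l, n)) ≫
    (α_ (D.V i) (D.V j) (D.V l)).inv ≫
    (show D.V i ⊗ D.V j ⟶ D.V p from v.1 (i, j, p)) ▷ D.V l ≫
    (show D.V p ⊗ D.V l ⟶ D.V m from u.1 (p, l, m)))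

/-- The tetrahedral form `T(u ⊗ v ⊗ x ⊗ y)`, as a function of four arguments; all but finitely many
terms of the sum vanish. -/
noncomputable def tetForm (D : PsiData C I) (u v x y : D.H) : k :=
  ∑ᶠ s : I × I × I × I × I × I,
    D.tetTerm k s.1 s.2.1 s.2.2.1 s.2.2.2.1 s.2.2.2.2.1 s.2.2.2.2.2 u v x y

/-- `T`-equality of two endomorphisms of `H`: `T f_r = T g_r` for `r = 1, 2, 3, 4`. -/
def TEq (D : PsiData C I) (f g : Module.End k D.H) : Prop :=
  ∀ u v x y : D.H,
    D.tetForm k (f u) v x y = D.tetForm k (g u) v x y ∧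
    D.tetForm k u (f v) x y = D.tetForm k u (g v) x y ∧
    D.tetForm k u v (f x) y = D.tetForm k u v (g x) y ∧
    D.tetForm k u v x (f y) = D.tetForm k u v x (g y)

/-- The operator `c Id_Ĥ ⊕ c' Id_Ȟ` on `H`. -/
def diagOp (D : PsiData C I) (c c' : k) : Module.End k D.H :=
  LinearMap.prodMap (c • LinearMap.id) (c' • LinearMap.id)

section Systems

variable [MonoidalPreadditive C] [MonoidalLinear k C]

/-- The axioms of a `Ψ`-system in a monoidal category with ground field `k`. -/
structure IsPsiSystem (D : PsiData C I) : Prop where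
  /-- the ground ring `End(𝟙)` is `k` -/
  ground : Function.Bijective fun c : k => c • 𝟙 (𝟙_ C)
  simple : ∀ i, Function.Bijective fun c : k => c • 𝟙 (D.V i)
  hom_eq_zero : ∀ i j, i ≠ j → ∀ f : D.V i ⟶ D.V j, f = 0
  duality_left : ∀ i, (λ_ (D.V i)).inv ≫ D.b i ▷ D.V i ≫
    (α_ (D.V i) (D.V (D.star i)) (D.V i)).hom ≫ D.V i ◁ D.dStar i ≫ (ρ_ (D.V i)).hom = 𝟙 (D.V i)
  duality_right : ∀ i, (ρ_ (D.V i)).inv ≫ D.V i ◁ D.bStar i ≫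
    (α_ (D.V i) (D.V (D.star i)) (D.V i)).inv ≫ D.d i ▷ D.V i ≫ (λ_ (D.V i)).hom = 𝟙 (D.V i)
  /-- if some `H^{ij}_l` is nonzero, the identity of `V_i ⊗ V_j` is in the image of
  `⨁ₗ H^{ij}_l ⊗ H_{ij}^l → End(V_i ⊗ V_j)` -/
  splitting : ∀ i j, (∃ l, ∃ x : D.V l ⟶ D.V i ⊗ D.V j, x ≠ 0) →
    𝟙 (D.V i ⊗ D.V j) ∈ Submodule.span k
      {f : D.V i ⊗ D.V j ⟶ D.V i ⊗ D.V j |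
        ∃ (l : I) (x : D.V l ⟶ D.V i ⊗ D.V j) (y : D.V i ⊗ D.V j ⟶ D.V l), f = y ≫ x}

variable {k}

/-- `√L = BA (√R)⁻¹ AB`. -/
noncomputable def sqrtL (D : PsiData C I) (sR : (Module.End k D.H)ˣ) : Module.End k D.H :=
  D.opB k * D.opA k * ↑sR⁻¹ * D.opA k * D.opB k

/-- `(√L)⁻¹ = BA √R AB`. -/
noncomputable def sqrtLInv (D : PsiData C I) (sR : (Module.End k D.H)ˣ) : Module.End k D.H :=
  D.opB k * D.opA k * ↑sR * D.opA k * D.opB k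

/-- `q = √R B √L B (√L)⁻¹ (√C)⁻¹`. -/
noncomputable def opQ (D : PsiData C I) (sC sR : (Module.End k D.H)ˣ) : Module.End k D.H :=
  ↑sR * D.opB k * D.sqrtL sR * D.opB k * D.sqrtLInv sR * ↑sC⁻¹

/-- The invertible operators `√C` and `√R` make a `Ψ`-system into a `Ψ̂`-system. -/
structure IsPsiHatSystem (D : PsiData C I) (sC sR : (Module.End k D.H)ˣ) : Prop where
  isPsiSystem : D.IsPsiSystem k
  symm_C : D.IsTranspose k ↑sC ↑sC
  symm_R : D.IsTranspose k ↑sR ↑sR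
  grading_C : D.IsGradingPreserving k ↑sC
  grading_R : D.IsGradingPreserving k ↑sR
  sq_C : (↑sC * ↑sC : Module.End k D.H) = D.opC k
  conjA_C : D.opA k * ↑sC * D.opA k = ↑sC⁻¹
  conjB_C : D.opB k * ↑sC * D.opB k = ↑sC⁻¹
  /-- `(√R)² = R`, where `R = B* B` -/
  sq_R : ∃ Bt : Module.End k D.H, D.IsTranspose k (D.opB k) Bt ∧
    (↑sR * ↑sR : Module.End k D.H) = Bt * D.opB k
  conjB_R : D.opB k * ↑sR * D.opB k = ↑sR⁻¹
  comm : sR * sC = sC * sR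
  /-- `T √C₁ √C₂ = T √C₃ √C₄` -/
  T_CC : ∀ u v x y : D.H, D.tetForm k (sC.val u) (sC.val v) x y =
    D.tetForm k u v (sC.val x) (sC.val y)
  /-- `T √R₁ √L₂ = T √R₃ √L₄` -/
  T_RL : ∀ u v x y : D.H, D.tetForm k (sR.val u) (D.sqrtL sR v) x y =
    D.tetForm k u v (sR.val x) (D.sqrtL sR y)
  /-- `T √R₁ √R₂ = T √C₃ √R₄` -/
  T_RR : ∀ u v x y : D.H, D.tetForm k (sR.val u) (sR.val v) x y =
    D.tetForm k u v (sC.val x) (sR.val y)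
  /-- `T √L₁ = T √C₂ √L₃ √L₄` -/
  T_L : ∀ u v x y : D.H, D.tetForm k (D.sqrtL sR u) v x y =
    D.tetForm k u (sC.val v) (D.sqrtL sR x) (D.sqrtL sR y)

/-- The five conditions on a family of finite subsets `I_g ⊆ I`, indexed by a group `G`, and a
function `β : I → k`, under which a `Ψ̂`-system defines state sums. -/
structure IsAlgebraicData (D : PsiData C I) {G : Type*} [Group G] (J : G → Finset I)
    (β : I → k) : Prop where
  star_mem : ∀ g, ∀ i ∈ J g, D.star i ∈ J g⁻¹
  hom_eq_zero : ∀ g₁ g₂, ∀ i₁ ∈ J g₁, ∀ i₂ ∈ J g₂, ∀ l ∉ J (g₁ * g₂),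
    ∀ f : D.V l ⟶ D.V i₁ ⊗ D.V i₂, f = 0
  exists_hom : ∀ g₁ g₂, ∀ i₁ ∈ J g₁, ∀ i₂ ∈ J g₂,
    J (g₁ * g₂) = ∅ ∨ ∃ l ∈ J (g₁ * g₂), ∃ f : D.V l ⟶ D.V i₁ ⊗ D.V i₂, f ≠ 0
  exists_translate : ∀ s : Finset G, ∃ g, ∀ h ∈ s, (J (g * h)).Nonempty
  weight_star : ∀ i, β (D.star i) = β i
  weight_sum : ∀ g₁ g₂, ∀ l ∈ J (g₁ * g₂), (J g₁).Nonempty → (J g₂).Nonempty →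
    ∑ i₁ ∈ J g₁, ∑ i₂ ∈ J g₂,
      β i₁ * β i₂ * (Module.finrank k (D.V l ⟶ D.V i₁ ⊗ D.V i₂) : k) = β l

end Systems

end PsiData

/-! ### The monoidal category of modules over a bialgebra -/

namespace BialgAct

variable {k : Type u} {B : Type v} [Field k] [Ring B] [Bialgebra k B]
  {M M' P P' Q : Type u} [AddCommGroup M] [Module k M] [AddCommGroup M'] [Module k M']
  [AddCommGroup P] [Module k P] [AddCommGroup P'] [Module k P'] [AddCommGroup Q] [Module k Q]

/-- The action of `B ⊗ B` on a tensor product `M ⊗ P` of `B`-modules. -/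
noncomputable def tensor₂ (σ : B →ₐ[k] Module.End k M) (τ : B →ₐ[k] Module.End k P) :
    B ⊗[k] B →ₐ[k] Module.End k (M ⊗[k] P) :=
  (Module.endTensorEndAlgHom (R := k) (S := k) (A := k)).comp (Algebra.TensorProduct.map σ τ)

@[simp]
theorem tensor₂_tmul (σ : B →ₐ[k] Module.End k M) (τ : B →ₐ[k] Module.End k P) (r s : B) :
    tensor₂ σ τ (r ⊗ₜ s) = TensorProduct.map (σ r) (τ s) := rfl

/-- The action of `B` on a tensor product of two modules, through the comultiplication. -/
noncomputable def tensor (σ : B →ₐ[k] Module.End k M) (τ : B →ₐ[k] Module.End k P) :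
    B →ₐ[k] Module.End k (M ⊗[k] P) :=
  (tensor₂ σ τ).comp (Bialgebra.comulAlgHom k B)

theorem tensor_apply (σ : B →ₐ[k] Module.End k M) (τ : B →ₐ[k] Module.End k P) (r : B) :
    tensor σ τ r = tensor₂ σ τ (Coalgebra.comul r) := rfl

/-- The action of `B` on the ground field, through the counit. -/
noncomputable def unit : B →ₐ[k] Module.End k k :=
  (Algebra.ofId k (Module.End k k)).comp (Bialgebra.counitAlgHom k B)

theorem unit_apply (r : B) (c : k) :
    unit (k := k) r c = Coalgebra.counit (R := k) r * c := rfl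

theorem map_comm (σ : B →ₐ[k] Module.End k M) (σ' : B →ₐ[k] Module.End k M')
    (τ : B →ₐ[k] Module.End k P) (τ' : B →ₐ[k] Module.End k P') (f : M →ₗ[k] M') (g : P →ₗ[k] P')
    (hf : ∀ r, f ∘ₗ σ r = σ' r ∘ₗ f) (hg : ∀ r, g ∘ₗ τ r = τ' r ∘ₗ g) (r : B) :
    TensorProduct.map f g ∘ₗ tensor σ τ r = tensor σ' τ' r ∘ₗ TensorProduct.map f g := by
  rw [tensor_apply, tensor_apply]
  induction (Coalgebra.comul r : B ⊗[k] B) with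
  | zero => simp
  | add a b ha hb => simp only [map_add, LinearMap.comp_add, LinearMap.add_comp, ha, hb]
  | tmul a b =>
    rw [tensor₂_tmul, tensor₂_tmul, ← TensorProduct.map_comp, ← TensorProduct.map_comp, hf, hg]

theorem assoc_comm (σ : B →ₐ[k] Module.End k M) (τ : B →ₐ[k] Module.End k P)
    (ω : B →ₐ[k] Module.End k Q) (r : B) :
    (TensorProduct.assoc k M P Q).toLinearMap ∘ₗ tensor (tensor σ τ) ω r =
      tensor σ (tensor τ ω) r ∘ₗ (TensorProduct.assoc k M P Q).toLinearMap := by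
  let act3 : B ⊗[k] (B ⊗[k] B) →ₗ[k] Module.End k (M ⊗[k] (P ⊗[k] Q)) :=
    TensorProduct.lift (LinearMap.mk₂ k
      (fun a (t : B ⊗[k] B) => TensorProduct.map (σ a) (tensor₂ τ ω t))
      (by intros; rw [map_add, TensorProduct.map_add_left])
      (by intros; rw [map_smul, TensorProduct.map_smul_left])
      (by intros; rw [map_add, TensorProduct.map_add_right])
      (by intros; rw [map_smul, TensorProduct.map_smul_right]))
  have h1 : ∀ (t : B ⊗[k] B) (c : B),
      (TensorProduct.assoc k M P Q).toLinearMap ∘ₗ TensorProduct.map (tensor₂ σ τ t) (ω c) =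
      act3 (TensorProduct.assoc k B B B (t ⊗ₜ c)) ∘ₗ
        (TensorProduct.assoc k M P Q).toLinearMap := by
    intro t c
    induction t with
    | zero => simp
    | add a b ha hb =>
      simp only [map_add, TensorProduct.map_add_left, TensorProduct.add_tmul,
        LinearMap.comp_add, LinearMap.add_comp, ha, hb]
    | tmul a b =>
      apply TensorProduct.ext_threefold
      intro x y z
      simp [act3]
  have h2 : ∀ t : B ⊗[k] B,
      (TensorProduct.assoc k M P Q).toLinearMap ∘ₗ tensor₂ (tensor σ τ) ω t =
      act3 (TensorProduct.assoc k B B B (Coalgebra.comul.rTensor B t)) ∘ₗ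
        (TensorProduct.assoc k M P Q).toLinearMap := by
    intro t
    induction t with
    | zero => simp
    | add a b ha hb => simp only [map_add, LinearMap.comp_add, LinearMap.add_comp, ha, hb]
    | tmul a b => exact h1 _ _
  have h3 : ∀ t : B ⊗[k] B,
      tensor₂ σ (tensor τ ω) t = act3 (Coalgebra.comul.lTensor B t) := by
    intro t
    induction t with
    | zero => simp
    | add a b ha hb => simp only [map_add, ha, hb]
    | tmul a b => rfl
  rw [tensor_apply, h2, Coalgebra.coassoc_apply, ← h3, tensor_apply]

theorem lid_comm (σ : B →ₐ[k] Module.End k M) (r : B) :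
    (TensorProduct.lid k M).toLinearMap ∘ₗ tensor unit σ r =
      σ r ∘ₗ (TensorProduct.lid k M).toLinearMap := by
  have h : ∀ t : B ⊗[k] B,
      (TensorProduct.lid k M).toLinearMap ∘ₗ tensor₂ unit σ t =
      σ (TensorProduct.lid k B (Coalgebra.counit.rTensor B t)) ∘ₗ
        (TensorProduct.lid k M).toLinearMap := by
    intro t
    induction t with
    | zero => simp
    | add a b ha hb => simp only [map_add, LinearMap.comp_add, LinearMap.add_comp, ha, hb]
    | tmul a b => ext x; simp [unit_apply]
  rw [tensor_apply, h, Coalgebra.rTensor_counit_comul]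
  simp

theorem rid_comm (σ : B →ₐ[k] Module.End k M) (r : B) :
    (TensorProduct.rid k M).toLinearMap ∘ₗ tensor σ unit r =
      σ r ∘ₗ (TensorProduct.rid k M).toLinearMap := by
  have h : ∀ t : B ⊗[k] B,
      (TensorProduct.rid k M).toLinearMap ∘ₗ tensor₂ σ unit t =
      σ (TensorProduct.rid k B (Coalgebra.counit.lTensor B t)) ∘ₗ
        (TensorProduct.rid k M).toLinearMap := by
    intro t
    induction t with
    | zero => simp
    | add a b ha hb => simp only [map_add, LinearMap.comp_add, LinearMap.add_comp, ha, hb]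
    | tmul a b => ext x; simp [unit_apply]
  rw [tensor_apply, h, Coalgebra.lTensor_counit_comul]
  simp

end BialgAct

/-- A (left) module over a `k`-algebra `B`: a `k`-vector space with an action of `B`. -/
structure BialgMod (k : Type u) (B : Type v) [Field k] [Ring B] [Algebra k B] where
  carrier : Type u
  [addCommGroup : AddCommGroup carrier]
  [module : Module k carrier]
  act : B →ₐ[k] Module.End k carrier

namespace BialgMod

attribute [instance] addCommGroup module

variable {k : Type u} {B : Type v} [Field k] [Ring B]

section Cat

variable [Algebra k B]

/-- `B`-linear maps. -/
@[ext]
structure Hom (X Y : BialgMod k B) where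
  lin : X.carrier →ₗ[k] Y.carrier
  comm : ∀ r, lin ∘ₗ X.act r = Y.act r ∘ₗ lin

instance : Category (BialgMod k B) where
  Hom X Y := Hom X Y
  id X := ⟨LinearMap.id, fun _ => rfl⟩
  comp f g := ⟨g.lin ∘ₗ f.lin, fun r => by
    rw [LinearMap.comp_assoc, f.comm, ← LinearMap.comp_assoc, g.comm, LinearMap.comp_assoc]⟩

/-- The linear map underlying a morphism. -/
def linMap {X Y : BialgMod k B} (f : X ⟶ Y) : X.carrier →ₗ[k] Y.carrier := Hom.lin f

theorem linMap_comm {X Y : BialgMod k B} (f : X ⟶ Y) (r : B) :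
    linMap f ∘ₗ X.act r = Y.act r ∘ₗ linMap f := Hom.comm f r

/-- A morphism from a linear map. -/
def ofLin {X Y : BialgMod k B} (f : X.carrier →ₗ[k] Y.carrier)
    (h : ∀ r, f ∘ₗ X.act r = Y.act r ∘ₗ f) : X ⟶ Y := Hom.mk f h

@[simp]
theorem linMap_ofLin {X Y : BialgMod k B} (f : X.carrier →ₗ[k] Y.carrier)
    (h : ∀ r, f ∘ₗ X.act r = Y.act r ∘ₗ f) : linMap (ofLin f h) = f := rfl

theorem linMap_injective (X Y : BialgMod k B) :
    Function.Injective (linMap : (X ⟶ Y) → (X.carrier →ₗ[k] Y.carrier)) :=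
  fun _ _ h => Hom.ext h

theorem hom_ext {X Y : BialgMod k B} {f g : X ⟶ Y} (h : linMap f = linMap g) : f = g :=
  Hom.ext h

@[simp]
theorem linMap_id (X : BialgMod k B) : linMap (𝟙 X) = LinearMap.id := rfl

@[simp]
theorem linMap_comp {X Y Z : BialgMod k B} (f : X ⟶ Y) (g : Y ⟶ Z) :
    linMap (f ≫ g) = linMap g ∘ₗ linMap f := rfl

instance (X Y : BialgMod k B) : AddCommGroup (X ⟶ Y) :=
  letI : Zero (X ⟶ Y) := ⟨ofLin 0 fun r => by simp⟩
  letI : Add (X ⟶ Y) := ⟨fun f g => ofLin (linMap f + linMap g) fun r => by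
    rw [LinearMap.add_comp, LinearMap.comp_add, linMap_comm, linMap_comm]⟩
  letI : Neg (X ⟶ Y) := ⟨fun f => ofLin (-linMap f) fun r => by
    rw [LinearMap.neg_comp, LinearMap.comp_neg, linMap_comm]⟩
  letI : Sub (X ⟶ Y) := ⟨fun f g => ofLin (linMap f - linMap g) fun r => by
    rw [LinearMap.sub_comp, LinearMap.comp_sub, linMap_comm, linMap_comm]⟩
  letI : SMul ℕ (X ⟶ Y) := ⟨fun n f => ofLin (n • linMap f) fun r => by
    rw [LinearMap.smul_comp, LinearMap.comp_smul, linMap_comm]⟩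
  letI : SMul ℤ (X ⟶ Y) := ⟨fun n f => ofLin (n • linMap f) fun r => by
    rw [LinearMap.smul_comp, LinearMap.comp_smul, linMap_comm]⟩
  (linMap_injective X Y).addCommGroup _ rfl (fun _ _ => rfl) (fun _ => rfl) (fun _ _ => rfl)
    (fun _ _ => rfl) (fun _ _ => rfl)

@[simp]
theorem linMap_zero (X Y : BialgMod k B) : linMap (0 : X ⟶ Y) = 0 := rfl

@[simp]
theorem linMap_add {X Y : BialgMod k B} (f g : X ⟶ Y) :
    linMap (f + g) = linMap f + linMap g := rfl

instance (X Y : BialgMod k B) : Module k (X ⟶ Y) :=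
  letI : SMul k (X ⟶ Y) := ⟨fun n f => ofLin (n • linMap f) fun r => by
    rw [LinearMap.smul_comp, LinearMap.comp_smul, linMap_comm]⟩
  (linMap_injective X Y).module k ⟨⟨linMap, rfl⟩, fun _ _ => rfl⟩ (fun _ _ => rfl)

@[simp]
theorem linMap_smul {X Y : BialgMod k B} (c : k) (f : X ⟶ Y) :
    linMap (c • f) = c • linMap f := rfl

instance : Preadditive (BialgMod k B) where
  add_comp _ _ _ f f' g := hom_ext (LinearMap.comp_add _ _ _)
  comp_add _ _ _ f g g' := hom_ext (LinearMap.add_comp _ _ _)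

instance : Linear k (BialgMod k B) where
  smul_comp _ _ _ r f g := hom_ext (LinearMap.comp_smul _ _ _)
  comp_smul _ _ _ f r g := hom_ext (LinearMap.smul_comp _ _ _)

/-- An invertible `B`-linear map is an isomorphism. -/
def isoMk {X Y : BialgMod k B} (e : X.carrier ≃ₗ[k] Y.carrier)
    (h : ∀ r, e.toLinearMap ∘ₗ X.act r = Y.act r ∘ₗ e.toLinearMap) : X ≅ Y where
  hom := ofLin e.toLinearMap h
  inv := ofLin e.symm.toLinearMap fun r => by
    ext y
    obtain ⟨x, rfl⟩ := e.surjective y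
    have := LinearMap.congr_fun (h r) x
    simp only [LinearMap.comp_apply, LinearEquiv.coe_coe] at this ⊢
    rw [← this]; simp
  hom_inv_id := hom_ext (LinearMap.ext fun x => e.symm_apply_apply x)
  inv_hom_id := hom_ext (LinearMap.ext fun x => e.apply_symm_apply x)

/-- The forgetful functor to vector spaces. -/
def forgetToVect : BialgMod k B ⥤ ModuleCat.{u} k where
  obj X := ModuleCat.of k X.carrier
  map f := ModuleCat.ofHom (linMap f)

instance : (forgetToVect (k := k) (B := B)).Faithful where
  map_injective {_ _ _ _} h := hom_ext (congrArg ModuleCat.Hom.hom h)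

end Cat

variable [Bialgebra k B]

noncomputable instance : MonoidalCategoryStruct (BialgMod k B) where
  tensorObj X Y := ⟨X.carrier ⊗[k] Y.carrier, BialgAct.tensor X.act Y.act⟩
  tensorHom f g := ofLin (TensorProduct.map (linMap f) (linMap g))
    (BialgAct.map_comm _ _ _ _ _ _ (linMap_comm f) (linMap_comm g))
  whiskerLeft X _ _ g := ofLin (TensorProduct.map LinearMap.id (linMap g))
    (BialgAct.map_comm X.act X.act _ _ LinearMap.id _ (fun _ => rfl) (linMap_comm g))
  whiskerRight f Y := ofLin (TensorProduct.map (linMap f) LinearMap.id)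
    (BialgAct.map_comm _ _ Y.act Y.act _ LinearMap.id (linMap_comm f) (fun _ => rfl))
  tensorUnit := ⟨k, BialgAct.unit⟩
  associator X Y Z := isoMk (TensorProduct.assoc k X.carrier Y.carrier Z.carrier)
    (BialgAct.assoc_comm X.act Y.act Z.act)
  leftUnitor X := isoMk (TensorProduct.lid k X.carrier) (BialgAct.lid_comm X.act)
  rightUnitor X := isoMk (TensorProduct.rid k X.carrier) (BialgAct.rid_comm X.act)

noncomputable instance : MonoidalCategory (BialgMod k B) :=
  Monoidal.induced forgetToVect
    { μIso := fun _ _ => Iso.refl _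
      εIso := Iso.refl _
      whiskerLeft_eq := fun X Y Z f => by ext1; exact TensorProduct.ext rfl
      whiskerRight_eq := fun f Y => by ext1; exact TensorProduct.ext rfl
      tensorHom_eq := fun f g => by ext1; exact TensorProduct.ext rfl
      associator_eq := fun _ _ _ => by ext1; exact TensorProduct.ext (TensorProduct.ext rfl)
      leftUnitor_eq := fun _ => by ext1; exact TensorProduct.ext rfl
      rightUnitor_eq := fun _ => by ext1; exact TensorProduct.ext rfl }

instance : MonoidalPreadditive (BialgMod k B) where
  whiskerLeft_zero := hom_ext (TensorProduct.map_zero_right _)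
  zero_whiskerRight := hom_ext (TensorProduct.map_zero_left _)
  whiskerLeft_add f g := hom_ext (TensorProduct.map_add_right _ (linMap f) (linMap g))
  add_whiskerRight f g := hom_ext (TensorProduct.map_add_left (linMap f) (linMap g) _)

instance : MonoidalLinear k (BialgMod k B) where
  whiskerLeft_smul _ _ _ r f := hom_ext (TensorProduct.map_smul_right r _ (linMap f))
  smul_whiskerRight r _ _ f _ := hom_ext (TensorProduct.map_smul_left r (linMap f) _)

end BialgMod

/-! ### The Borel Hopf algebra `B_ϖ` -/

/-- The generators `a`, `a⁻¹`, `b` of `B_ϖ`. -/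
inductive BorelGen
  | a
  | aInv
  | b

namespace BorelGen

/-- The defining relations `a a⁻¹ = a⁻¹ a = 1` and `a b = ϖ b a`. -/
inductive Rel (ϖ : ℂ) : FreeAlgebra ℂ BorelGen → FreeAlgebra ℂ BorelGen → Prop
  | mul_inv : Rel ϖ (FreeAlgebra.ι ℂ a * FreeAlgebra.ι ℂ aInv) 1
  | inv_mul : Rel ϖ (FreeAlgebra.ι ℂ aInv * FreeAlgebra.ι ℂ a) 1
  | comm : Rel ϖ (FreeAlgebra.ι ℂ a * FreeAlgebra.ι ℂ b)
      (ϖ • (FreeAlgebra.ι ℂ b * FreeAlgebra.ι ℂ a))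

end BorelGen

/-- The algebra `B_ϖ = ℂ⟨a^{±1}, b | ab = ϖba⟩`. -/
def BorelAlg (ϖ : ℂ) : Type := RingQuot (BorelGen.Rel ϖ)

namespace BorelAlg

open BorelGen (Rel)

noncomputable instance (ϖ : ℂ) : Ring (BorelAlg ϖ) := inferInstanceAs (Ring (RingQuot _))
noncomputable instance (ϖ : ℂ) : Algebra ℂ (BorelAlg ϖ) :=
  inferInstanceAs (Algebra ℂ (RingQuot _))

variable {ϖ : ℂ}

/-- The quotient homomorphism. -/
noncomputable def mk (ϖ : ℂ) : FreeAlgebra ℂ BorelGen →ₐ[ℂ] BorelAlg ϖ :=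
  RingQuot.mkAlgHom ℂ (Rel ϖ)

theorem mk_rel {x y : FreeAlgebra ℂ BorelGen} (h : Rel ϖ x y) : mk ϖ x = mk ϖ y :=
  RingQuot.mkAlgHom_rel ℂ h

/-- The image of a generator in `B_ϖ`. -/
noncomputable def gen (ϖ : ℂ) (x : BorelGen) : BorelAlg ϖ := mk ϖ (FreeAlgebra.ι ℂ x)

theorem a_mul_aInv : gen ϖ .a * gen ϖ .aInv = 1 := by
  simpa only [gen, map_mul, map_one] using mk_rel (Rel.mul_inv (ϖ := ϖ))

theorem aInv_mul_a : gen ϖ .aInv * gen ϖ .a = 1 := by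
  simpa only [gen, map_mul, map_one] using mk_rel (Rel.inv_mul (ϖ := ϖ))

theorem a_mul_b : gen ϖ .a * gen ϖ .b = ϖ • (gen ϖ .b * gen ϖ .a) := by
  simpa only [gen, map_mul, map_smul] using mk_rel (Rel.comm (ϖ := ϖ))

/-- The algebra homomorphism `B_ϖ → E` with prescribed values on `a`, `a⁻¹`, `b`. -/
noncomputable def lift {E : Type*} [Ring E] [Algebra ℂ E] (α α' β : E) (h₁ : α * α' = 1)
    (h₂ : α' * α = 1) (h₃ : α * β = ϖ • (β * α)) : BorelAlg ϖ →ₐ[ℂ] E :=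
  RingQuot.liftAlgHom ℂ ⟨FreeAlgebra.lift ℂ fun x => BorelGen.rec α α' β x, by
    rintro _ _ (_ | _ | _) <;> simp [h₁, h₂, h₃]⟩

section Lift

variable {E : Type*} [Ring E] [Algebra ℂ E] {α α' β : E} (h₁ : α * α' = 1) (h₂ : α' * α = 1)
  (h₃ : α * β = ϖ • (β * α))

@[simp]
theorem lift_a : lift α α' β h₁ h₂ h₃ (gen ϖ .a) = α :=
  (RingQuot.liftAlgHom_mkAlgHom_apply ℂ _ _ _).trans (FreeAlgebra.lift_ι_apply _ _)

@[simp]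
theorem lift_aInv : lift α α' β h₁ h₂ h₃ (gen ϖ .aInv) = α' :=
  (RingQuot.liftAlgHom_mkAlgHom_apply ℂ _ _ _).trans (FreeAlgebra.lift_ι_apply _ _)

@[simp]
theorem lift_b : lift α α' β h₁ h₂ h₃ (gen ϖ .b) = β :=
  (RingQuot.liftAlgHom_mkAlgHom_apply ℂ _ _ _).trans (FreeAlgebra.lift_ι_apply _ _)

end Lift

theorem algHom_ext {E : Type*} [Semiring E] [Algebra ℂ E] {f g : BorelAlg ϖ →ₐ[ℂ] E}
    (h : ∀ x, f (gen ϖ x) = g (gen ϖ x)) : f = g :=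
  RingQuot.ringQuot_ext' (S := ℂ) (s := Rel ϖ) f g (FreeAlgebra.hom_ext (funext h))

/-- The inverse of `a` also satisfies a commutation relation, whatever `ϖ` is. -/
theorem b_mul_aInv : gen ϖ .b * gen ϖ .aInv = ϖ • (gen ϖ .aInv * gen ϖ .b) := by
  calc gen ϖ .b * gen ϖ .aInv
      = gen ϖ .aInv * (gen ϖ .a * gen ϖ .b) * gen ϖ .aInv := by
        rw [← mul_assoc, aInv_mul_a, one_mul]
    _ = ϖ • (gen ϖ .aInv * gen ϖ .b) := by
        rw [a_mul_b, mul_smul_comm, smul_mul_assoc, mul_assoc, mul_assoc, a_mul_aInv, mul_one]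

/-- `Δ(a) = a ⊗ a`, `Δ(b) = a ⊗ b + b ⊗ 1`. -/
noncomputable def comulHom (ϖ : ℂ) : BorelAlg ϖ →ₐ[ℂ] BorelAlg ϖ ⊗[ℂ] BorelAlg ϖ :=
  lift (gen ϖ .a ⊗ₜ gen ϖ .a) (gen ϖ .aInv ⊗ₜ gen ϖ .aInv)
    (gen ϖ .a ⊗ₜ gen ϖ .b + gen ϖ .b ⊗ₜ 1)
    (by simp [a_mul_aInv, Algebra.TensorProduct.one_def])
    (by simp [aInv_mul_a, Algebra.TensorProduct.one_def])
    (by simp [mul_add, add_mul, a_mul_b, TensorProduct.smul_tmul'])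

/-- `ε(a) = 1`, `ε(b) = 0`. -/
noncomputable def counitHom (ϖ : ℂ) : BorelAlg ϖ →ₐ[ℂ] ℂ :=
  lift 1 1 0 (by simp) (by simp) (by simp)

noncomputable instance : Bialgebra ℂ (BorelAlg ϖ) :=
  Bialgebra.ofAlgHom (comulHom ϖ) (counitHom ϖ)
    (algHom_ext fun x => by
      cases x <;> simp [comulHom, TensorProduct.tmul_add, TensorProduct.add_tmul,
        Algebra.TensorProduct.one_def, add_assoc])
    (algHom_ext fun x => by
      cases x <;> simp [comulHom, counitHom])
    (algHom_ext fun x => by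
      cases x <;> simp [comulHom, counitHom])

theorem comul_eq (x : BorelAlg ϖ) : Coalgebra.comul (R := ℂ) x = comulHom ϖ x := rfl

theorem counit_eq (x : BorelAlg ϖ) : Coalgebra.counit (R := ℂ) x = counitHom ϖ x := rfl

/-- The antipode, as an algebra homomorphism to the opposite algebra:
`S(a) = a⁻¹`, `S(b) = -a⁻¹b`. -/
noncomputable def antipodeHom (ϖ : ℂ) : BorelAlg ϖ →ₐ[ℂ] (BorelAlg ϖ)ᵐᵒᵖ :=
  lift (MulOpposite.op (gen ϖ .aInv)) (MulOpposite.op (gen ϖ .a))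
    (MulOpposite.op (-(gen ϖ .aInv * gen ϖ .b)))
    (by rw [← MulOpposite.op_mul, a_mul_aInv, MulOpposite.op_one])
    (by rw [← MulOpposite.op_mul, aInv_mul_a, MulOpposite.op_one])
    (by
      rw [← MulOpposite.op_mul, ← MulOpposite.op_mul, ← MulOpposite.op_smul, neg_mul, mul_neg,
        mul_assoc, b_mul_aInv, mul_smul_comm, smul_neg])

/-- The antipode of `B_ϖ`. -/
noncomputable def antipodeMap (ϖ : ℂ) : BorelAlg ϖ →ₗ[ℂ] BorelAlg ϖ :=
  (MulOpposite.opLinearEquiv ℂ).symm.toLinearMap ∘ₗ (antipodeHom ϖ).toLinearMap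

theorem antipodeMap_mul (x y : BorelAlg ϖ) :
    antipodeMap ϖ (x * y) = antipodeMap ϖ y * antipodeMap ϖ x := by
  simp [antipodeMap]

theorem antipodeMap_one : antipodeMap ϖ 1 = 1 := by simp [antipodeMap]

theorem antipodeMap_a : antipodeMap ϖ (gen ϖ .a) = gen ϖ .aInv := by
  simp [antipodeMap, antipodeHom]

theorem antipodeMap_aInv : antipodeMap ϖ (gen ϖ .aInv) = gen ϖ .a := by
  simp [antipodeMap, antipodeHom]

theorem antipodeMap_b : antipodeMap ϖ (gen ϖ .b) = -(gen ϖ .aInv * gen ϖ .b) := by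
  simp [antipodeMap, antipodeHom]

theorem gen_induction {p : BorelAlg ϖ → Prop} (hc : ∀ c, p (algebraMap ℂ _ c))
    (hg : ∀ x, p (gen ϖ x)) (hm : ∀ x y, p x → p y → p (x * y))
    (ha : ∀ x y, p x → p y → p (x + y)) (x : BorelAlg ϖ) : p x := by
  obtain ⟨y, rfl⟩ : ∃ y, mk ϖ y = x := RingQuot.mkAlgHom_surjective ℂ (Rel ϖ) x
  induction y using FreeAlgebra.induction with
  | grade0 c => rw [AlgHom.commutes]; exact hc c
  | grade1 z => exact hg z
  | mul u v hu hv => rw [map_mul]; exact hm _ _ hu hv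
  | add u v hu hv => rw [map_add]; exact ha _ _ hu hv

/-- The map `x ⊗ y ↦ S(x) y`. -/
noncomputable def convLeft (ϖ : ℂ) : BorelAlg ϖ ⊗[ℂ] BorelAlg ϖ →ₗ[ℂ] BorelAlg ϖ :=
  LinearMap.mul' ℂ (BorelAlg ϖ) ∘ₗ (antipodeMap ϖ).rTensor (BorelAlg ϖ)

/-- The map `x ⊗ y ↦ x S(y)`. -/
noncomputable def convRight (ϖ : ℂ) : BorelAlg ϖ ⊗[ℂ] BorelAlg ϖ →ₗ[ℂ] BorelAlg ϖ :=
  LinearMap.mul' ℂ (BorelAlg ϖ) ∘ₗ (antipodeMap ϖ).lTensor (BorelAlg ϖ)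

theorem convLeft_tmul (x y : BorelAlg ϖ) : convLeft ϖ (x ⊗ₜ y) = antipodeMap ϖ x * y := by
  simp [convLeft]

theorem convRight_tmul (x y : BorelAlg ϖ) : convRight ϖ (x ⊗ₜ y) = x * antipodeMap ϖ y := by
  simp [convRight]

theorem convLeft_mul (s t : BorelAlg ϖ ⊗[ℂ] BorelAlg ϖ) (c : ℂ)
    (hs : convLeft ϖ s = algebraMap ℂ _ c) : convLeft ϖ (s * t) = c • convLeft ϖ t := by
  induction t with
  | zero => simp
  | add a b ha hb => rw [mul_add, map_add, map_add, ha, hb, smul_add]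
  | tmul y z =>
    have h : ∀ s : BorelAlg ϖ ⊗[ℂ] BorelAlg ϖ,
        convLeft ϖ (s * y ⊗ₜ z) = antipodeMap ϖ y * convLeft ϖ s * z := by
      intro s
      induction s with
      | zero => simp
      | add a b ha hb => rw [add_mul, map_add, map_add, ha, hb, mul_add, add_mul]
      | tmul p q =>
        rw [Algebra.TensorProduct.tmul_mul_tmul, convLeft_tmul, convLeft_tmul, antipodeMap_mul]
        simp only [mul_assoc]
    rw [h, hs, convLeft_tmul, ← Algebra.commutes, mul_assoc, Algebra.smul_def]

theorem convRight_mul (s t : BorelAlg ϖ ⊗[ℂ] BorelAlg ϖ) (c : ℂ)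
    (ht : convRight ϖ t = algebraMap ℂ _ c) : convRight ϖ (s * t) = c • convRight ϖ s := by
  induction s with
  | zero => simp
  | add a b ha hb => rw [add_mul, map_add, map_add, ha, hb, smul_add]
  | tmul y z =>
    have h : ∀ t : BorelAlg ϖ ⊗[ℂ] BorelAlg ϖ,
        convRight ϖ (y ⊗ₜ z * t) = y * convRight ϖ t * antipodeMap ϖ z := by
      intro t
      induction t with
      | zero => simp
      | add a b ha hb => rw [mul_add, map_add, map_add, ha, hb, mul_add, add_mul]
      | tmul p q =>
        rw [Algebra.TensorProduct.tmul_mul_tmul, convRight_tmul, convRight_tmul, antipodeMap_mul]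
        simp only [mul_assoc]
    rw [h, ht, convRight_tmul, ← Algebra.commutes, mul_assoc, Algebra.smul_def]

theorem convLeft_comul (x : BorelAlg ϖ) :
    convLeft ϖ (comulHom ϖ x) = algebraMap ℂ _ (counitHom ϖ x) := by
  induction x using gen_induction with
  | hc c =>
    rw [AlgHom.commutes, AlgHom.commutes, Algebra.TensorProduct.algebraMap_apply, convLeft_tmul,
      Algebra.algebraMap_eq_smul_one, map_smul, antipodeMap_one, mul_one]
    simp [Algebra.algebraMap_eq_smul_one]
  | hg x =>
    cases x
    · simp [comulHom, counitHom, convLeft_tmul, antipodeMap_a, aInv_mul_a]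
    · simp [comulHom, counitHom, convLeft_tmul, antipodeMap_aInv, a_mul_aInv]
    · simp [comulHom, counitHom, convLeft_tmul, antipodeMap_a, antipodeMap_b]
  | hm x y hx hy =>
    rw [map_mul, convLeft_mul _ _ _ hx, hy, map_mul, map_mul, Algebra.smul_def]
  | ha x y hx hy => simp only [map_add, hx, hy]

theorem convRight_comul (x : BorelAlg ϖ) :
    convRight ϖ (comulHom ϖ x) = algebraMap ℂ _ (counitHom ϖ x) := by
  induction x using gen_induction with
  | hc c =>
    rw [AlgHom.commutes, AlgHom.commutes, Algebra.TensorProduct.algebraMap_apply, convRight_tmul,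
      antipodeMap_one, mul_one]
    simp
  | hg x =>
    cases x
    · simp [comulHom, counitHom, convRight_tmul, antipodeMap_a, a_mul_aInv]
    · simp [comulHom, counitHom, convRight_tmul, antipodeMap_aInv, aInv_mul_a]
    · simp [comulHom, counitHom, convRight_tmul, antipodeMap_b, antipodeMap_one, ← mul_assoc,
        a_mul_aInv]
  | hm x y hx hy =>
    rw [map_mul, convRight_mul _ _ _ hy, hx, map_mul, map_mul, Algebra.smul_def,
      Algebra.commutes]
  | ha x y hx hy => simp only [map_add, hx, hy]

noncomputable instance : HopfAlgebra ℂ (BorelAlg ϖ) where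
  antipode := antipodeMap ϖ
  mul_antipode_rTensor_comul := LinearMap.ext convLeft_comul
  mul_antipode_lTensor_comul := LinearMap.ext convRight_comul

end BorelAlg

/-! ### The cyclic representations of `B_ϖ` -/

/-- The group `G = ℝ × ℝ_{>0}` with `(x, y)(u, v) = (x + yu, yv)`. -/
@[ext]
structure HalfPlane where
  x : ℝ
  y : ℝ
  pos : 0 < y

namespace HalfPlane

noncomputable instance : Group HalfPlane :=
  letI : Mul HalfPlane := ⟨fun g h => ⟨g.x + g.y * h.x, g.y * h.y, mul_pos g.pos h.pos⟩⟩
  letI : One HalfPlane := ⟨⟨0, 1, one_pos⟩⟩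
  letI : Inv HalfPlane := ⟨fun g => ⟨-g.x / g.y, g.y⁻¹, inv_pos.mpr g.pos⟩⟩
  Group.ofLeftAxioms
    (fun g h k => HalfPlane.ext
      (show g.x + g.y * h.x + g.y * h.y * k.x = g.x + g.y * (h.x + h.y * k.x) by ring)
      (mul_assoc g.y h.y k.y))
    (fun g => HalfPlane.ext (show 0 + 1 * g.x = g.x by ring) (one_mul g.y))
    (fun g => HalfPlane.ext
      (show -g.x / g.y + g.y⁻¹ * g.x = 0 by ring) (inv_mul_cancel₀ g.pos.ne'))

theorem inv_x (g : HalfPlane) : g⁻¹.x = -g.x / g.y := rfl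

theorem inv_y (g : HalfPlane) : g⁻¹.y = g.y⁻¹ := rfl

theorem mul_x (g h : HalfPlane) : (g * h).x = g.x + g.y * h.x := rfl

theorem mul_y (g h : HalfPlane) : (g * h).y = g.y * h.y := rfl

theorem inv_x_ne {g : HalfPlane} (hg : g.x ≠ 0) : g⁻¹.x ≠ 0 :=
  div_ne_zero (neg_ne_zero.mpr hg) g.pos.ne'

end HalfPlane

/-- The index set `I = G \ ({0} × ℝ_{>0})`. -/
abbrev BorelIdx : Type := {g : HalfPlane // g.x ≠ 0}

/-- The real `N`-th root for odd `N`; it is negative on negative numbers. -/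
noncomputable def oddRoot (N : ℕ) (t : ℝ) : ℝ :=
  if 0 ≤ t then t ^ (1 / (N : ℝ)) else -(-t) ^ (1 / (N : ℝ))

theorem oddRoot_pos (N : ℕ) {t : ℝ} (ht : 0 < t) : 0 < oddRoot N t := by
  rw [oddRoot, if_pos ht.le]; exact Real.rpow_pos_of_pos ht _

theorem oddRoot_neg (N : ℕ) {t : ℝ} (ht : t ≠ 0) : oddRoot N (-t) = -oddRoot N t := by
  rcases lt_or_gt_of_ne ht with h | h
  · rw [oddRoot, oddRoot, if_pos (by linarith), if_neg (by linarith), neg_neg]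
  · rw [oddRoot, oddRoot, if_neg (by linarith), if_pos (by linarith), neg_neg]

theorem oddRoot_div (N : ℕ) (t : ℝ) {s : ℝ} (hs : 0 < s) :
    oddRoot N (t / s) = oddRoot N t / oddRoot N s := by
  rcases le_or_gt 0 t with h | h
  · rw [oddRoot, oddRoot, oddRoot, if_pos (div_nonneg h hs.le), if_pos h, if_pos hs.le,
      Real.div_rpow h hs.le]
  · rw [oddRoot, oddRoot, oddRoot, if_neg (not_le.mpr (div_neg_of_neg_of_pos h hs)),
      if_neg (not_le.mpr h), if_pos hs.le, ← neg_div, Real.div_rpow (by linarith) hs.le, neg_div]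

namespace HalfPlane

/-- `u_g`. -/
noncomputable def rootU (N : ℕ) (g : HalfPlane) : ℝ := oddRoot N g.y

/-- `v_g`. -/
noncomputable def rootV (N : ℕ) (g : HalfPlane) : ℝ := oddRoot N g.x

theorem rootU_pos (N : ℕ) (g : HalfPlane) : 0 < g.rootU N := oddRoot_pos N g.pos

theorem rootU_inv (N : ℕ) (g : HalfPlane) : g⁻¹.rootU N = (g.rootU N)⁻¹ := by
  rw [rootU, rootU, inv_y, oddRoot, oddRoot, if_pos g.pos.le, if_pos (inv_pos.mpr g.pos).le,
    Real.inv_rpow g.pos.le]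

theorem rootV_inv (N : ℕ) {g : HalfPlane} (hg : g.x ≠ 0) :
    g.rootU N * g⁻¹.rootV N = -g.rootV N := by
  have h := (rootU_pos N g).ne'
  rw [rootV, inv_x, oddRoot_div N _ g.pos, oddRoot_neg N hg]
  rw [rootU] at h ⊢
  rw [mul_div_cancel₀ _ h]
  rfl

end HalfPlane

namespace Borel

variable {N : ℕ} {ϖ : ℂ}

/-- `X e_i = ϖ^i e_i` on `ℂ^N`, whose coordinates are indexed by `ℤ/N`. -/
def opX (N : ℕ) (ϖ : ℂ) : Module.End ℂ (ZMod N → ℂ) where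
  toFun f i := ϖ ^ i.val * f i
  map_add' f g := by ext i; exact mul_add _ _ _
  map_smul' c f := by ext i; exact mul_left_comm _ _ _

/-- `Y e_i = e_{i+1}` on `ℂ^N`. -/
def opY (N : ℕ) : Module.End ℂ (ZMod N → ℂ) where
  toFun f i := f (i - 1)
  map_add' _ _ := rfl
  map_smul' _ _ := rfl

/-- `Y⁻¹ e_i = e_{i-1}` on `ℂ^N`. -/
def opYInv (N : ℕ) : Module.End ℂ (ZMod N → ℂ) where
  toFun f i := f (i + 1)
  map_add' _ _ := rfl
  map_smul' _ _ := rfl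

theorem pow_val_add [NeZero N] (hϖ : IsPrimitiveRoot ϖ N) (i j : ZMod N) :
    ϖ ^ (i + j).val = ϖ ^ i.val * ϖ ^ j.val := by
  have h := (AddChar.zmodChar N hϖ.pow_eq_one).map_add_eq_mul i j
  simpa [AddChar.zmodChar_apply] using h

theorem pow_val_add_one [NeZero N] (hϖ : IsPrimitiveRoot ϖ N) (i : ZMod N) :
    ϖ ^ (i + 1).val = ϖ * ϖ ^ i.val := by
  have h := AddChar.zmodChar_apply' (n := N) hϖ.pow_eq_one 1
  rw [AddChar.zmodChar_apply] at h
  rw [pow_val_add hϖ, mul_comm]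
  simpa using congrArg (· * ϖ ^ i.val) h

theorem pow_val_mul_neg [NeZero N] (hϖ : IsPrimitiveRoot ϖ N) (i : ZMod N) :
    ϖ ^ i.val * ϖ ^ (-i).val = 1 := by
  rw [← pow_val_add hϖ, add_neg_cancel, ZMod.val_zero, pow_zero]

theorem root_ne_zero [NeZero N] (hϖ : IsPrimitiveRoot ϖ N) : ϖ ≠ 0 :=
  hϖ.ne_zero (NeZero.ne N)

/-- The cyclic representation `π_g` of `B_ϖ` on `ℂ^N`:
`a w_i = u_g ϖ^i w_i` and `b w_i = v_g w_{i+1}`. -/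
noncomputable def cyclicAct (N : ℕ) [NeZero N] {ϖ : ℂ} (hϖ : IsPrimitiveRoot ϖ N)
    (g : HalfPlane) : BorelAlg ϖ →ₐ[ℂ] Module.End ℂ (ZMod N → ℂ) :=
  BorelAlg.lift ((g.rootU N : ℂ) • opX N ϖ) ((g.rootU N : ℂ)⁻¹ • opX N ϖ⁻¹)
    ((g.rootV N : ℂ) • opY N)
    (by
      have hu : (g.rootU N : ℂ) ≠ 0 := by exact_mod_cast (g.rootU_pos N).ne'
      have hw := root_ne_zero hϖ
      refine LinearMap.ext fun f => funext fun i => ?_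
      change (g.rootU N : ℂ) * (ϖ ^ i.val * ((g.rootU N : ℂ)⁻¹ * (ϖ⁻¹ ^ i.val * f i))) = f i
      rw [inv_pow]; field_simp)
    (by
      have hu : (g.rootU N : ℂ) ≠ 0 := by exact_mod_cast (g.rootU_pos N).ne'
      have hw := root_ne_zero hϖ
      refine LinearMap.ext fun f => funext fun i => ?_
      change (g.rootU N : ℂ)⁻¹ * (ϖ⁻¹ ^ i.val * ((g.rootU N : ℂ) * (ϖ ^ i.val * f i))) = f i
      rw [inv_pow]; field_simp)
    (by
      refine LinearMap.ext fun f => funext fun i => ?_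
      change (g.rootU N : ℂ) * (ϖ ^ i.val * ((g.rootV N : ℂ) * f (i - 1))) =
        ϖ * ((g.rootV N : ℂ) * ((g.rootU N : ℂ) * (ϖ ^ (i - 1).val * f (i - 1))))
      have h := pow_val_add_one hϖ (i - 1)
      rw [sub_add_cancel] at h
      rw [h]; ring)

/-- The `B_ϖ`-module `V_g`. -/
noncomputable abbrev cyclicMod (N : ℕ) [NeZero N] {ϖ : ℂ} (hϖ : IsPrimitiveRoot ϖ N)
    (g : HalfPlane) : BialgMod ℂ (BorelAlg ϖ) :=
  ⟨ZMod N → ℂ, cyclicAct N hϖ g⟩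

/-- The basis vector `w_i` of `V_g`, which is also the basis vector `e_i` of `ℂ^N`. -/
def basisVec (i : ZMod N) : ZMod N → ℂ := Pi.single i 1

/-- `Φ_{g,m} = ϖ^{m(m-1)/2}`; for odd `N` one has `ε = -1`, so that `-ε_g = 1` and `Φ_{g,m}` does
not depend on `g`. -/
def phi (ϖ : ℂ) (m : ZMod N) : ℂ := ϖ ^ (m.val.choose 2)

theorem phi_add_one [NeZero N] (hN : Odd N) (hϖ : IsPrimitiveRoot ϖ N) (i : ZMod N) :
    phi ϖ (i + 1) = ϖ ^ i.val * phi ϖ i := by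
  have hlt := ZMod.val_lt i
  rw [phi, phi, ← pow_add, ← Nat.choose_one_right i.val, Nat.choose_one_right]
  have hc : i.val + i.val.choose 2 = (i.val + 1).choose 2 := by
    rw [Nat.choose_succ_succ' i.val 1, Nat.choose_one_right]
  rw [hc]
  rcases Nat.lt_or_ge (i.val + 1) N with h | h
  · have : Fact (1 < N) := ⟨by omega⟩
    rw [ZMod.val_add_of_lt (by rwa [ZMod.val_one]), ZMod.val_one]
  · have hi : i.val + 1 = N := by omega
    have h0 : i + 1 = 0 := by
      have : ((i.val + 1 : ℕ) : ZMod N) = 0 := by rw [hi]; exact ZMod.natCast_self N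
      simpa using this
    rw [h0, hi, ZMod.val_zero]
    obtain ⟨m, hm⟩ := hN
    have : N.choose 2 = N * m := by
      rw [Nat.choose_two_right]
      have : N - 1 = 2 * m := by omega
      rw [this, mul_left_comm]
      exact Nat.mul_div_cancel_left _ two_pos
    rw [this, pow_mul, hϖ.pow_eq_one, one_pow]
    rfl

theorem comm_of_gen {M P : Type} [AddCommGroup M] [Module ℂ M] [AddCommGroup P] [Module ℂ P]
    (σ : BorelAlg ϖ →ₐ[ℂ] Module.End ℂ M) (τ : BorelAlg ϖ →ₐ[ℂ] Module.End ℂ P) (f : M →ₗ[ℂ] P)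
    (ha : f ∘ₗ σ (BorelAlg.gen ϖ .a) = τ (BorelAlg.gen ϖ .a) ∘ₗ f)
    (hb : f ∘ₗ σ (BorelAlg.gen ϖ .b) = τ (BorelAlg.gen ϖ .b) ∘ₗ f) (r : BorelAlg ϖ) :
    f ∘ₗ σ r = τ r ∘ₗ f := by
  induction r using BorelAlg.gen_induction with
  | hc c => ext x; simp [Module.algebraMap_end_apply]
  | hg x =>
    cases x
    · exact ha
    · have h1 : σ (BorelAlg.gen ϖ .a) ∘ₗ σ (BorelAlg.gen ϖ .aInv) = LinearMap.id := by
        rw [← Module.End.mul_eq_comp, ← map_mul, BorelAlg.a_mul_aInv, map_one]; rfl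
      have h2 : τ (BorelAlg.gen ϖ .aInv) ∘ₗ τ (BorelAlg.gen ϖ .a) = LinearMap.id := by
        rw [← Module.End.mul_eq_comp, ← map_mul, BorelAlg.aInv_mul_a, map_one]; rfl
      calc f ∘ₗ σ (BorelAlg.gen ϖ .aInv)
          = τ (BorelAlg.gen ϖ .aInv) ∘ₗ (τ (BorelAlg.gen ϖ .a) ∘ₗ f) ∘ₗ
              σ (BorelAlg.gen ϖ .aInv) := by
            rw [LinearMap.comp_assoc, ← LinearMap.comp_assoc, h2, LinearMap.id_comp]
        _ = τ (BorelAlg.gen ϖ .aInv) ∘ₗ f := by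
            rw [← ha, LinearMap.comp_assoc, h1, LinearMap.comp_id]
    · exact hb
  | hm x y hx hy =>
    rw [map_mul, map_mul, Module.End.mul_eq_comp, Module.End.mul_eq_comp, ← LinearMap.comp_assoc,
      hx, LinearMap.comp_assoc, hy, LinearMap.comp_assoc]
  | ha x y hx hy => rw [map_add, map_add, LinearMap.comp_add, LinearMap.add_comp, hx, hy]

theorem tensor_a {M P : Type} [AddCommGroup M] [Module ℂ M] [AddCommGroup P] [Module ℂ P]
    (σ : BorelAlg ϖ →ₐ[ℂ] Module.End ℂ M) (τ : BorelAlg ϖ →ₐ[ℂ] Module.End ℂ P) :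
    BialgAct.tensor σ τ (BorelAlg.gen ϖ .a) =
      TensorProduct.map (σ (BorelAlg.gen ϖ .a)) (τ (BorelAlg.gen ϖ .a)) := by
  rw [BialgAct.tensor_apply, BorelAlg.comul_eq, BorelAlg.comulHom, BorelAlg.lift_a,
    BialgAct.tensor₂_tmul]

theorem tensor_b {M P : Type} [AddCommGroup M] [Module ℂ M] [AddCommGroup P] [Module ℂ P]
    (σ : BorelAlg ϖ →ₐ[ℂ] Module.End ℂ M) (τ : BorelAlg ϖ →ₐ[ℂ] Module.End ℂ P) :
    BialgAct.tensor σ τ (BorelAlg.gen ϖ .b) =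
      TensorProduct.map (σ (BorelAlg.gen ϖ .a)) (τ (BorelAlg.gen ϖ .b)) +
      TensorProduct.map (σ (BorelAlg.gen ϖ .b)) LinearMap.id := by
  rw [BialgAct.tensor_apply, BorelAlg.comul_eq, BorelAlg.comulHom, BorelAlg.lift_b, map_add,
    BialgAct.tensor₂_tmul, BialgAct.tensor₂_tmul, map_one]
  rfl

theorem unit_a : BialgAct.unit (k := ℂ) (BorelAlg.gen ϖ .a) = LinearMap.id := by
  ext; simp [BialgAct.unit_apply, BorelAlg.counit_eq, BorelAlg.counitHom]

theorem unit_b : BialgAct.unit (k := ℂ) (BorelAlg.gen ϖ .b) = 0 := by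
  ext; simp [BialgAct.unit_apply, BorelAlg.counit_eq, BorelAlg.counitHom]

theorem cyclicAct_a [NeZero N] (hϖ : IsPrimitiveRoot ϖ N) (g : HalfPlane) :
    cyclicAct N hϖ g (BorelAlg.gen ϖ .a) = (g.rootU N : ℂ) • opX N ϖ :=
  by rw [cyclicAct, BorelAlg.lift_a]

theorem cyclicAct_b [NeZero N] (hϖ : IsPrimitiveRoot ϖ N) (g : HalfPlane) :
    cyclicAct N hϖ g (BorelAlg.gen ϖ .b) = (g.rootV N : ℂ) • opY N :=
  by rw [cyclicAct, BorelAlg.lift_b]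

/-- `d_g(w_i ⊗ w_j) = Φ_{g,i}` if `i + j = 0`, and `0` otherwise. -/
noncomputable def evLin (N : ℕ) [NeZero N] (ϖ : ℂ) :
    (ZMod N → ℂ) ⊗[ℂ] (ZMod N → ℂ) →ₗ[ℂ] ℂ :=
  TensorProduct.lift (LinearMap.mk₂ ℂ (fun f h => ∑ i, phi ϖ i * f i * h (-i))
    (fun f f' h => by
      rw [← Finset.sum_add_distrib]; refine Finset.sum_congr rfl fun i _ => ?_
      rw [Pi.add_apply]; ring)
    (fun c f h => by
      rw [Finset.smul_sum]; refine Finset.sum_congr rfl fun i _ => ?_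
      rw [Pi.smul_apply, smul_eq_mul, smul_eq_mul]; ring)
    (fun f h h' => by
      rw [← Finset.sum_add_distrib]; refine Finset.sum_congr rfl fun i _ => ?_
      rw [Pi.add_apply]; ring)
    (fun c f h => by
      rw [Finset.smul_sum]; refine Finset.sum_congr rfl fun i _ => ?_
      rw [Pi.smul_apply, smul_eq_mul, smul_eq_mul]; ring))

theorem evLin_tmul [NeZero N] (f h : ZMod N → ℂ) :
    evLin N ϖ (f ⊗ₜ h) = ∑ i, phi ϖ i * f i * h (-i) := rfl

/-- `b_g(1) = ∑_i Φ_{g*,-i}⁻¹ w_i ⊗ w_{-i}`. -/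
noncomputable def coevLin (N : ℕ) [NeZero N] (ϖ : ℂ) :
    ℂ →ₗ[ℂ] (ZMod N → ℂ) ⊗[ℂ] (ZMod N → ℂ) :=
  LinearMap.toSpanSingleton ℂ _ (∑ i : ZMod N, (phi ϖ (-i))⁻¹ • basisVec i ⊗ₜ basisVec (-i))

theorem evLin_comm [NeZero N] (hN : Odd N) (hϖ : IsPrimitiveRoot ϖ N) {g : HalfPlane}
    (hg : g.x ≠ 0) (r : BorelAlg ϖ) :
    evLin N ϖ ∘ₗ BialgAct.tensor (cyclicAct N hϖ g) (cyclicAct N hϖ g⁻¹) r =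
      BialgAct.unit r ∘ₗ evLin N ϖ := by
  have hu : (g.rootU N : ℂ) ≠ 0 := by exact_mod_cast (g.rootU_pos N).ne'
  refine comm_of_gen (ϖ := ϖ) _ _ _ ?_ ?_ r
  · rw [tensor_a, unit_a, cyclicAct_a, cyclicAct_a, HalfPlane.rootU_inv, LinearMap.id_comp]
    apply TensorProduct.ext'
    intro f h
    rw [LinearMap.comp_apply, TensorProduct.map_tmul]
    change evLin N ϖ (_ ⊗ₜ _) = evLin N ϖ (f ⊗ₜ h)
    rw [evLin_tmul, evLin_tmul]
    refine Finset.sum_congr rfl fun i _ => ?_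
    change phi ϖ i * ((g.rootU N : ℂ) * (ϖ ^ i.val * f i)) *
      ((((g.rootU N)⁻¹ : ℝ) : ℂ) * (ϖ ^ (-i).val * h (-i))) = _
    have := pow_val_mul_neg hϖ i
    rw [Complex.ofReal_inv]
    calc _ = ((g.rootU N : ℂ) * (g.rootU N : ℂ)⁻¹) * (ϖ ^ i.val * ϖ ^ (-i).val) *
          (phi ϖ i * f i * h (-i)) := by ring
      _ = _ := by rw [this, mul_inv_cancel₀ hu]; ring
  · rw [tensor_b, unit_b, cyclicAct_a, cyclicAct_b, cyclicAct_b, LinearMap.zero_comp]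
    apply TensorProduct.ext'
    intro f h
    rw [LinearMap.comp_apply, LinearMap.add_apply, TensorProduct.map_tmul, TensorProduct.map_tmul,
      map_add]
    change evLin N ϖ (_ ⊗ₜ _) + evLin N ϖ (_ ⊗ₜ _) = 0
    rw [evLin_tmul, evLin_tmul]
    change ∑ i, phi ϖ i * ((g.rootU N : ℂ) * (ϖ ^ i.val * f i)) *
        ((g⁻¹.rootV N : ℂ) * h (-i - 1)) +
      ∑ i, phi ϖ i * ((g.rootV N : ℂ) * f (i - 1)) * h (-i) = 0
    rw [← Equiv.sum_comp (Equiv.addRight (1 : ZMod N))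
      (fun i => phi ϖ i * ((g.rootV N : ℂ) * f (i - 1)) * h (-i)), ← Finset.sum_add_distrib]
    refine Finset.sum_eq_zero fun i _ => ?_
    have hv : (g.rootU N : ℂ) * (g⁻¹.rootV N : ℂ) = -(g.rootV N : ℂ) := by
      exact_mod_cast HalfPlane.rootV_inv N hg
    rw [Equiv.coe_addRight, phi_add_one hN hϖ, add_sub_cancel_right, neg_add, ← sub_eq_add_neg]
    calc _ = ((g.rootU N : ℂ) * (g⁻¹.rootV N : ℂ) + (g.rootV N : ℂ)) *
          (phi ϖ i * ϖ ^ i.val * f i * h (-i - 1)) := by ring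
      _ = 0 := by rw [hv]; ring

theorem opX_basisVec (i : ZMod N) : opX N ϖ (basisVec i) = ϖ ^ i.val • basisVec i := by
  funext j
  change ϖ ^ j.val * (Pi.single i 1 : ZMod N → ℂ) j = ϖ ^ i.val * (Pi.single i 1 : ZMod N → ℂ) j
  rcases eq_or_ne j i with rfl | h
  · rfl
  · rw [Pi.single_eq_of_ne h]; ring

theorem opY_basisVec (i : ZMod N) : opY N (basisVec i) = basisVec (i + 1) := by
  funext j
  change (Pi.single i 1 : ZMod N → ℂ) (j - 1) = (Pi.single (i + 1) 1 : ZMod N → ℂ) j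
  simp only [Pi.single_apply, sub_eq_iff_eq_add]

theorem coevLin_comm [NeZero N] (hN : Odd N) (hϖ : IsPrimitiveRoot ϖ N) {g : HalfPlane}
    (hg : g.x ≠ 0) (r : BorelAlg ϖ) :
    coevLin N ϖ ∘ₗ BialgAct.unit r =
      BialgAct.tensor (cyclicAct N hϖ g) (cyclicAct N hϖ g⁻¹) r ∘ₗ coevLin N ϖ := by
  have hu : (g.rootU N : ℂ) ≠ 0 := by exact_mod_cast (g.rootU_pos N).ne'
  have hw := root_ne_zero hϖ
  have hv : (g.rootU N : ℂ) * (g⁻¹.rootV N : ℂ) = -(g.rootV N : ℂ) := by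
    exact_mod_cast HalfPlane.rootV_inv N hg
  refine comm_of_gen (ϖ := ϖ) _ _ _ ?_ ?_ r
  · rw [tensor_a, unit_a, cyclicAct_a, cyclicAct_a, HalfPlane.rootU_inv, LinearMap.comp_id]
    apply LinearMap.ext_ring
    rw [LinearMap.comp_apply, coevLin, LinearMap.toSpanSingleton_apply, one_smul]
    rw [map_sum]
    refine Finset.sum_congr rfl fun i _ => ?_
    rw [map_smul, TensorProduct.map_tmul, LinearMap.smul_apply, LinearMap.smul_apply, opX_basisVec, opX_basisVec, smul_smul,
      smul_smul, TensorProduct.smul_tmul_smul]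
    have := pow_val_mul_neg hϖ i
    rw [Complex.ofReal_inv]
    have h1 : (g.rootU N : ℂ) * ϖ ^ i.val * ((g.rootU N : ℂ)⁻¹ * ϖ ^ (-i).val) = 1 := by
      calc _ = ((g.rootU N : ℂ) * (g.rootU N : ℂ)⁻¹) * (ϖ ^ i.val * ϖ ^ (-i).val) := by ring
        _ = 1 := by rw [this, mul_inv_cancel₀ hu, one_mul]
    rw [h1, one_smul]
  · rw [tensor_b, unit_b, cyclicAct_a, cyclicAct_b, cyclicAct_b, LinearMap.comp_zero]
    apply LinearMap.ext_ring
    rw [LinearMap.zero_apply, LinearMap.comp_apply, coevLin, LinearMap.toSpanSingleton_apply,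
      one_smul]
    symm
    rw [map_sum]
    have key : ∀ i : ZMod N,
        (TensorProduct.map ((g.rootU N : ℂ) • opX N ϖ) ((g⁻¹.rootV N : ℂ) • opY N) +
          TensorProduct.map ((g.rootV N : ℂ) • opY N) LinearMap.id :
            Module.End ℂ ((ZMod N → ℂ) ⊗[ℂ] (ZMod N → ℂ)))
          ((phi ϖ (-i))⁻¹ • basisVec i ⊗ₜ[ℂ] basisVec (-i)) =
        (-((g.rootV N : ℂ) * ((phi ϖ (-i))⁻¹ * ϖ ^ i.val))) •
            basisVec i ⊗ₜ[ℂ] basisVec (-i + 1) +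
          ((g.rootV N : ℂ) * (phi ϖ (-i))⁻¹) • basisVec (i + 1) ⊗ₜ[ℂ] basisVec (-i) := by
      intro i
      rw [map_smul, LinearMap.add_apply, TensorProduct.map_tmul, TensorProduct.map_tmul,
        LinearMap.smul_apply, LinearMap.smul_apply, LinearMap.smul_apply, opX_basisVec,
        opY_basisVec, opY_basisVec, LinearMap.id_apply, smul_smul,
        TensorProduct.smul_tmul_smul, ← TensorProduct.smul_tmul', smul_add, smul_smul, smul_smul]
      congr 2
      · calc _ = (phi ϖ (-i))⁻¹ * ϖ ^ i.val * ((g.rootU N : ℂ) * (g⁻¹.rootV N : ℂ)) := by ring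
          _ = _ := by rw [hv]; ring
      · ring
    refine (Finset.sum_congr rfl fun i _ => key i).trans ?_
    rw [Finset.sum_add_distrib, ← Equiv.sum_comp (Equiv.addRight (1 : ZMod N)) (fun i =>
      (-((g.rootV N : ℂ) * ((phi ϖ (-i))⁻¹ * ϖ ^ i.val))) •
            (basisVec i : ZMod N → ℂ) ⊗ₜ[ℂ] basisVec (-i + 1)), ← Finset.sum_add_distrib]
    refine Finset.sum_eq_zero fun i _ => ?_
    rw [Equiv.coe_addRight]
    have e1 : -(i + 1) + 1 = -i := by ring
    have e2 : phi ϖ (-i) = ϖ ^ (-(i + 1)).val * phi ϖ (-(i + 1)) := by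
      rw [← phi_add_one hN hϖ, e1]
    have e3 := pow_val_mul_neg hϖ (i + 1)
    have e4 : (phi ϖ (-(i + 1)))⁻¹ * ϖ ^ (i + 1).val = (phi ϖ (-i))⁻¹ := by
      rw [e2, mul_inv, ← eq_inv_of_mul_eq_one_left e3, mul_comm]
    rw [e1, e4, ← add_smul, neg_add_cancel, zero_smul]

/-- The modules `V_g`, `g ∈ I`, with the involution `g* = g⁻¹` and the morphisms `b_g`, `d_g`. -/
noncomputable abbrev psiData (N : ℕ) [NeZero N] (hN : Odd N) {ϖ : ℂ} (hϖ : IsPrimitiveRoot ϖ N) :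
    PsiData (BialgMod ℂ (BorelAlg ϖ)) BorelIdx where
  V g := cyclicMod N hϖ g.1
  star g := ⟨g.1⁻¹, HalfPlane.inv_x_ne g.2⟩
  star_star g := Subtype.ext (inv_inv g.1)
  b g := BialgMod.ofLin (coevLin N ϖ) (coevLin_comm hN hϖ g.2)
  d g := BialgMod.ofLin (evLin N ϖ) (evLin_comm hN hϖ g.2)

/-! ### The operators `S_{g,h}` and the algebraic data -/

/-- `ψ_{g,h,m}`: the solution of `ψ_m / ψ_{m-1} = -u_g v_h / (v_g - v_{gh} ϖ^m)`, `ψ_0 = 1`. -/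
noncomputable def psiCoeff (ϖ : ℂ) (g h : HalfPlane) (m : ZMod N) : ℂ :=
  ∏ j ∈ Finset.range m.val,
    (-(g.rootU N * h.rootV N : ℂ)) / ((g.rootV N : ℂ) - ((g * h).rootV N : ℂ) * ϖ ^ (j + 1))

/-- `S_{g,h} = Ψ_{g,h}(-Y⁻¹X ⊗ Y) L(Y ⊗ 1, 1 ⊗ X)` on `ℂ^N ⊗ ℂ^N`, where
`Ψ_{g,h}(E) = ∑_m ψ_{g,h,m} (-E)^m` and `L(U, V) = N⁻¹ ∑_{i,j} ϖ^{ij} U^i V^j`. -/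
noncomputable def opS (N : ℕ) [NeZero N] (ϖ : ℂ) (g h : HalfPlane) :
    Module.End ℂ ((ZMod N → ℂ) ⊗[ℂ] (ZMod N → ℂ)) :=
  (∑ m : ZMod N, psiCoeff ϖ g h m •
    (TensorProduct.map (opYInv N * opX N ϖ) (opY N) :
      Module.End ℂ ((ZMod N → ℂ) ⊗[ℂ] (ZMod N → ℂ))) ^ m.val) *
  ((N : ℂ)⁻¹ • ∑ i : ZMod N, ∑ j : ZMod N, ϖ ^ (i.val * j.val) •
    ((TensorProduct.map (opY N) LinearMap.id :
        Module.End ℂ ((ZMod N → ℂ) ⊗[ℂ] (ZMod N → ℂ))) ^ i.val *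
      (TensorProduct.map LinearMap.id (opX N ϖ) :
        Module.End ℂ ((ZMod N → ℂ) ⊗[ℂ] (ZMod N → ℂ))) ^ j.val))

/-- `I_g = {g}` if `g ∈ I`, and `I_g = ∅` otherwise. -/
noncomputable def fiber (g : HalfPlane) : Finset BorelIdx :=
  open Classical in if hg : g.x ≠ 0 then {⟨g, hg⟩} else ∅

/-- The eigenvalue `ϖ^{-((N+1)/2) i} (v_g / v_l)^{(N-1)/2}` of `√R`, where `l = gh`. -/
noncomputable def sqrtREigen (N : ℕ) (ϖ : ℂ) (g l : HalfPlane) (i : ZMod N) : ℂ :=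
  (ϖ ^ ((N + 1) / 2 * i.val))⁻¹ * ((g.rootV N / l.rootV N : ℝ) : ℂ) ^ ((N - 1) / 2)

end Borel

set_option linter.unusedSectionVars false

/-! ### Real roots -/

/-! In the bases `w_i` a morphism between `V_g ⊗ V_h` and `V_l` is an array of numbers indexed by
`(i, j, k)` in `ℤ/N`. Commuting with `a`, whose eigenvalues are positive reals times roots of unity,
forces `k = i + j` and `u_l = u_g u_h` wherever an entry is nonzero. Commuting with `b` is a
first-order linear recursion. The operators `A` and `B` permute the three indices, up to sign, and
multiply by a Gaussian factor `φ`.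

The organising device is a pair of operators on `H` that preserve every summand: `r`, built from `Y
⊗ X`, and `s`, built from `1 ⊗ Y`, each compensated by a shift on `V_l`. They satisfy `r^N = s^N =
1` and `r s = z s r`, where `z` is `ϖ⁻¹` on `Ĥ` and `ϖ` on `Ȟ`. Moreover `A² = B² = 1`, `s A s = A`,
`r B r = B`, `A r = r A s` and `B s = s B r`. With `M = (N - 1)/2` one takes `√R = ((v_g/v_l) r)^M`,
and conjugation gives `√L = ((u_g v_h/v_l) s)^M`. The conjugation axioms and the value of `q` then
become computations with words in a group: the scalars contribute `(-1)^M` to `q`, and `r^M (s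
r⁻¹)^M s^{-M} = z^{M(M+1)/2}` gives the power of `ϖ` (`units_q`). The identities for `T` follow from
three elementary rules carrying `r` and `s` through a tetrahedron (`tetBracket_rr`, `tetBracket_rs`,
`tetBracket_s`).

The columns of `S_{g,h}` give eigenvectors `e_a` of `r` with eigenvalue `χ(a)`. The dual vectors
`e_a^*` use the inverse `θ` of the series `∑ ψ_m E^m`. Biorthogonality (`bracket_eUp_eLow`) rests on
the value of `∑ χ/(z - wχ)` over all `N`-th roots of unity `χ`; the companion sum `∑ 1/(z - wχ)`
gives the eigenvalue `((v_g/v_l) χ(a))^{N-1}` of `B*B` on `e_a`, which is why `√R` has the stated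
form. Invertibility of `S_{g,h}`, the bases and the splitting of `V_g ⊗ V_h` all follow from
biorthogonality, because the dimension is finite.

That `H^{g,h}_l` vanishes unless `l = gh` comes from an eigenvector of `r`: on it the recursion for
`b` involves a single index, and multiplying its instances once around the cycle `ℤ/N` gives `l.x =
g.x + g.y h.x` (`eq_mul_of_eigenvector`). -/

theorem oddRoot_pow {N : ℕ} (hN : Odd N) (t : ℝ) : oddRoot N t ^ N = t := by
  have h0 : N ≠ 0 := hN.pos.ne'
  rw [oddRoot, one_div]
  split_ifs with h
  · exact Real.rpow_inv_natCast_pow h h0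
  · rw [hN.neg_pow, Real.rpow_inv_natCast_pow (by linarith) h0, neg_neg]

namespace HalfPlane

variable {N : ℕ} {g h : HalfPlane}

theorem rootU_pow (hN : Odd N) (g : HalfPlane) : g.rootU N ^ N = g.y := oddRoot_pow hN _

theorem rootV_pow (hN : Odd N) (g : HalfPlane) : g.rootV N ^ N = g.x := oddRoot_pow hN _

theorem rootU_ne (N : ℕ) (g : HalfPlane) : (g.rootU N : ℂ) ≠ 0 := by
  exact_mod_cast (g.rootU_pos N).ne'

theorem rootV_ne (hN : Odd N) (hg : g.x ≠ 0) : (g.rootV N : ℂ) ≠ 0 := by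
  intro h0
  have h1 : g.rootV N = 0 := by exact_mod_cast h0
  exact hg (by rw [← rootV_pow hN g, h1, zero_pow hN.pos.ne'])

theorem rootU_pow' (hN : Odd N) (g : HalfPlane) : (g.rootU N : ℂ) ^ N = g.y := by
  exact_mod_cast rootU_pow hN g

theorem rootV_pow' (hN : Odd N) (g : HalfPlane) : (g.rootV N : ℂ) ^ N = g.x := by
  exact_mod_cast rootV_pow hN g

theorem rootU_mul (hN : Odd N) (g h : HalfPlane) :
    (g * h).rootU N = g.rootU N * h.rootU N := by
  refine (pow_left_inj₀ (rootU_pos N _).le (mul_pos (rootU_pos N g) (rootU_pos N h)).le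
    hN.pos.ne').mp ?_
  rw [mul_pow, rootU_pow hN, rootU_pow hN, rootU_pow hN, mul_y]

theorem rootV_inv' (hg : g.x ≠ 0) :
    (g⁻¹.rootV N : ℂ) = -(g.rootV N : ℂ) / g.rootU N := by
  rw [eq_div_iff (rootU_ne N g), mul_comm]
  exact_mod_cast rootV_inv N hg

end HalfPlane

namespace Borel

/-! ### Roots of unity indexed by `ℤ/N` -/

variable {N : ℕ} {ϖ : ℂ}

/-- The character `i ↦ ϖ^i` of `ℤ/N`. -/
def chi (ϖ : ℂ) (i : ZMod N) : ℂ := ϖ ^ i.val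

theorem chi_add [NeZero N] (hϖ : IsPrimitiveRoot ϖ N) (i j : ZMod N) :
    chi ϖ (i + j) = chi ϖ i * chi ϖ j := pow_val_add hϖ i j

theorem chi_zero : chi ϖ (0 : ZMod N) = 1 := by simp [chi]

theorem chi_ne_zero [NeZero N] (hϖ : IsPrimitiveRoot ϖ N) (i : ZMod N) : chi ϖ i ≠ 0 :=
  pow_ne_zero _ (root_ne_zero hϖ)

theorem chi_neg [NeZero N] (hϖ : IsPrimitiveRoot ϖ N) (i : ZMod N) : chi ϖ (-i) = (chi ϖ i)⁻¹ :=
  eq_inv_of_mul_eq_one_right (pow_val_mul_neg hϖ i)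

theorem chi_one [NeZero N] (hϖ : IsPrimitiveRoot ϖ N) : chi ϖ (1 : ZMod N) = ϖ := by
  have h := pow_val_add_one hϖ (0 : ZMod N)
  simpa [chi] using h

theorem chi_natCast (hϖ : IsPrimitiveRoot ϖ N) (n : ℕ) : chi ϖ (n : ZMod N) = ϖ ^ n := by
  rw [chi, ZMod.val_natCast]
  exact (pow_eq_pow_mod n hϖ.pow_eq_one).symm

theorem chi_natCast_mul [NeZero N] (hϖ : IsPrimitiveRoot ϖ N) (n : ℕ) (i : ZMod N) :
    chi ϖ ((n : ZMod N) * i) = chi ϖ i ^ n := by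
  conv_lhs => rw [← ZMod.natCast_zmod_val i, ← Nat.cast_mul, chi_natCast hϖ]
  rw [chi, ← pow_mul, mul_comm]

theorem chi_injective [NeZero N] (hϖ : IsPrimitiveRoot ϖ N) :
    Function.Injective (chi ϖ : ZMod N → ℂ) := fun i j h =>
  ZMod.val_injective N (hϖ.pow_inj (ZMod.val_lt i) (ZMod.val_lt j) h)

theorem chi_pow_card (hϖ : IsPrimitiveRoot ϖ N) (i : ZMod N) : chi ϖ i ^ N = 1 := by
  rw [chi, ← pow_mul, mul_comm, pow_mul, hϖ.pow_eq_one, one_pow]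

theorem norm_chi [NeZero N] (hϖ : IsPrimitiveRoot ϖ N) (i : ZMod N) : ‖chi ϖ i‖ = 1 :=
  Complex.norm_eq_one_of_pow_eq_one (chi_pow_card hϖ i) (NeZero.ne N)

theorem sum_chi_mul [NeZero N] (hϖ : IsPrimitiveRoot ϖ N) (m : ZMod N) :
    ∑ i : ZMod N, chi ϖ (i * m) = if m = 0 then (N : ℂ) else 0 := by
  split_ifs with h
  · subst h; simp [chi_zero]
  · have h1 : chi ϖ m * ∑ i : ZMod N, chi ϖ (i * m) = ∑ i : ZMod N, chi ϖ (i * m) := by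
      rw [Finset.mul_sum]
      refine Eq.trans (Finset.sum_congr rfl fun i _ => ?_)
        (Equiv.sum_comp (Equiv.addRight (1 : ZMod N)) _)
      rw [← chi_add hϖ, Equiv.coe_addRight]; congr 1; ring
    have h2 : chi ϖ m ≠ 1 := fun h2 => h (chi_injective hϖ (h2.trans chi_zero.symm))
    have h3 : (chi ϖ m - 1) * ∑ i : ZMod N, chi ϖ (i * m) = 0 := by rw [sub_mul, h1]; ring
    exact (mul_eq_zero.mp h3).resolve_left (sub_ne_zero.mpr h2)

/-- The values of `χ` are exactly the `N`-th roots of unity. This product closes up first-order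
recursions after one turn around `ℤ/N`. -/
theorem prod_sub_mul_chi [NeZero N] (hϖ : IsPrimitiveRoot ϖ N) (z w : ℂ) :
    ∏ i : ZMod N, (z - w * chi ϖ i) = z ^ N - w ^ N := by
  rw [hϖ.pow_sub_pow_eq_prod_sub_mul z w (NeZero.pos N)]
  refine Finset.prod_bij (fun i _ => chi ϖ i)
    (fun i _ => (Polynomial.mem_nthRootsFinset (NeZero.pos N) 1).mpr (chi_pow_card hϖ i))
    (fun i _ j _ h => chi_injective hϖ h) (fun ζ hζ => ?_) (fun i _ => by ring)
  obtain ⟨k, hk, rfl⟩ := hϖ.eq_pow_of_pow_eq_one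
    ((Polynomial.mem_nthRootsFinset (NeZero.pos N) 1).mp hζ)
  exact ⟨(k : ZMod N), Finset.mem_univ _, chi_natCast hϖ k⟩

theorem sub_mul_chi_ne_zero (hϖ : IsPrimitiveRoot ϖ N) {z w : ℂ} (h : z ^ N ≠ w ^ N)
    (i : ZMod N) : z - w * chi ϖ i ≠ 0 := by
  intro h0
  apply h
  rw [sub_eq_zero.mp h0, mul_pow, chi_pow_card hϖ, mul_one]

/-- The finite geometric series, using `χ^N = 1`, turns the inverse into a polynomial in `χ`, to
which orthogonality of characters applies. -/
theorem inv_sub_mul_chi [NeZero N] (hϖ : IsPrimitiveRoot ϖ N) {z w : ℂ} (h : z ^ N ≠ w ^ N) (i : ZMod N) :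
    (z - w * chi ϖ i)⁻¹ =
      (z ^ N - w ^ N)⁻¹ * ∑ k ∈ Finset.range N, z ^ k * (w * chi ϖ i) ^ (N - 1 - k) := by
  have h1 := sub_mul_chi_ne_zero hϖ h i
  have h2 : z ^ N - w ^ N ≠ 0 := sub_ne_zero.mpr h
  have h3 := (Commute.all z (w * chi ϖ i)).geom_sum₂_mul N
  rw [mul_pow w, chi_pow_card hϖ, mul_one] at h3
  rw [inv_eq_iff_eq_inv, mul_inv, inv_inv, ← div_eq_mul_inv, eq_div_iff, mul_comm]
  · exact h3
  · intro h0; rw [h0, zero_mul] at h3; exact h2 h3.symm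

theorem sum_inv_sub_mul_chi [NeZero N] (hϖ : IsPrimitiveRoot ϖ N) {z w : ℂ} (h : z ^ N ≠ w ^ N) :
    ∑ i : ZMod N, (z - w * chi ϖ i)⁻¹ = N * z ^ (N - 1) / (z ^ N - w ^ N) := by
  simp_rw [inv_sub_mul_chi hϖ h]
  rw [← Finset.mul_sum, Finset.sum_comm]
  have key : ∀ k ∈ Finset.range N, ∑ i : ZMod N, z ^ k * (w * chi ϖ i) ^ (N - 1 - k) =
      if k = N - 1 then N * z ^ (N - 1) else 0 := by
    intro k hk
    have hk := Finset.mem_range.mp hk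
    have e : ∀ i : ZMod N, z ^ k * (w * chi ϖ i) ^ (N - 1 - k) =
        z ^ k * w ^ (N - 1 - k) * chi ϖ (i * ((N - 1 - k : ℕ) : ZMod N)) := by
      intro i; rw [mul_comm i, chi_natCast_mul hϖ, mul_pow]; ring
    simp_rw [e]
    -- Orthogonality leaves only the exponent `N - 1 - k` divisible by `N`, that is `k = N - 1`.
    rw [← Finset.mul_sum, sum_chi_mul hϖ]
    by_cases h1 : k = N - 1
    · subst h1; simp; ring
    · rw [if_neg h1, if_neg, mul_zero]
      rw [ZMod.natCast_eq_zero_iff]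
      exact Nat.not_dvd_of_pos_of_lt (by omega) (by omega)
  rw [Finset.sum_congr rfl key, Finset.sum_ite_eq', if_pos (by simp [NeZero.pos N])]
  ring

/-- Follows from the preceding sum through `χ/(z - wχ) = w⁻¹ (z/(z - wχ) - 1)`. -/
theorem sum_chi_div_sub_mul_chi [NeZero N] (hϖ : IsPrimitiveRoot ϖ N) {z w : ℂ} (h : z ^ N ≠ w ^ N)
    (hw : w ≠ 0) :
    ∑ i : ZMod N, chi ϖ i * (z - w * chi ϖ i)⁻¹ = N * w ^ (N - 1) / (z ^ N - w ^ N) := by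
  have e : ∀ i : ZMod N, chi ϖ i * (z - w * chi ϖ i)⁻¹ =
      w⁻¹ * (z * (z - w * chi ϖ i)⁻¹ - 1) := by
    intro i
    have hd := sub_mul_chi_ne_zero hϖ h i
    rw [eq_inv_mul_iff_mul_eq₀ hw, ← mul_inv_cancel₀ hd]
    ring
  have h2 : z ^ N - w ^ N ≠ 0 := sub_ne_zero.mpr h
  have hp : ∀ t : ℂ, t ^ N = t * t ^ (N - 1) := fun t =>
    (mul_pow_sub_one (NeZero.ne N) t).symm
  simp_rw [e]
  rw [← Finset.mul_sum, Finset.sum_sub_distrib, ← Finset.mul_sum, sum_inv_sub_mul_chi hϖ h,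
    Finset.sum_const, Finset.card_univ, ZMod.card]
  rw [nsmul_eq_mul, mul_one]
  field_simp
  rw [hp z, hp w]; ring

/-- A function on `ℤ/N` invariant under translation by `1` is constant. -/
theorem eq_apply_zero_of_add_one [NeZero N] {α : Type*} {f : ZMod N → α} (h : ∀ i, f (i + 1) = f i)
    (i : ZMod N) : f i = f 0 := by
  have : ∀ n : ℕ, f (n : ZMod N) = f 0 := by
    intro n
    induction n with
    | zero => simp
    | succ n ih => rw [Nat.cast_succ, h, ih]
  simpa using this i.val

/-- The inverse of `2` in `ℤ/N`, for odd `N`. -/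
def half (N : ℕ) : ZMod N := ((N + 1) / 2 : ℕ)

theorem two_mul_half (hN : Odd N) : 2 * half N = 1 := by
  obtain ⟨m, rfl⟩ := hN
  have h : (2 * m + 1 + 1) / 2 = m + 1 := by omega
  have h2 : ((2 * m + 1 : ℕ) : ZMod (2 * m + 1)) = 0 := ZMod.natCast_self _
  rw [half, h]
  push_cast at h2 ⊢
  linear_combination h2

/-- Both sides obey the same recursion in `m` and agree at `0`. With `half N` in place of division
by `2`, identities between Gaussian factors become polynomial identities in `ℤ/N`, settled by
`two_mul_half`. -/
theorem phi_eq [NeZero N] (hN : Odd N) (hϖ : IsPrimitiveRoot ϖ N) (m : ZMod N) :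
    phi ϖ m = chi ϖ (half N * (m * (m - 1))) := by
  have h : phi ϖ m * chi ϖ (-(half N * (m * (m - 1)))) = 1 := by
    rw [eq_apply_zero_of_add_one (f := fun m : ZMod N =>
      phi ϖ m * chi ϖ (-(half N * (m * (m - 1))))) (fun i => ?_) m]
    · simp [phi, chi_zero]
    · rw [phi_add_one hN hϖ]
      change chi ϖ i * _ * _ = _
      rw [mul_comm (chi ϖ i), mul_assoc, ← chi_add hϖ]
      congr 2
      linear_combination (-i) * two_mul_half hN
  rw [chi_neg hϖ] at h
  exact eq_of_mul_inv_eq_one h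

theorem phi_ne_zero [NeZero N] (hϖ : IsPrimitiveRoot ϖ N) (m : ZMod N) : phi ϖ m ≠ 0 :=
  pow_ne_zero _ (root_ne_zero hϖ)

theorem sum_univ_zmod [NeZero N] (hN : Odd N) : ∑ i : ZMod N, i = 0 := by
  have h1 : ∑ i : ZMod N, i = -∑ i : ZMod N, i := by
    rw [← Finset.sum_neg_distrib, ← Equiv.sum_comp (Equiv.neg (ZMod N))]; rfl
  linear_combination half N * h1 - (∑ i : ZMod N, i) * two_mul_half hN

theorem prod_chi [NeZero N] (hϖ : IsPrimitiveRoot ϖ N) (f : ZMod N → ZMod N) :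
    ∏ i, chi ϖ (f i) = chi ϖ (∑ i, f i) := by
  classical
  induction (Finset.univ : Finset (ZMod N)) using Finset.induction_on with
  | empty => simp [chi_zero]
  | insert a s ha ih => rw [Finset.prod_insert ha, Finset.sum_insert ha, chi_add hϖ, ih]

end Borel

namespace BialgMod

variable {k : Type u} {B : Type v} [Field k] [Ring B] [Bialgebra k B] {X Y Z : BialgMod k B}

theorem linMap_whiskerLeft (f : Y ⟶ Z) :
    linMap (X ◁ f) = TensorProduct.map LinearMap.id (linMap f) := rfl

end BialgMod

namespace Borel

open BialgMod

variable {N : ℕ} [NeZero N] {ϖ : ℂ}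

/-! ### Coordinates in `ℂ^N ⊗ ℂ^N` -/

/-- The coordinate of `z ∈ ℂ^N ⊗ ℂ^N` at `e_i ⊗ e_j`. -/
noncomputable def tcoord (i j : ZMod N) : (ZMod N → ℂ) ⊗[ℂ] (ZMod N → ℂ) →ₗ[ℂ] ℂ :=
  LinearMap.mul' ℂ ℂ ∘ₗ TensorProduct.map (LinearMap.proj i) (LinearMap.proj j)

theorem tcoord_tmul (i j : ZMod N) (f h : ZMod N → ℂ) : tcoord i j (f ⊗ₜ h) = f i * h j := rfl

theorem sum_basisVec (f : ZMod N → ℂ) : ∑ i, f i • (basisVec i : ZMod N → ℂ) = f := by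
  funext j
  simp [basisVec, Finset.sum_apply, Pi.single_apply]

theorem basisVec_apply (i j : ZMod N) : (basisVec i : ZMod N → ℂ) j = if j = i then 1 else 0 := by
  simp [basisVec, Pi.single_apply]

theorem sum_tcoord (z : (ZMod N → ℂ) ⊗[ℂ] (ZMod N → ℂ)) :
    ∑ i, ∑ j, tcoord i j z • (basisVec i : ZMod N → ℂ) ⊗ₜ[ℂ] (basisVec j : ZMod N → ℂ) = z := by
  induction z with
  | zero => simp
  | add a b ha hb =>
    simp only [map_add, add_smul, Finset.sum_add_distrib, ha, hb]
  | tmul f h =>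
    conv_rhs => rw [← sum_basisVec f, ← sum_basisVec h, TensorProduct.sum_tmul]
    refine Finset.sum_congr rfl fun i _ => ?_
    rw [TensorProduct.tmul_sum]
    refine Finset.sum_congr rfl fun j _ => ?_
    rw [TensorProduct.smul_tmul_smul, tcoord_tmul]

theorem tensor_ext {z z' : (ZMod N → ℂ) ⊗[ℂ] (ZMod N → ℂ)}
    (h : ∀ i j, tcoord i j z = tcoord i j z') : z = z' := by
  rw [← sum_tcoord z, ← sum_tcoord z']
  simp only [h]

theorem ext_basisVec {M : Type*} [AddCommMonoid M] [Module ℂ M] {f f' : (ZMod N → ℂ) →ₗ[ℂ] M}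
    (h : ∀ i, f (basisVec i) = f' (basisVec i)) : f = f' := by
  ext x
  exact h x

theorem ext_basisVec_tmul {M : Type*} [AddCommMonoid M] [Module ℂ M]
    {f f' : (ZMod N → ℂ) ⊗[ℂ] (ZMod N → ℂ) →ₗ[ℂ] M}
    (h : ∀ i j, f (basisVec i ⊗ₜ basisVec j) = f' (basisVec i ⊗ₜ basisVec j)) : f = f' := by
  ext x y
  exact h x y

/-- The linear map `ℂ^N ⊗ ℂ^N → ℂ^N` with given matrix. -/
noncomputable def linOfLow (c : ZMod N → ZMod N → ZMod N → ℂ) :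
    (ZMod N → ℂ) ⊗[ℂ] (ZMod N → ℂ) →ₗ[ℂ] (ZMod N → ℂ) :=
  ∑ i, ∑ j, (tcoord i j).smulRight (c i j)

theorem linOfLow_basisVec (c : ZMod N → ZMod N → ZMod N → ℂ) (i j : ZMod N) :
    linOfLow c (basisVec i ⊗ₜ basisVec j) = c i j := by
  simp only [linOfLow, LinearMap.sum_apply, LinearMap.smulRight_apply, tcoord_tmul,
    basisVec_apply]
  simp

/-- The linear map `ℂ^N → ℂ^N ⊗ ℂ^N` with given matrix. -/
noncomputable def linOfUp (c : ZMod N → ZMod N → ZMod N → ℂ) :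
    (ZMod N → ℂ) →ₗ[ℂ] (ZMod N → ℂ) ⊗[ℂ] (ZMod N → ℂ) :=
  ∑ i, ∑ j, (∑ k, c i j k • LinearMap.proj k).smulRight (basisVec i ⊗ₜ basisVec j)

theorem tcoord_linOfUp (c : ZMod N → ZMod N → ZMod N → ℂ) (i j k : ZMod N) :
    tcoord i j (linOfUp c (basisVec k)) = c i j k := by
  simp only [linOfUp, LinearMap.sum_apply, LinearMap.smulRight_apply, map_sum, map_smul,
    tcoord_tmul, basisVec_apply, LinearMap.smul_apply, LinearMap.proj_apply]
  simp

theorem opX_apply (f : ZMod N → ℂ) (i : ZMod N) : opX N ϖ f i = chi ϖ i * f i := rfl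

theorem opY_apply (f : ZMod N → ℂ) (i : ZMod N) : opY N f i = f (i - 1) := rfl

theorem tcoord_map_X_X (i j : ZMod N) (z : (ZMod N → ℂ) ⊗[ℂ] (ZMod N → ℂ)) :
    tcoord i j (TensorProduct.map (opX N ϖ) (opX N ϖ) z) =
      chi ϖ i * chi ϖ j * tcoord i j z := by
  induction z with
  | zero => simp
  | add a b ha hb => simp only [map_add, ha, hb, mul_add]
  | tmul f h => simp only [TensorProduct.map_tmul, tcoord_tmul, opX_apply]; ring

theorem tcoord_map_X_Y (i j : ZMod N) (z : (ZMod N → ℂ) ⊗[ℂ] (ZMod N → ℂ)) :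
    tcoord i j (TensorProduct.map (opX N ϖ) (opY N) z) = chi ϖ i * tcoord i (j - 1) z := by
  induction z with
  | zero => simp
  | add a b ha hb => simp only [map_add, ha, hb, mul_add]
  | tmul f h => simp only [TensorProduct.map_tmul, tcoord_tmul, opX_apply, opY_apply]; ring

theorem tcoord_map_Y_id (i j : ZMod N) (z : (ZMod N → ℂ) ⊗[ℂ] (ZMod N → ℂ)) :
    tcoord i j (TensorProduct.map (opY N) LinearMap.id z) = tcoord (i - 1) j z := by
  induction z with
  | zero => simp
  | add a b ha hb => simp only [map_add, ha, hb]
  | tmul f h => simp only [TensorProduct.map_tmul, tcoord_tmul, opY_apply, LinearMap.id_apply]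

/-! ### Coordinates of morphisms -/

section Coord

variable {hϖ : IsPrimitiveRoot ϖ N} {g h l : HalfPlane}

/-- The matrix coefficients of a morphism `V_g ⊗ V_h → V_l`. -/
noncomputable def lowCoord (f : cyclicMod N hϖ g ⊗ cyclicMod N hϖ h ⟶ cyclicMod N hϖ l)
    (i j k : ZMod N) : ℂ :=
  (linMap f : (ZMod N → ℂ) ⊗[ℂ] (ZMod N → ℂ) →ₗ[ℂ] (ZMod N → ℂ)) (basisVec i ⊗ₜ basisVec j) k

/-- The matrix coefficients of a morphism `V_l → V_g ⊗ V_h`. -/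
noncomputable def upCoord (f : cyclicMod N hϖ l ⟶ cyclicMod N hϖ g ⊗ cyclicMod N hϖ h)
    (i j k : ZMod N) : ℂ :=
  tcoord i j ((linMap f : (ZMod N → ℂ) →ₗ[ℂ] (ZMod N → ℂ) ⊗[ℂ] (ZMod N → ℂ)) (basisVec k))

theorem low_ext {f f' : cyclicMod N hϖ g ⊗ cyclicMod N hϖ h ⟶ cyclicMod N hϖ l}
    (H : ∀ i j k, lowCoord f i j k = lowCoord f' i j k) : f = f' :=
  hom_ext (ext_basisVec_tmul fun i j => funext fun k => H i j k)

theorem up_ext {f f' : cyclicMod N hϖ l ⟶ cyclicMod N hϖ g ⊗ cyclicMod N hϖ h}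
    (H : ∀ i j k, upCoord f i j k = upCoord f' i j k) : f = f' :=
  hom_ext (ext_basisVec fun k => tensor_ext fun i j => H i j k)

theorem act_a (g : HalfPlane) (f : ZMod N → ℂ) :
    cyclicAct N hϖ g (BorelAlg.gen ϖ .a) f = (g.rootU N : ℂ) • opX N ϖ f := by
  rw [cyclicAct_a]; rfl

theorem act_b (g : HalfPlane) (f : ZMod N → ℂ) :
    cyclicAct N hϖ g (BorelAlg.gen ϖ .b) f = (g.rootV N : ℂ) • opY N f := by
  rw [cyclicAct_b]; rfl

theorem tensor_act_a (g h : HalfPlane) (z : (ZMod N → ℂ) ⊗[ℂ] (ZMod N → ℂ)) :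
    BialgAct.tensor (cyclicAct N hϖ g) (cyclicAct N hϖ h) (BorelAlg.gen ϖ .a) z =
      ((g.rootU N : ℂ) * h.rootU N) • TensorProduct.map (opX N ϖ) (opX N ϖ) z := by
  rw [tensor_a, cyclicAct_a, cyclicAct_a, TensorProduct.map_smul_left,
    TensorProduct.map_smul_right, smul_smul]
  rfl

theorem tensor_act_b (g h : HalfPlane) (z : (ZMod N → ℂ) ⊗[ℂ] (ZMod N → ℂ)) :
    BialgAct.tensor (cyclicAct N hϖ g) (cyclicAct N hϖ h) (BorelAlg.gen ϖ .b) z =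
      ((g.rootU N : ℂ) * h.rootV N) • TensorProduct.map (opX N ϖ) (opY N) z +
        (g.rootV N : ℂ) • TensorProduct.map (opY N) LinearMap.id z := by
  rw [tensor_b, cyclicAct_a, cyclicAct_b, cyclicAct_b, TensorProduct.map_smul_left,
    TensorProduct.map_smul_right, smul_smul, TensorProduct.map_smul_left]
  rfl

theorem lowCoord_a (f : cyclicMod N hϖ g ⊗ cyclicMod N hϖ h ⟶ cyclicMod N hϖ l)
    (i j k : ZMod N) :
    (l.rootU N : ℂ) * chi ϖ k * lowCoord f i j k =
      (g.rootU N : ℂ) * h.rootU N * (chi ϖ i * chi ϖ j) * lowCoord f i j k := by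
  have H := congrFun (LinearMap.congr_fun (linMap_comm f (BorelAlg.gen ϖ .a))
    ((basisVec i : ZMod N → ℂ) ⊗ₜ[ℂ] (basisVec j : ZMod N → ℂ))) k
  change linMap f (BialgAct.tensor (cyclicAct N hϖ g) (cyclicAct N hϖ h) (BorelAlg.gen ϖ .a) _) k
    = cyclicAct N hϖ l (BorelAlg.gen ϖ .a) (linMap f _) k at H
  rw [tensor_act_a, act_a, TensorProduct.map_tmul, opX_basisVec, opX_basisVec,
    TensorProduct.smul_tmul_smul, smul_smul, map_smul] at H
  change _ * lowCoord f i j k = (l.rootU N : ℂ) * (chi ϖ k * lowCoord f i j k) at H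
  rw [mul_assoc, ← H]; rfl

theorem lowCoord_b (f : cyclicMod N hϖ g ⊗ cyclicMod N hϖ h ⟶ cyclicMod N hϖ l)
    (i j k : ZMod N) :
    (l.rootV N : ℂ) * lowCoord f i j (k - 1) =
      (g.rootU N : ℂ) * h.rootV N * chi ϖ i * lowCoord f i (j + 1) k +
        g.rootV N * lowCoord f (i + 1) j k := by
  have H := congrFun (LinearMap.congr_fun (linMap_comm f (BorelAlg.gen ϖ .b))
    ((basisVec i : ZMod N → ℂ) ⊗ₜ[ℂ] (basisVec j : ZMod N → ℂ))) k
  change linMap f (BialgAct.tensor (cyclicAct N hϖ g) (cyclicAct N hϖ h) (BorelAlg.gen ϖ .b) _) k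
    = cyclicAct N hϖ l (BorelAlg.gen ϖ .b) (linMap f _) k at H
  rw [tensor_act_b, act_b, TensorProduct.map_tmul, TensorProduct.map_tmul, opX_basisVec,
    opY_basisVec, opY_basisVec, ← TensorProduct.smul_tmul', smul_smul, map_add, map_smul,
    map_smul] at H
  exact H.symm

theorem upCoord_a (f : cyclicMod N hϖ l ⟶ cyclicMod N hϖ g ⊗ cyclicMod N hϖ h)
    (i j k : ZMod N) :
    (l.rootU N : ℂ) * chi ϖ k * upCoord f i j k =
      (g.rootU N : ℂ) * h.rootU N * (chi ϖ i * chi ϖ j) * upCoord f i j k := by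
  have H := congrArg (tcoord i j) (LinearMap.congr_fun (linMap_comm f (BorelAlg.gen ϖ .a))
    (basisVec k : ZMod N → ℂ))
  change tcoord i j (linMap f (cyclicAct N hϖ l (BorelAlg.gen ϖ .a) _)) = tcoord i j
    (BialgAct.tensor (cyclicAct N hϖ g) (cyclicAct N hϖ h) (BorelAlg.gen ϖ .a) (linMap f _)) at H
  rw [tensor_act_a, act_a, opX_basisVec, map_smul, map_smul, map_smul, map_smul, map_smul,
    tcoord_map_X_X] at H
  change (l.rootU N : ℂ) * (chi ϖ k * upCoord f i j k) =
    (g.rootU N : ℂ) * h.rootU N * (chi ϖ i * chi ϖ j * upCoord f i j k) at H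
  rw [mul_assoc, H]; ring

theorem upCoord_b (f : cyclicMod N hϖ l ⟶ cyclicMod N hϖ g ⊗ cyclicMod N hϖ h)
    (i j k : ZMod N) :
    (l.rootV N : ℂ) * upCoord f i j (k + 1) =
      (g.rootU N : ℂ) * h.rootV N * chi ϖ i * upCoord f i (j - 1) k +
        g.rootV N * upCoord f (i - 1) j k := by
  have H := congrArg (tcoord i j) (LinearMap.congr_fun (linMap_comm f (BorelAlg.gen ϖ .b))
    (basisVec k : ZMod N → ℂ))
  change tcoord i j (linMap f (cyclicAct N hϖ l (BorelAlg.gen ϖ .b) _)) = tcoord i j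
    (BialgAct.tensor (cyclicAct N hϖ g) (cyclicAct N hϖ h) (BorelAlg.gen ϖ .b) (linMap f _)) at H
  rw [tensor_act_b, act_b, opY_basisVec, map_smul, map_smul, map_add, map_smul, map_smul,
    tcoord_map_X_Y, tcoord_map_Y_id] at H
  change (l.rootV N : ℂ) * upCoord f i j (k + 1) =
    (g.rootU N : ℂ) * h.rootV N * (chi ϖ i * upCoord f i (j - 1) k) +
      g.rootV N * upCoord f (i - 1) j k at H
  rw [H]; ring

/-- The morphism `V_g ⊗ V_h → V_l` with given matrix coefficients. -/
noncomputable def lowOf (c : ZMod N → ZMod N → ZMod N → ℂ)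
    (ha : ∀ i j k, (l.rootU N : ℂ) * chi ϖ k * c i j k =
      (g.rootU N : ℂ) * h.rootU N * (chi ϖ i * chi ϖ j) * c i j k)
    (hb : ∀ i j k, (l.rootV N : ℂ) * c i j (k - 1) =
      (g.rootU N : ℂ) * h.rootV N * chi ϖ i * c i (j + 1) k + g.rootV N * c (i + 1) j k) :
    cyclicMod N hϖ g ⊗ cyclicMod N hϖ h ⟶ cyclicMod N hϖ l :=
  ofLin (X := cyclicMod N hϖ g ⊗ cyclicMod N hϖ h) (linOfLow c) <| by
    refine comm_of_gen (ϖ := ϖ) _ _ _ ?_ ?_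
    · refine ext_basisVec_tmul fun i j => funext fun k => ?_
      change linOfLow c (BialgAct.tensor (cyclicAct N hϖ g) (cyclicAct N hϖ h) (BorelAlg.gen ϖ .a)
        _) k = cyclicAct N hϖ l (BorelAlg.gen ϖ .a) (linOfLow c _) k
      rw [tensor_act_a, act_a, TensorProduct.map_tmul, opX_basisVec, opX_basisVec,
        TensorProduct.smul_tmul_smul, smul_smul, map_smul, linOfLow_basisVec]
      change _ * c i j k = (l.rootU N : ℂ) * (chi ϖ k * c i j k)
      rw [← mul_assoc (l.rootU N : ℂ), ha]; rfl
    · refine ext_basisVec_tmul fun i j => funext fun k => ?_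
      change linOfLow c (BialgAct.tensor (cyclicAct N hϖ g) (cyclicAct N hϖ h) (BorelAlg.gen ϖ .b)
        _) k = cyclicAct N hϖ l (BorelAlg.gen ϖ .b) (linOfLow c _) k
      rw [tensor_act_b, act_b, TensorProduct.map_tmul, TensorProduct.map_tmul, opX_basisVec,
        opY_basisVec, opY_basisVec, ← TensorProduct.smul_tmul', smul_smul, map_add, map_smul,
        map_smul]
      simp only [LinearMap.id_apply, linOfLow_basisVec]
      exact (hb i j k).symm

theorem lowCoord_lowOf (c : ZMod N → ZMod N → ZMod N → ℂ) (ha hb) (i j k : ZMod N) :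
    lowCoord (lowOf (hϖ := hϖ) (g := g) (h := h) (l := l) c ha hb) i j k = c i j k :=
  congrFun (linOfLow_basisVec c i j) k

/-- The morphism `V_l → V_g ⊗ V_h` with given matrix coefficients. -/
noncomputable def upOf (c : ZMod N → ZMod N → ZMod N → ℂ)
    (ha : ∀ i j k, (l.rootU N : ℂ) * chi ϖ k * c i j k =
      (g.rootU N : ℂ) * h.rootU N * (chi ϖ i * chi ϖ j) * c i j k)
    (hb : ∀ i j k, (l.rootV N : ℂ) * c i j (k + 1) =
      (g.rootU N : ℂ) * h.rootV N * chi ϖ i * c i (j - 1) k + g.rootV N * c (i - 1) j k) :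
    cyclicMod N hϖ l ⟶ cyclicMod N hϖ g ⊗ cyclicMod N hϖ h :=
  ofLin (Y := cyclicMod N hϖ g ⊗ cyclicMod N hϖ h) (linOfUp c) <| by
    refine comm_of_gen (ϖ := ϖ) _ _ _ ?_ ?_
    · refine ext_basisVec fun k => tensor_ext fun i j => ?_
      change tcoord i j (linOfUp c (cyclicAct N hϖ l (BorelAlg.gen ϖ .a) _)) = tcoord i j
        (BialgAct.tensor (cyclicAct N hϖ g) (cyclicAct N hϖ h) (BorelAlg.gen ϖ .a) (linOfUp c _))
      rw [tensor_act_a, act_a, opX_basisVec, map_smul, map_smul, map_smul, map_smul, map_smul,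
        tcoord_map_X_X, tcoord_linOfUp]
      change (l.rootU N : ℂ) * (chi ϖ k * c i j k) =
        (g.rootU N : ℂ) * h.rootU N * (chi ϖ i * chi ϖ j * c i j k)
      rw [← mul_assoc, ha]; ring
    · refine ext_basisVec fun k => tensor_ext fun i j => ?_
      change tcoord i j (linOfUp c (cyclicAct N hϖ l (BorelAlg.gen ϖ .b) _)) = tcoord i j
        (BialgAct.tensor (cyclicAct N hϖ g) (cyclicAct N hϖ h) (BorelAlg.gen ϖ .b) (linOfUp c _))
      rw [tensor_act_b, act_b, opY_basisVec, map_smul, map_smul, map_add, map_smul, map_smul,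
        tcoord_map_X_Y, tcoord_map_Y_id, tcoord_linOfUp, tcoord_linOfUp, tcoord_linOfUp]
      change (l.rootV N : ℂ) * c i j (k + 1) =
        (g.rootU N : ℂ) * h.rootV N * (chi ϖ i * c i (j - 1) k) + g.rootV N * c (i - 1) j k
      rw [hb]; ring

theorem upCoord_upOf (c : ZMod N → ZMod N → ZMod N → ℂ) (ha hb) (i j k : ZMod N) :
    upCoord (upOf (hϖ := hϖ) (g := g) (h := h) (l := l) c ha hb) i j k = c i j k :=
  tcoord_linOfUp c i j k

/-- Taking absolute values removes the roots of unity and compares the positive reals `u`; what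
remains compares characters, and `χ` is injective. -/
theorem eq_of_weight (hϖ : IsPrimitiveRoot ϖ N) {i j k : ZMod N} {c : ℂ} (hc : c ≠ 0)
    (H : (l.rootU N : ℂ) * chi ϖ k * c =
      (g.rootU N : ℂ) * h.rootU N * (chi ϖ i * chi ϖ j) * c) :
    k = i + j ∧ l.rootU N = g.rootU N * h.rootU N := by
  have H1 := mul_right_cancel₀ hc H
  have H2 := congrArg norm H1
  simp only [norm_mul, norm_chi hϖ, mul_one, Complex.norm_real, Real.norm_eq_abs,
    abs_of_pos (HalfPlane.rootU_pos N _)] at H2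
  refine ⟨?_, H2⟩
  rw [← chi_add hϖ, H2, Complex.ofReal_mul] at H1
  exact chi_injective hϖ (mul_left_cancel₀
    (mul_ne_zero (HalfPlane.rootU_ne N g) (HalfPlane.rootU_ne N h)) H1)

theorem lowCoord_support {f : cyclicMod N hϖ g ⊗ cyclicMod N hϖ h ⟶ cyclicMod N hϖ l}
    {i j k : ZMod N} (hc : lowCoord f i j k ≠ 0) :
    k = i + j ∧ l.rootU N = g.rootU N * h.rootU N := eq_of_weight hϖ hc (lowCoord_a f i j k)

theorem upCoord_support {f : cyclicMod N hϖ l ⟶ cyclicMod N hϖ g ⊗ cyclicMod N hϖ h}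
    {i j k : ZMod N} (hc : upCoord f i j k ≠ 0) :
    k = i + j ∧ l.rootU N = g.rootU N * h.rootU N := eq_of_weight hϖ hc (upCoord_a f i j k)

theorem lowCoord_add (f f' : cyclicMod N hϖ g ⊗ cyclicMod N hϖ h ⟶ cyclicMod N hϖ l)
    (i j k : ZMod N) : lowCoord (f + f') i j k = lowCoord f i j k + lowCoord f' i j k := rfl

theorem lowCoord_smul (c : ℂ) (f : cyclicMod N hϖ g ⊗ cyclicMod N hϖ h ⟶ cyclicMod N hϖ l)
    (i j k : ZMod N) : lowCoord (c • f) i j k = c * lowCoord f i j k := rfl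

theorem lowCoord_zero (i j k : ZMod N) :
    lowCoord (0 : cyclicMod N hϖ g ⊗ cyclicMod N hϖ h ⟶ cyclicMod N hϖ l) i j k = 0 := rfl

theorem upCoord_add (f f' : cyclicMod N hϖ l ⟶ cyclicMod N hϖ g ⊗ cyclicMod N hϖ h)
    (i j k : ZMod N) : upCoord (f + f') i j k = upCoord f i j k + upCoord f' i j k :=
  map_add (tcoord i j) _ _

theorem upCoord_smul (c : ℂ) (f : cyclicMod N hϖ l ⟶ cyclicMod N hϖ g ⊗ cyclicMod N hϖ h)
    (i j k : ZMod N) : upCoord (c • f) i j k = c * upCoord f i j k :=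
  map_smul (tcoord i j) _ _

theorem upCoord_zero (i j k : ZMod N) :
    upCoord (0 : cyclicMod N hϖ l ⟶ cyclicMod N hϖ g ⊗ cyclicMod N hϖ h) i j k = 0 :=
  map_zero (tcoord i j)

end Coord

end Borel

namespace Borel

open BialgMod

variable {N : ℕ} [NeZero N] {ϖ : ℂ} {hN : Odd N} {hϖ : IsPrimitiveRoot ϖ N}

/-! ### The operators `A` and `B` in coordinates -/

/-- All `V_g` share the carrier `ℂ^N`, so rewriting along `g** = g` changes no coordinates. -/
theorem linMap_eqToHom {g h : BorelIdx} (e : g = h) :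
    linMap (eqToHom (congrArg (psiData N hN hϖ).V e)) =
      (LinearMap.id : (ZMod N → ℂ) →ₗ[ℂ] (ZMod N → ℂ)) := by
  subst e; rfl

theorem linMap_bStar (g : BorelIdx) :
    linMap ((psiData N hN hϖ).bStar g) = coevLin N ϖ := by
  rw [PsiData.bStar, linMap_comp, linMap_whiskerLeft,
    linMap_eqToHom ((psiData N hN hϖ).star_star g)]
  erw [TensorProduct.map_id]
  rfl

theorem linMap_dStar (g : BorelIdx) :
    linMap ((psiData N hN hϖ).dStar g) = evLin N ϖ := by
  rw [PsiData.dStar, linMap_comp, linMap_whiskerLeft,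
    linMap_eqToHom ((psiData N hN hϖ).star_star g).symm]
  erw [TensorProduct.map_id]
  rfl

theorem coevLin_one :
    coevLin N ϖ 1 = ∑ i : ZMod N, (phi ϖ (-i))⁻¹ • basisVec i ⊗ₜ basisVec (-i) := by
  rw [coevLin, LinearMap.toSpanSingleton_apply, one_smul]

theorem tcoord_coev_left (x : (ZMod N → ℂ) ⊗[ℂ] (ZMod N → ℂ) →ₗ[ℂ] (ZMod N → ℂ))
    (i j k : ZMod N) :
    tcoord i j (TensorProduct.map LinearMap.id x (TensorProduct.assoc ℂ _ _ _
      (coevLin N ϖ 1 ⊗ₜ[ℂ] basisVec k))) =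
      (phi ϖ (-i))⁻¹ * x (basisVec (-i) ⊗ₜ basisVec k) j := by
  simp only [coevLin_one, TensorProduct.sum_tmul, map_sum, ← TensorProduct.smul_tmul', map_smul,
    TensorProduct.assoc_tmul, TensorProduct.map_tmul, tcoord_tmul, LinearMap.id_apply,
    basisVec_apply, smul_eq_mul]
  rw [Finset.sum_eq_single i]
  · simp
  · intro m _ hm; simp [Ne.symm hm]
  · simp

theorem tcoord_coev_right (x : (ZMod N → ℂ) ⊗[ℂ] (ZMod N → ℂ) →ₗ[ℂ] (ZMod N → ℂ))
    (i j k : ZMod N) :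
    tcoord i j (TensorProduct.map x LinearMap.id ((TensorProduct.assoc ℂ _ _ _).symm
      (basisVec k ⊗ₜ[ℂ] coevLin N ϖ 1))) =
      (phi ϖ j)⁻¹ * x (basisVec k ⊗ₜ basisVec (-j)) i := by
  simp only [coevLin_one, TensorProduct.tmul_sum, map_sum, TensorProduct.tmul_smul, map_smul,
    TensorProduct.assoc_symm_tmul, TensorProduct.map_tmul, tcoord_tmul, LinearMap.id_apply,
    basisVec_apply, smul_eq_mul]
  rw [Finset.sum_eq_single (-j)]
  · simp
  · intro m _ hm
    rw [if_neg, mul_zero, mul_zero]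
    rintro rfl; simp at hm
  · simp

theorem ev_left_apply (z : (ZMod N → ℂ) ⊗[ℂ] (ZMod N → ℂ)) (i k : ZMod N) :
    TensorProduct.lid ℂ (ZMod N → ℂ) (TensorProduct.map (evLin N ϖ) LinearMap.id
      ((TensorProduct.assoc ℂ _ _ _).symm ((basisVec i : ZMod N → ℂ) ⊗ₜ[ℂ] z))) k =
      phi ϖ i * tcoord (-i) k z := by
  induction z with
  | zero => simp
  | add a b ha hb =>
    rw [TensorProduct.tmul_add, map_add, map_add, map_add, Pi.add_apply, ha, hb, map_add, mul_add]
  | tmul f f' =>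
    rw [TensorProduct.assoc_symm_tmul, TensorProduct.map_tmul, TensorProduct.lid_tmul,
      Pi.smul_apply, smul_eq_mul, LinearMap.id_apply, tcoord_tmul, evLin_tmul,
      Finset.sum_eq_single i]
    · simp [basisVec_apply]; ring
    · intro m _ hm; simp [basisVec_apply, hm]
    · simp

theorem ev_right_apply (z : (ZMod N → ℂ) ⊗[ℂ] (ZMod N → ℂ)) (j k : ZMod N) :
    TensorProduct.rid ℂ (ZMod N → ℂ) (TensorProduct.map LinearMap.id (evLin N ϖ)
      ((TensorProduct.assoc ℂ _ _ _) (z ⊗ₜ[ℂ] (basisVec j : ZMod N → ℂ)))) k =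
      phi ϖ (-j) * tcoord k (-j) z := by
  induction z with
  | zero =>
    rw [TensorProduct.zero_tmul, LinearEquiv.map_zero, LinearMap.map_zero, LinearEquiv.map_zero,
      LinearMap.map_zero, mul_zero]
    rfl
  | add a b ha hb =>
    rw [TensorProduct.add_tmul, map_add, map_add, map_add, Pi.add_apply, ha, hb, map_add, mul_add]
  | tmul f f' =>
    rw [TensorProduct.assoc_tmul, TensorProduct.map_tmul, TensorProduct.rid_tmul,
      Pi.smul_apply, smul_eq_mul, LinearMap.id_apply, tcoord_tmul, evLin_tmul,
      Finset.sum_eq_single (-j)]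
    · simp [basisVec_apply]; ring
    · intro m _ hm
      rw [basisVec_apply, if_neg, mul_zero]
      rintro rfl; simp at hm
    · simp

section

variable {g h l : BorelIdx}

/-- This and the next three formulas reduce every identity between `A` and `B` to a permutation of
indices and a comparison of factors `φ`. -/
theorem upCoord_aLow (x : (psiData N hN hϖ).V g ⊗ (psiData N hN hϖ).V h ⟶ (psiData N hN hϖ).V l)
    (i j k : ZMod N) :
    upCoord ((psiData N hN hϖ).aLow ℂ g h l x) i j k =
      (phi ϖ (-i))⁻¹ * lowCoord x (-i) k j := by
  refine Eq.trans ?_ (tcoord_coev_left (linMap x) i j k)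
  rw [← linMap_bStar (hN := hN) (hϖ := hϖ) g]
  rfl

theorem upCoord_bLow (x : (psiData N hN hϖ).V g ⊗ (psiData N hN hϖ).V h ⟶ (psiData N hN hϖ).V l)
    (i j k : ZMod N) :
    upCoord ((psiData N hN hϖ).bLow ℂ g h l x) i j k =
      (phi ϖ j)⁻¹ * lowCoord x k (-j) i :=
  tcoord_coev_right (linMap x) i j k

theorem lowCoord_aUp (y : (psiData N hN hϖ).V l ⟶ (psiData N hN hϖ).V g ⊗ (psiData N hN hϖ).V h)
    (i j k : ZMod N) :
    lowCoord ((psiData N hN hϖ).aUp ℂ g h l y) i j k = phi ϖ i * upCoord y (-i) k j := by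
  refine Eq.trans ?_ (ev_left_apply (linMap y (basisVec j)) i k)
  rw [← linMap_dStar (hN := hN) (hϖ := hϖ) g]
  rfl

theorem lowCoord_bUp (y : (psiData N hN hϖ).V l ⟶ (psiData N hN hϖ).V g ⊗ (psiData N hN hϖ).V h)
    (i j k : ZMod N) :
    lowCoord ((psiData N hN hϖ).bUp ℂ g h l y) i j k = phi ϖ (-j) * upCoord y k (-j) i :=
  ev_right_apply (linMap y (basisVec i)) j k

end

/-! ### The operators `r` and `s` -/

section RS

variable {g h l : HalfPlane}

/-- The operator `x ↦ Y⁻¹ x (Y ⊗ X)` on `Hom(V_g ⊗ V_h, V_l)`. -/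
noncomputable def rLow : Module.End ℂ (cyclicMod N hϖ g ⊗ cyclicMod N hϖ h ⟶ cyclicMod N hϖ l) where
  toFun x := lowOf (fun i j k => chi ϖ j * lowCoord x (i + 1) j (k + 1))
    (fun i j k => by
      have H := lowCoord_a x (i + 1) j (k + 1)
      rw [chi_add hϖ, chi_add hϖ] at H
      have h1 := chi_ne_zero hϖ (1 : ZMod N)
      -- Shifting both `i` and `k` by one multiplies the two sides of the weight equation by the
      -- same factor `χ(1)`.
      apply mul_left_cancel₀ h1
      linear_combination chi ϖ j * H)
    (fun i j k => by
      have H := lowCoord_b x (i + 1) j (k + 1)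
      rw [chi_add hϖ, add_sub_right_comm] at H
      rw [chi_add hϖ j]
      linear_combination chi ϖ j * H)
  map_add' x y := low_ext fun i j k => by
    simp only [lowCoord_add, lowCoord_lowOf]; ring
  map_smul' c x := low_ext fun i j k => by
    simp only [lowCoord_smul, lowCoord_lowOf, RingHom.id_apply]; ring

/-- The operator `x ↦ Y⁻¹ x (1 ⊗ Y)` on `Hom(V_g ⊗ V_h, V_l)`. -/
noncomputable def sLow : Module.End ℂ (cyclicMod N hϖ g ⊗ cyclicMod N hϖ h ⟶ cyclicMod N hϖ l) where
  toFun x := lowOf (fun i j k => lowCoord x i (j + 1) (k + 1))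
    (fun i j k => by
      have H := lowCoord_a x i (j + 1) (k + 1)
      rw [chi_add hϖ, chi_add hϖ] at H
      have h1 := chi_ne_zero hϖ (1 : ZMod N)
      apply mul_left_cancel₀ h1
      linear_combination H)
    (fun i j k => by
      have H := lowCoord_b x i (j + 1) (k + 1)
      rw [add_sub_right_comm] at H
      exact H)
  map_add' x y := low_ext fun i j k => by
    simp only [lowCoord_add, lowCoord_lowOf]
  map_smul' c x := low_ext fun i j k => by
    simp only [lowCoord_smul, lowCoord_lowOf, RingHom.id_apply]

/-- The operator `y ↦ (Y ⊗ X) y Y⁻¹` on `Hom(V_l, V_g ⊗ V_h)`. -/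
noncomputable def rUp : Module.End ℂ (cyclicMod N hϖ l ⟶ cyclicMod N hϖ g ⊗ cyclicMod N hϖ h) where
  toFun y := upOf (fun i j k => chi ϖ j * upCoord y (i - 1) j (k - 1))
    (fun i j k => by
      have H := upCoord_a y (i - 1) j (k - 1)
      rw [sub_eq_add_neg, sub_eq_add_neg, chi_add hϖ, chi_add hϖ] at H
      have h1 := chi_ne_zero hϖ (-1 : ZMod N)
      apply mul_left_cancel₀ h1
      rw [sub_eq_add_neg, sub_eq_add_neg]
      linear_combination chi ϖ j * H)
    (fun i j k => by
      have H := upCoord_b y (i - 1) j (k - 1)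
      have e : chi ϖ i * chi ϖ (j - 1) = chi ϖ j * chi ϖ (i - 1) := by
        rw [← chi_add hϖ, ← chi_add hϖ]; congr 1; ring
      rw [sub_add_cancel] at H
      rw [add_sub_cancel_right]
      linear_combination chi ϖ j * H - (g.rootU N : ℂ) * h.rootV N *
        upCoord y (i - 1) (j - 1) (k - 1) * e)
  map_add' x y := up_ext fun i j k => by
    simp only [upCoord_add, upCoord_upOf]; ring
  map_smul' c x := up_ext fun i j k => by
    simp only [upCoord_smul, upCoord_upOf, RingHom.id_apply]; ring

/-- The operator `y ↦ (1 ⊗ Y) y Y⁻¹` on `Hom(V_l, V_g ⊗ V_h)`. -/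
noncomputable def sUp : Module.End ℂ (cyclicMod N hϖ l ⟶ cyclicMod N hϖ g ⊗ cyclicMod N hϖ h) where
  toFun y := upOf (fun i j k => upCoord y i (j - 1) (k - 1))
    (fun i j k => by
      have H := upCoord_a y i (j - 1) (k - 1)
      rw [sub_eq_add_neg, sub_eq_add_neg, chi_add hϖ, chi_add hϖ] at H
      have h1 := chi_ne_zero hϖ (-1 : ZMod N)
      apply mul_left_cancel₀ h1
      rw [sub_eq_add_neg, sub_eq_add_neg]
      linear_combination H)
    (fun i j k => by
      have H := upCoord_b y i (j - 1) (k - 1)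
      rw [sub_add_cancel] at H
      rw [add_sub_cancel_right, H])
  map_add' x y := up_ext fun i j k => by
    simp only [upCoord_add, upCoord_upOf]
  map_smul' c x := up_ext fun i j k => by
    simp only [upCoord_smul, upCoord_upOf, RingHom.id_apply]

theorem lowCoord_rLow (x : cyclicMod N hϖ g ⊗ cyclicMod N hϖ h ⟶ cyclicMod N hϖ l)
    (i j k : ZMod N) : lowCoord (rLow x) i j k = chi ϖ j * lowCoord x (i + 1) j (k + 1) := by
  dsimp only [rLow, LinearMap.coe_mk, AddHom.coe_mk]
  rw [lowCoord_lowOf]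

theorem lowCoord_sLow (x : cyclicMod N hϖ g ⊗ cyclicMod N hϖ h ⟶ cyclicMod N hϖ l)
    (i j k : ZMod N) : lowCoord (sLow x) i j k = lowCoord x i (j + 1) (k + 1) := by
  dsimp only [sLow, LinearMap.coe_mk, AddHom.coe_mk]
  rw [lowCoord_lowOf]

theorem upCoord_rUp (y : cyclicMod N hϖ l ⟶ cyclicMod N hϖ g ⊗ cyclicMod N hϖ h)
    (i j k : ZMod N) : upCoord (rUp y) i j k = chi ϖ j * upCoord y (i - 1) j (k - 1) := by
  dsimp only [rUp, LinearMap.coe_mk, AddHom.coe_mk]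
  rw [upCoord_upOf]

theorem upCoord_sUp (y : cyclicMod N hϖ l ⟶ cyclicMod N hϖ g ⊗ cyclicMod N hϖ h)
    (i j k : ZMod N) : upCoord (sUp y) i j k = upCoord y i (j - 1) (k - 1) := by
  dsimp only [sUp, LinearMap.coe_mk, AddHom.coe_mk]
  rw [upCoord_upOf]

theorem rLow_pow : (rLow (hϖ := hϖ) (g := g) (h := h) (l := l)) ^ N = 1 := by
  -- For `n = N` the shift is zero in `ℤ/N`, and the accumulated factor `χ(j)^N` is `1`.
  have H : ∀ (n : ℕ) (x : cyclicMod N hϖ g ⊗ cyclicMod N hϖ h ⟶ cyclicMod N hϖ l) (i j k : ZMod N),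
      lowCoord ((rLow ^ n) x) i j k = chi ϖ j ^ n * lowCoord x (i + n) j (k + n) := by
    intro n
    induction n with
    | zero => intro x i j k; simp
    | succ n ih =>
      intro x i j k
      rw [pow_succ, Module.End.mul_apply, ih, lowCoord_rLow]; push_cast
      rw [add_assoc i, add_assoc k]; ring
  refine LinearMap.ext fun x => low_ext fun i j k => ?_
  rw [H]; simp [chi_pow_card hϖ]

theorem sLow_pow : (sLow (hϖ := hϖ) (g := g) (h := h) (l := l)) ^ N = 1 := by
  have H : ∀ (n : ℕ) (x : cyclicMod N hϖ g ⊗ cyclicMod N hϖ h ⟶ cyclicMod N hϖ l) (i j k : ZMod N),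
      lowCoord ((sLow ^ n) x) i j k = lowCoord x i (j + n) (k + n) := by
    intro n
    induction n with
    | zero => intro x i j k; simp
    | succ n ih =>
      intro x i j k
      rw [pow_succ, Module.End.mul_apply, ih, lowCoord_sLow]; push_cast
      rw [add_assoc j, add_assoc k]
  refine LinearMap.ext fun x => low_ext fun i j k => ?_
  rw [H]; simp

theorem rUp_pow : (rUp (hϖ := hϖ) (g := g) (h := h) (l := l)) ^ N = 1 := by
  have H : ∀ (n : ℕ) (y : cyclicMod N hϖ l ⟶ cyclicMod N hϖ g ⊗ cyclicMod N hϖ h) (i j k : ZMod N),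
      upCoord ((rUp ^ n) y) i j k = chi ϖ j ^ n * upCoord y (i - n) j (k - n) := by
    intro n
    induction n with
    | zero => intro x i j k; simp
    | succ n ih =>
      intro x i j k
      rw [pow_succ, Module.End.mul_apply, ih, upCoord_rUp]; push_cast
      rw [sub_sub i, sub_sub k]; ring
  refine LinearMap.ext fun x => up_ext fun i j k => ?_
  rw [H]; simp [chi_pow_card hϖ]

theorem sUp_pow : (sUp (hϖ := hϖ) (g := g) (h := h) (l := l)) ^ N = 1 := by
  have H : ∀ (n : ℕ) (y : cyclicMod N hϖ l ⟶ cyclicMod N hϖ g ⊗ cyclicMod N hϖ h) (i j k : ZMod N),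
      upCoord ((sUp ^ n) y) i j k = upCoord y i (j - n) (k - n) := by
    intro n
    induction n with
    | zero => intro x i j k; simp
    | succ n ih =>
      intro x i j k
      rw [pow_succ, Module.End.mul_apply, ih, upCoord_sUp]; push_cast
      rw [sub_sub j, sub_sub k]
  refine LinearMap.ext fun x => up_ext fun i j k => ?_
  rw [H]; simp

/-- The shift of `j` made by `s` changes the factor `χ(j)` of `r` by `χ(1) = ϖ`. For maps in the
other direction the shift is reversed, so `ϖ⁻¹` becomes `ϖ`. -/
theorem rLow_mul_sLow :
    (rLow * sLow : Module.End ℂ (cyclicMod N hϖ g ⊗ cyclicMod N hϖ h ⟶ cyclicMod N hϖ l)) =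
      ϖ⁻¹ • (sLow * rLow) := by
  refine LinearMap.ext fun x => low_ext fun i j k => ?_
  simp only [Module.End.mul_apply, LinearMap.smul_apply, lowCoord_smul, lowCoord_rLow,
    lowCoord_sLow, chi_add hϖ, chi_one hϖ]
  have := root_ne_zero hϖ
  field_simp

theorem rUp_mul_sUp :
    (rUp * sUp : Module.End ℂ (cyclicMod N hϖ l ⟶ cyclicMod N hϖ g ⊗ cyclicMod N hϖ h)) =
      ϖ • (sUp * rUp) := by
  refine LinearMap.ext fun x => up_ext fun i j k => ?_
  simp only [Module.End.mul_apply, LinearMap.smul_apply, upCoord_smul, upCoord_rUp,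
    upCoord_sUp, sub_eq_add_neg, chi_add hϖ, chi_neg hϖ, chi_one hϖ]
  have := root_ne_zero hϖ
  field_simp

end RS

/-! ### Endomorphisms and compositions -/

section Endo

variable {g h l : HalfPlane}

/-- Since `a` has `N` distinct eigenvalues, an endomorphism is diagonal; since `b` permutes the
eigenlines cyclically with `v_l ≠ 0`, the diagonal is constant. -/
theorem exists_eq_smul_id (hN : Odd N) (hl : l.x ≠ 0) (f : cyclicMod N hϖ l ⟶ cyclicMod N hϖ l) :
    ∃ c : ℂ, f = c • 𝟙 (cyclicMod N hϖ l) := by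
  let F : (ZMod N → ℂ) →ₗ[ℂ] (ZMod N → ℂ) := linMap f
  have hu := HalfPlane.rootU_ne N l
  have hv := HalfPlane.rootV_ne hN hl
  have Ha : ∀ i k : ZMod N, i ≠ k → F (basisVec i) k = 0 := by
    intro i k hik
    have H := congrFun (LinearMap.congr_fun (linMap_comm f (BorelAlg.gen ϖ .a))
      (basisVec i : ZMod N → ℂ)) k
    change F (cyclicAct N hϖ l (BorelAlg.gen ϖ .a) _) k =
      cyclicAct N hϖ l (BorelAlg.gen ϖ .a) (F _) k at H
    rw [act_a, act_a, opX_basisVec, map_smul, map_smul] at H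
    change (l.rootU N : ℂ) * (chi ϖ i * F (basisVec i) k) =
      (l.rootU N : ℂ) * (chi ϖ k * F (basisVec i) k) at H
    have H1 := mul_left_cancel₀ hu H
    by_contra h0
    exact hik (chi_injective hϖ (mul_right_cancel₀ h0 H1))
  have Hb : ∀ i : ZMod N, F (basisVec (i + 1)) (i + 1) = F (basisVec i) i := by
    intro i
    have H := congrFun (LinearMap.congr_fun (linMap_comm f (BorelAlg.gen ϖ .b))
      (basisVec i : ZMod N → ℂ)) (i + 1)
    change F (cyclicAct N hϖ l (BorelAlg.gen ϖ .b) _) (i + 1) =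
      cyclicAct N hϖ l (BorelAlg.gen ϖ .b) (F _) (i + 1) at H
    rw [act_b, act_b, opY_basisVec, map_smul] at H
    change (l.rootV N : ℂ) * F (basisVec (i + 1)) (i + 1) =
      (l.rootV N : ℂ) * F (basisVec i) (i + 1 - 1) at H
    rw [add_sub_cancel_right] at H
    exact mul_left_cancel₀ hv H
  refine ⟨F (basisVec 0) 0, hom_ext (ext_basisVec fun i => funext fun k => ?_)⟩
  change F (basisVec i) k = F (basisVec 0) 0 * (basisVec i : ZMod N → ℂ) k
  rw [basisVec_apply]
  split_ifs with h
  · subst h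
    rw [mul_one, eq_apply_zero_of_add_one (f := fun i => F (basisVec i) i) Hb k]
  · rw [mul_zero, Ha _ _ (Ne.symm h)]

/-- A nonzero entry would force `g = h`: the `N`-th power of the relation for `a` compares `u_g^N =
g.y` with `u_h^N = h.y`, and `N` steps of `b` lead back to the same entry and compare `v_g^N = g.x`
with `v_h^N = h.x`. -/
theorem hom_eq_zero_of_ne (hN : Odd N) (hgh : g ≠ h)
    (f : cyclicMod N hϖ g ⟶ cyclicMod N hϖ h) : f = 0 := by
  let F : (ZMod N → ℂ) →ₗ[ℂ] (ZMod N → ℂ) := linMap f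
  by_contra hf
  obtain ⟨i, k, hik⟩ : ∃ i k : ZMod N, F (basisVec i) k ≠ 0 := by
    by_contra! H
    exact hf (hom_ext (ext_basisVec fun i => funext fun k => H i k))
  have Ha : (g.rootU N : ℂ) * chi ϖ i = (h.rootU N : ℂ) * chi ϖ k := by
    have H := congrFun (LinearMap.congr_fun (linMap_comm f (BorelAlg.gen ϖ .a))
      (basisVec i : ZMod N → ℂ)) k
    change F (cyclicAct N hϖ g (BorelAlg.gen ϖ .a) _) k =
      cyclicAct N hϖ h (BorelAlg.gen ϖ .a) (F _) k at H
    rw [act_a, act_a, opX_basisVec, map_smul, map_smul] at H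
    change (g.rootU N : ℂ) * (chi ϖ i * F (basisVec i) k) =
      (h.rootU N : ℂ) * (chi ϖ k * F (basisVec i) k) at H
    apply mul_right_cancel₀ hik
    linear_combination H
  have Hb : ∀ i k : ZMod N, (g.rootV N : ℂ) * F (basisVec (i + 1)) (k + 1) =
      (h.rootV N : ℂ) * F (basisVec i) k := by
    intro i k
    have H := congrFun (LinearMap.congr_fun (linMap_comm f (BorelAlg.gen ϖ .b))
      (basisVec i : ZMod N → ℂ)) (k + 1)
    change F (cyclicAct N hϖ g (BorelAlg.gen ϖ .b) _) (k + 1) =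
      cyclicAct N hϖ h (BorelAlg.gen ϖ .b) (F _) (k + 1) at H
    rw [act_b, act_b, opY_basisVec, map_smul] at H
    change (g.rootV N : ℂ) * F (basisVec (i + 1)) (k + 1) =
      (h.rootV N : ℂ) * F (basisVec i) (k + 1 - 1) at H
    rwa [add_sub_cancel_right] at H
  have Hn : ∀ n : ℕ, (g.rootV N : ℂ) ^ n * F (basisVec (i + n)) (k + n) =
      (h.rootV N : ℂ) ^ n * F (basisVec i) k := by
    intro n
    induction n with
    | zero => simp
    | succ n ih =>
      push_cast
      rw [← add_assoc, ← add_assoc, pow_succ, mul_assoc, Hb, pow_succ]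
      linear_combination (h.rootV N : ℂ) * ih
  have HN := Hn N
  simp only [ZMod.natCast_self, add_zero] at HN
  have HN := mul_right_cancel₀ hik HN
  rw [HalfPlane.rootV_pow' hN, HalfPlane.rootV_pow' hN] at HN
  have HU := congrArg (· ^ N) Ha
  simp only [mul_pow, chi_pow_card hϖ, mul_one, HalfPlane.rootU_pow' hN] at HU
  exact hgh (HalfPlane.ext (by exact_mod_cast HN) (by exact_mod_cast HU))

/-- The scalar may be read off at any diagonal position `k`. Comparing two positions is what makes
the shift arguments below work. -/
theorem bracket_eq (hN : Odd N) (hl : l.x ≠ 0) (f : cyclicMod N hϖ l ⟶ cyclicMod N hϖ l)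
    (k : ZMod N) :
    bracket ℂ f = (linMap f : (ZMod N → ℂ) →ₗ[ℂ] (ZMod N → ℂ)) (basisVec k) k := by
  have H := exists_eq_smul_id hN hl f
  rw [bracket, dif_pos H]
  conv_rhs => rw [H.choose_spec]
  change _ = _ * (basisVec k : ZMod N → ℂ) k
  rw [basisVec_apply, if_pos rfl, mul_one]

theorem eq_bracket_smul (hN : Odd N) (hl : l.x ≠ 0) (f : cyclicMod N hϖ l ⟶ cyclicMod N hϖ l) :
    f = bracket ℂ f • 𝟙 (cyclicMod N hϖ l) := by
  have H := exists_eq_smul_id hN hl f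
  rw [bracket, dif_pos H]
  exact H.choose_spec

theorem comp_apply_coord (x : cyclicMod N hϖ g ⊗ cyclicMod N hϖ h ⟶ cyclicMod N hϖ l)
    {m : HalfPlane} (y : cyclicMod N hϖ m ⟶ cyclicMod N hϖ g ⊗ cyclicMod N hϖ h) (k k' : ZMod N) :
    (linMap (y ≫ x) : (ZMod N → ℂ) →ₗ[ℂ] (ZMod N → ℂ)) (basisVec k) k' =
      ∑ i, ∑ j, upCoord y i j k * lowCoord x i j k' := by
  change (linMap x : (ZMod N → ℂ) ⊗[ℂ] (ZMod N → ℂ) →ₗ[ℂ] (ZMod N → ℂ))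
    ((linMap y : (ZMod N → ℂ) →ₗ[ℂ] (ZMod N → ℂ) ⊗[ℂ] (ZMod N → ℂ)) (basisVec k)) k' = _
  conv_lhs => rw [← sum_tcoord ((linMap y : (ZMod N → ℂ) →ₗ[ℂ] (ZMod N → ℂ) ⊗[ℂ] (ZMod N → ℂ))
    (basisVec k))]
  simp only [map_sum, map_smul, Finset.sum_apply, Pi.smul_apply, smul_eq_mul]
  rfl

theorem bracket_comp (hN : Odd N) (hl : l.x ≠ 0)
    (x : cyclicMod N hϖ g ⊗ cyclicMod N hϖ h ⟶ cyclicMod N hϖ l)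
    (y : cyclicMod N hϖ l ⟶ cyclicMod N hϖ g ⊗ cyclicMod N hϖ h) (k : ZMod N) :
    bracket ℂ (y ≫ x) = ∑ i, ∑ j, upCoord y i j k * lowCoord x i j k := by
  rw [bracket_eq hN hl _ k, comp_apply_coord]

end Endo

end Borel

namespace Borel

open BialgMod

variable {N : ℕ} [NeZero N] {ϖ : ℂ} {hN : Odd N} {hϖ : IsPrimitiveRoot ϖ N}

/-! ### The coefficients of `S_{g,h}` and of its inverse -/

section Coeff

variable {g h : HalfPlane}

theorem rootV_pow_ne (hN : Odd N) (hh : h.x ≠ 0) :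
    (g.rootV N : ℂ) ^ N ≠ ((g * h).rootV N : ℂ) ^ N := by
  rw [HalfPlane.rootV_pow' hN, HalfPlane.rootV_pow' hN, HalfPlane.mul_x]
  intro H
  have H1 : g.x = g.x + g.y * h.x := by exact_mod_cast H
  have H2 : g.y * h.x = 0 := by linarith
  exact (mul_ne_zero g.pos.ne' hh) H2

theorem psiCoeff_zero : psiCoeff ϖ g h (0 : ZMod N) = 1 := by
  simp [psiCoeff]

/-- The recursion is built into the product except where `m + 1` wraps around to `0`. There it needs
the product over a full period to be `1`: for odd `N` the numerators multiply to `-g.y h.x`, and the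
denominators to `g.x - (gh).x`, the same number. -/
theorem psiCoeff_add_one (hN : Odd N) (hϖ : IsPrimitiveRoot ϖ N) (hh : h.x ≠ 0) (m : ZMod N) :
    psiCoeff ϖ g h (m + 1) * ((g.rootV N : ℂ) - ((g * h).rootV N : ℂ) * chi ϖ (m + 1)) =
      -((g.rootU N : ℂ) * h.rootV N) * psiCoeff ϖ g h m := by
  let P : ℕ → ℂ := fun n => ∏ j ∈ Finset.range n,
    (-(g.rootU N * h.rootV N : ℂ)) / ((g.rootV N : ℂ) - ((g * h).rootV N : ℂ) * ϖ ^ (j + 1))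
  have hd : ∀ j : ℕ, (g.rootV N : ℂ) - ((g * h).rootV N : ℂ) * ϖ ^ j ≠ 0 := by
    intro j
    rw [← chi_natCast hϖ j]
    exact sub_mul_chi_ne_zero hϖ (rootV_pow_ne hN hh) _
  have hPN : P N = 1 := by
    change ∏ j ∈ Finset.range N, _ = _
    rw [Finset.prod_div_distrib, Finset.prod_const, Finset.card_range]
    have e : ∏ j ∈ Finset.range N, ((g.rootV N : ℂ) - ((g * h).rootV N : ℂ) * ϖ ^ (j + 1)) =
        ∏ i : ZMod N, ((g.rootV N : ℂ) - ((g * h).rootV N : ℂ) * chi ϖ i) := by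
      rw [← Equiv.prod_comp (Equiv.addRight (1 : ZMod N))]
      refine Finset.prod_bij (fun j _ => (j : ZMod N)) (fun _ _ => Finset.mem_univ _) ?_ ?_ ?_
      · intro a ha b hb hab
        have := congrArg ZMod.val hab
        rwa [ZMod.val_natCast_of_lt (Finset.mem_range.mp ha),
          ZMod.val_natCast_of_lt (Finset.mem_range.mp hb)] at this
      · intro i _
        exact ⟨i.val, Finset.mem_range.mpr (ZMod.val_lt i), by simp⟩
      · intro j _
        rw [Equiv.coe_addRight, ← chi_natCast hϖ (j + 1), Nat.cast_succ]
    have hne := sub_ne_zero.mpr (rootV_pow_ne (N := N) (g := g) hN hh)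
    rw [e, prod_sub_mul_chi hϖ, div_eq_one_iff_eq hne, hN.neg_pow, mul_pow,
      HalfPlane.rootU_pow' hN, HalfPlane.rootV_pow' hN, HalfPlane.rootV_pow' hN,
      HalfPlane.rootV_pow' hN, HalfPlane.mul_x]
    push_cast; ring
  have h1 : psiCoeff ϖ g h (m + 1) = P (m.val + 1) := by
    rcases Nat.lt_or_ge (m.val + 1) N with hlt | hge
    · have : Fact (1 < N) := ⟨by omega⟩
      change P (m + 1).val = _
      rw [ZMod.val_add_of_lt (by rwa [ZMod.val_one]), ZMod.val_one]
    · have hi : m.val + 1 = N := by have := ZMod.val_lt m; omega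
      have h0 : m + 1 = 0 := by
        have : ((m.val + 1 : ℕ) : ZMod N) = 0 := by rw [hi]; exact ZMod.natCast_self N
        simpa using this
      rw [h0, hi, hPN, psiCoeff_zero]
  have h2 : chi ϖ (m + 1) = ϖ ^ (m.val + 1) := by
    rw [← chi_natCast hϖ]; simp
  have h3 : psiCoeff ϖ g h m = P m.val := rfl
  rw [h1, h2, h3]
  change (∏ j ∈ Finset.range (m.val + 1), _) * _ = _
  rw [Finset.prod_range_succ, mul_assoc, div_mul_cancel₀ _ (hd _)]
  exact mul_comm _ _

theorem psiCoeff_ne_zero (hN : Odd N) (hϖ : IsPrimitiveRoot ϖ N) (hh : h.x ≠ 0) (m : ZMod N) :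
    psiCoeff ϖ g h m ≠ 0 := by
  refine Finset.prod_ne_zero_iff.mpr fun j _ => div_ne_zero
    (neg_ne_zero.mpr (mul_ne_zero (HalfPlane.rootU_ne N g) (HalfPlane.rootV_ne hN hh))) ?_
  rw [← chi_natCast hϖ (j + 1)]
  exact sub_mul_chi_ne_zero hϖ (rootV_pow_ne hN hh) _

/-- The coefficients of the inverse of `∑_m ψ_m E^m`. -/
noncomputable def thetaCoeff (ϖ : ℂ) (g h : HalfPlane) (m : ZMod N) : ℂ :=
  ((g.rootV N : ℂ) ^ N - ((g * h).rootV N : ℂ) ^ N) / (N * ((g * h).rootV N : ℂ) ^ (N - 1)) *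
    (chi ϖ (-m) * ((g.rootV N : ℂ) - ((g * h).rootV N : ℂ) * chi ϖ (-m))⁻¹) *
    (psiCoeff ϖ g h (-m))⁻¹

/-- This is the recursion that makes `e_a^*` commute with `b`. By the recursion for `ψ` at `-m`,
both sides equal `-K/ψ_{-m}`, where `K` is the normalising constant of `θ`. -/
theorem thetaCoeff_sub_one (hN : Odd N) (hϖ : IsPrimitiveRoot ϖ N) (hh : h.x ≠ 0) (m : ZMod N) :
    (g.rootU N : ℂ) * h.rootV N * chi ϖ (m - 1) * thetaCoeff ϖ g h (m - 1) =
      thetaCoeff ϖ g h m * (((g * h).rootV N : ℂ) - g.rootV N * chi ϖ m) := by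
  have h1 := psiCoeff_add_one (g := g) hN hϖ hh (-m)
  have p0 := psiCoeff_ne_zero (g := g) hN hϖ hh (-m)
  have p1 := psiCoeff_ne_zero (g := g) hN hϖ hh (-m + 1)
  have d0 := sub_mul_chi_ne_zero hϖ (rootV_pow_ne (g := g) hN hh) (-m)
  have d1 := sub_mul_chi_ne_zero hϖ (rootV_pow_ne (g := g) hN hh) (-m + 1)
  have e1 : -(m - 1) = -m + 1 := by ring
  have c0 := chi_ne_zero hϖ m
  have c1 : chi ϖ (m - 1) * chi ϖ (-m + 1) = 1 := by
    rw [← chi_add hϖ]; ring_nf; exact chi_zero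
  have c2 : chi ϖ (-m) * chi ϖ m = 1 := by
    rw [← chi_add hϖ]; ring_nf; exact chi_zero
  rw [thetaCoeff, thetaCoeff, e1]
  set K := ((g.rootV N : ℂ) ^ N - ((g * h).rootV N : ℂ) ^ N) /
    (N * ((g * h).rootV N : ℂ) ^ (N - 1))
  have hinv : ((g.rootV N : ℂ) - ((g * h).rootV N : ℂ) * chi ϖ (-m + 1))⁻¹ *
      (psiCoeff ϖ g h (-m + 1))⁻¹ * ((g.rootU N : ℂ) * h.rootV N) =
      -(psiCoeff ϖ g h (-m))⁻¹ := by
    rw [← mul_inv, mul_comm _ (psiCoeff ϖ g h (-m + 1)), h1]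
    have := HalfPlane.rootU_ne N g
    have := HalfPlane.rootV_ne hN hh
    field_simp
  have hd : ((g.rootV N : ℂ) - ((g * h).rootV N : ℂ) * chi ϖ (-m))⁻¹ * chi ϖ (-m) *
      (((g * h).rootV N : ℂ) - g.rootV N * chi ϖ m) = -1 := by
    have : chi ϖ (-m) * (((g * h).rootV N : ℂ) - g.rootV N * chi ϖ m) =
        -((g.rootV N : ℂ) - ((g * h).rootV N : ℂ) * chi ϖ (-m)) := by
      linear_combination (-(g.rootV N : ℂ)) * c2
    rw [mul_assoc, this, mul_neg, inv_mul_cancel₀ d0]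
  linear_combination K * chi ϖ (m - 1) * chi ϖ (-m + 1) * hinv
    - K * (psiCoeff ϖ g h (-m))⁻¹ * c1 - K * (psiCoeff ϖ g h (-m))⁻¹ * hd

theorem psiCoeff_mul_thetaCoeff (hN : Odd N) (hϖ : IsPrimitiveRoot ϖ N) (hh : h.x ≠ 0)
    (m : ZMod N) : psiCoeff ϖ g h m * thetaCoeff ϖ g h (-m) =
      ((g.rootV N : ℂ) ^ N - ((g * h).rootV N : ℂ) ^ N) / (N * ((g * h).rootV N : ℂ) ^ (N - 1)) *
        (chi ϖ m * ((g.rootV N : ℂ) - ((g * h).rootV N : ℂ) * chi ϖ m)⁻¹) := by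
  have p0 := psiCoeff_ne_zero (g := g) hN hϖ hh m
  rw [thetaCoeff, neg_neg]
  field_simp

/-- In `ψ_m θ_{-m}` the factors `ψ` cancel, leaving a multiple of `χ/(z - wχ)`; the constant in `θ`
is chosen to normalise the sum. -/
theorem sum_psiCoeff_mul_thetaCoeff (hN : Odd N) (hϖ : IsPrimitiveRoot ϖ N) (hh : h.x ≠ 0)
    (hl : (g * h).x ≠ 0) :
    ∑ m : ZMod N, psiCoeff ϖ g h m * thetaCoeff ϖ g h (-m) = 1 := by
  have hne := sub_ne_zero.mpr (rootV_pow_ne (N := N) (g := g) hN hh)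
  have hv := HalfPlane.rootV_ne hN hl
  have hN0 : (N : ℂ) ≠ 0 := NeZero.ne _
  simp_rw [psiCoeff_mul_thetaCoeff hN hϖ hh]
  rw [← Finset.mul_sum, sum_chi_div_sub_mul_chi hϖ (rootV_pow_ne hN hh) hv]
  field_simp

/-- The weight `χ(-m)` turns `χ/(z - wχ)` into `1/(z - wχ)`, which replaces `w^{N-1}` by `z^{N-1}`
in the value of the sum. This is the origin of the factor `(v_g/v_{gh})^{N-1}` in `R`. -/
theorem sum_chi_neg_mul_psiCoeff_mul_thetaCoeff (hN : Odd N) (hϖ : IsPrimitiveRoot ϖ N)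
    (hh : h.x ≠ 0) (hl : (g * h).x ≠ 0) :
    ∑ m : ZMod N, chi ϖ (-m) * (psiCoeff ϖ g h m * thetaCoeff ϖ g h (-m)) =
      ((g.rootV N : ℂ) / (g * h).rootV N) ^ (N - 1) := by
  have hne := sub_ne_zero.mpr (rootV_pow_ne (N := N) (g := g) hN hh)
  have hv := HalfPlane.rootV_ne hN hl
  have hN0 : (N : ℂ) ≠ 0 := NeZero.ne _
  have e : ∀ m : ZMod N, chi ϖ (-m) * (psiCoeff ϖ g h m * thetaCoeff ϖ g h (-m)) =
      ((g.rootV N : ℂ) ^ N - ((g * h).rootV N : ℂ) ^ N) / (N * ((g * h).rootV N : ℂ) ^ (N - 1)) *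
        ((g.rootV N : ℂ) - ((g * h).rootV N : ℂ) * chi ϖ m)⁻¹ := by
    intro m
    have := chi_ne_zero hϖ m
    rw [psiCoeff_mul_thetaCoeff hN hϖ hh, chi_neg hϖ]
    field_simp
  simp_rw [e]
  rw [← Finset.mul_sum, sum_inv_sub_mul_chi hϖ (rootV_pow_ne hN hh), div_pow]
  field_simp

end Coeff

/-! ### The operator `S_{g,h}` in coordinates -/

theorem opYInv_basisVec (i : ZMod N) : opYInv N (basisVec i) = basisVec (i - 1) := by
  funext j
  change (Pi.single i 1 : ZMod N → ℂ) (j + 1) = (Pi.single (i - 1) 1 : ZMod N → ℂ) j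
  simp only [Pi.single_apply, eq_sub_iff_add_eq]

/-- Each application contributes `χ` of the current first index, and `i + (i - 1) + ⋯ + (i - n + 1)
= n i - n(n - 1)/2`. -/
theorem map_YInvX_Y_pow (hN : Odd N) (hϖ : IsPrimitiveRoot ϖ N) (n : ℕ) (i j : ZMod N) :
    ((TensorProduct.map (opYInv N * opX N ϖ) (opY N) :
      Module.End ℂ ((ZMod N → ℂ) ⊗[ℂ] (ZMod N → ℂ))) ^ n) (basisVec i ⊗ₜ basisVec j) =
      chi ϖ ((n : ZMod N) * i - half N * ((n : ZMod N) * ((n : ZMod N) - 1))) •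
        (basisVec (i - n) : ZMod N → ℂ) ⊗ₜ[ℂ] (basisVec (j + n) : ZMod N → ℂ) := by
  induction n with
  | zero => simp [chi_zero]
  | succ n ih =>
    rw [pow_succ', Module.End.mul_apply, ih, map_smul, TensorProduct.map_tmul,
      Module.End.mul_apply, opX_basisVec, map_smul, opYInv_basisVec, opY_basisVec,
      ← TensorProduct.smul_tmul', smul_smul]
    change (_ * chi ϖ (i - (n : ZMod N))) • _ = _
    rw [← chi_add hϖ]
    push_cast
    rw [sub_sub, add_assoc]
    congr 2
    linear_combination (n : ZMod N) * two_mul_half hN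

/-- The sum over `j` is a discrete delta function at `i = -b`, so the double sum is a controlled
shift. -/
theorem opS_right_basisVec (hϖ : IsPrimitiveRoot ϖ N) (a b : ZMod N) :
    ((N : ℂ)⁻¹ • ∑ i : ZMod N, ∑ j : ZMod N, ϖ ^ (i.val * j.val) •
      ((TensorProduct.map (opY N) LinearMap.id :
          Module.End ℂ ((ZMod N → ℂ) ⊗[ℂ] (ZMod N → ℂ))) ^ i.val *
        (TensorProduct.map LinearMap.id (opX N ϖ) :
          Module.End ℂ ((ZMod N → ℂ) ⊗[ℂ] (ZMod N → ℂ))) ^ j.val))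
      (basisVec a ⊗ₜ basisVec b) =
      (basisVec (a - b) : ZMod N → ℂ) ⊗ₜ[ℂ] (basisVec b : ZMod N → ℂ) := by
  have hY : ∀ (n : ℕ) (a b : ZMod N), ((TensorProduct.map (opY N) LinearMap.id :
      Module.End ℂ ((ZMod N → ℂ) ⊗[ℂ] (ZMod N → ℂ))) ^ n) (basisVec a ⊗ₜ basisVec b) =
      (basisVec (a + n) : ZMod N → ℂ) ⊗ₜ[ℂ] (basisVec b : ZMod N → ℂ) := by
    intro n
    induction n with
    | zero => simp
    | succ n ih =>
      intro a b
      rw [pow_succ', Module.End.mul_apply, ih, TensorProduct.map_tmul, opY_basisVec]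
      push_cast
      rw [add_assoc]; rfl
  have hX : ∀ (n : ℕ) (a b : ZMod N), ((TensorProduct.map LinearMap.id (opX N ϖ) :
      Module.End ℂ ((ZMod N → ℂ) ⊗[ℂ] (ZMod N → ℂ))) ^ n) (basisVec a ⊗ₜ basisVec b) =
      chi ϖ ((n : ZMod N) * b) • (basisVec a : ZMod N → ℂ) ⊗ₜ[ℂ] (basisVec b : ZMod N → ℂ) := by
    intro n
    induction n with
    | zero => simp [chi_zero]
    | succ n ih =>
      intro a b
      rw [pow_succ', Module.End.mul_apply, ih, map_smul, TensorProduct.map_tmul, opX_basisVec,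
        TensorProduct.tmul_smul, smul_smul]
      change (_ * chi ϖ b) • _ = _
      rw [← chi_add hϖ]
      push_cast
      rw [add_mul, one_mul]; rfl
  have hN0 : (N : ℂ) ≠ 0 := NeZero.ne _
  rw [LinearMap.smul_apply, LinearMap.sum_apply]
  have e : ∀ i : ZMod N, (∑ j : ZMod N, ϖ ^ (i.val * j.val) •
      ((TensorProduct.map (opY N) LinearMap.id :
          Module.End ℂ ((ZMod N → ℂ) ⊗[ℂ] (ZMod N → ℂ))) ^ i.val *
        (TensorProduct.map LinearMap.id (opX N ϖ) :
          Module.End ℂ ((ZMod N → ℂ) ⊗[ℂ] (ZMod N → ℂ))) ^ j.val))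
      (basisVec a ⊗ₜ basisVec b) = (if i + b = 0 then (N : ℂ) else 0) •
        (basisVec (a + i) : ZMod N → ℂ) ⊗ₜ[ℂ] (basisVec b : ZMod N → ℂ) := by
    intro i
    rw [LinearMap.sum_apply, ← sum_chi_mul hϖ, Finset.sum_smul]
    refine Finset.sum_congr rfl fun j _ => ?_
    rw [LinearMap.smul_apply, Module.End.mul_apply, hX, map_smul, hY, smul_smul,
      ← chi_natCast hϖ, ← chi_add hϖ]
    push_cast
    simp only [ZMod.natCast_val, ZMod.cast_id', id_eq]
    congr 2
    ring
  simp_rw [e]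
  rw [Finset.sum_eq_single (-b)]
  · rw [neg_add_cancel, if_pos rfl, smul_smul, inv_mul_cancel₀ hN0, one_smul, ← sub_eq_add_neg]
  · intro i _ hi
    rw [if_neg (fun h0 => hi (eq_neg_of_add_eq_zero_left h0)), zero_smul]
  · simp

theorem opS_basisVec (hN : Odd N) (hϖ : IsPrimitiveRoot ϖ N) (g h : HalfPlane) (a b : ZMod N) :
    opS N ϖ g h (basisVec a ⊗ₜ basisVec b) = ∑ m : ZMod N,
      (psiCoeff ϖ g h m * chi ϖ (m * (a - b) - half N * (m * (m - 1)))) •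
        (basisVec (a - b - m) : ZMod N → ℂ) ⊗ₜ[ℂ] (basisVec (b + m) : ZMod N → ℂ) := by
  rw [opS, Module.End.mul_apply, opS_right_basisVec hϖ, LinearMap.sum_apply]
  refine Finset.sum_congr rfl fun m _ => ?_
  rw [LinearMap.smul_apply, map_YInvX_Y_pow hN hϖ, smul_smul]
  simp only [ZMod.natCast_val, ZMod.cast_id', id_eq]

end Borel

namespace Borel

open BialgMod

variable {N : ℕ} [NeZero N] {ϖ : ℂ}

/-! ### The vectors `e_i` and `e_i^*` -/

section Basis

variable (hN : Odd N) (hϖ : IsPrimitiveRoot ϖ N) {g h l : HalfPlane}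

/-- The coefficients of `e_a`. -/
noncomputable def eUpCoeff (ϖ : ℂ) (g h : HalfPlane) (a i j k : ZMod N) : ℂ :=
  if k = i + j then
    psiCoeff ϖ g h (j - a) * chi ϖ ((j - a) * (k - a) - half N * ((j - a) * (j - a - 1)))
  else 0

/-- The coefficients of `e_a^*`. -/
noncomputable def eLowCoeff (ϖ : ℂ) (g h : HalfPlane) (a i j k : ZMod N) : ℂ :=
  if k = i + j then
    thetaCoeff ϖ g h (a - j) * chi ϖ ((a - j) * i - half N * ((a - j) * (a - j - 1)))
  else 0

/-- The element `e_a` of `H^{g,h}_l`, `l = gh`. -/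
noncomputable def eUp (hh : h.x ≠ 0) (hl : l = g * h) (a : ZMod N) :
    cyclicMod N hϖ l ⟶ cyclicMod N hϖ g ⊗ cyclicMod N hϖ h :=
  upOf (eUpCoeff ϖ g h a)
    (fun i j k => by
      rw [eUpCoeff]
      split_ifs with hk
      · rw [hl, HalfPlane.rootU_mul hN, hk, ← chi_add hϖ]; push_cast; ring
      · ring)
    (fun i j k => by
      rw [eUpCoeff, eUpCoeff, eUpCoeff]
      by_cases hk : k + 1 = i + j
      · rw [if_pos hk, if_pos (by linear_combination hk), if_pos (by linear_combination hk)]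
        have H := psiCoeff_add_one (g := g) hN hϖ hh (j - 1 - a)
        have e1 : j - 1 - a + 1 = j - a := by ring
        rw [e1] at H
        have c1 : chi ϖ ((j - a) * (k + 1 - a) - half N * ((j - a) * (j - a - 1))) =
            chi ϖ (j - a) * chi ϖ ((j - a) * (k - a) - half N * ((j - a) * (j - a - 1))) := by
          rw [← chi_add hϖ]; congr 1; ring
        have c2 : chi ϖ i * chi ϖ ((j - 1 - a) * (k - a) -
            half N * ((j - 1 - a) * (j - 1 - a - 1))) =
            chi ϖ ((j - a) * (k - a) - half N * ((j - a) * (j - a - 1))) := by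
          rw [← chi_add hϖ]; congr 1
          linear_combination -hk + (j - a - 1) * two_mul_half hN
        rw [c1, hl]
        linear_combination (-chi ϖ ((j - a) * (k - a) - half N * ((j - a) * (j - a - 1)))) * H
          - (g.rootU N : ℂ) * h.rootV N * psiCoeff ϖ g h (j - 1 - a) * c2
      · rw [if_neg hk, if_neg (fun H => hk (by linear_combination H)),
          if_neg (fun H => hk (by linear_combination H))]
        ring)

/-- The element `e_a^*` of `H_{g,h}^l`, `l = gh`. -/
noncomputable def eLow (hh : h.x ≠ 0) (hl : l = g * h) (a : ZMod N) :
    cyclicMod N hϖ g ⊗ cyclicMod N hϖ h ⟶ cyclicMod N hϖ l :=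
  lowOf (eLowCoeff ϖ g h a)
    (fun i j k => by
      rw [eLowCoeff]
      split_ifs with hk
      · rw [hl, HalfPlane.rootU_mul hN, hk, ← chi_add hϖ]; push_cast; ring
      · ring)
    (fun i j k => by
      rw [eLowCoeff, eLowCoeff, eLowCoeff]
      by_cases hk : k - 1 = i + j
      · rw [if_pos hk, if_pos (by linear_combination hk), if_pos (by linear_combination hk)]
        have H := thetaCoeff_sub_one (g := g) hN hϖ hh (a - j)
        have e1 : a - (j + 1) = a - j - 1 := by ring
        rw [e1]
        have c1 : chi ϖ ((a - j) * (i + 1) - half N * ((a - j) * (a - j - 1))) =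
            chi ϖ (a - j) * chi ϖ ((a - j) * i - half N * ((a - j) * (a - j - 1))) := by
          rw [← chi_add hϖ]; congr 1; ring
        have c2 : chi ϖ i * chi ϖ ((a - j - 1) * i -
            half N * ((a - j - 1) * (a - j - 1 - 1))) = chi ϖ (a - j - 1) *
            chi ϖ ((a - j) * i - half N * ((a - j) * (a - j - 1))) := by
          rw [← chi_add hϖ, ← chi_add hϖ]; congr 1
          linear_combination (a - j - 1) * two_mul_half hN
        rw [c1, hl]
        linear_combination (-chi ϖ ((a - j) * i - half N * ((a - j) * (a - j - 1)))) * H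
          - (g.rootU N : ℂ) * h.rootV N * thetaCoeff ϖ g h (a - j - 1) * c2
      · rw [if_neg hk, if_neg (fun H => hk (by linear_combination H)),
          if_neg (fun H => hk (by linear_combination H))]
        ring)

theorem upCoord_eUp (hh : h.x ≠ 0) (hl : l = g * h) (a i j k : ZMod N) :
    upCoord (eUp hN hϖ hh hl a) i j k = eUpCoeff ϖ g h a i j k := by
  rw [eUp, upCoord_upOf]

theorem lowCoord_eLow (hh : h.x ≠ 0) (hl : l = g * h) (a i j k : ZMod N) :
    lowCoord (eLow hN hϖ hh hl a) i j k = eLowCoeff ϖ g h a i j k := by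
  rw [eLow, lowCoord_lowOf]

/-- For equal labels the quadratic phases of the two vectors are inverse to each other, leaving the
summand already evaluated for `ψ` and `θ`. -/
theorem eUpCoeff_mul_eLowCoeff_self (hN : Odd N) (hϖ : IsPrimitiveRoot ϖ N) (a j k : ZMod N) :
    eUpCoeff ϖ g h a (k - j) j k * eLowCoeff ϖ g h a (k - j) j k =
      psiCoeff ϖ g h (j - a) * thetaCoeff ϖ g h (-(j - a)) := by
  rw [eUpCoeff, eLowCoeff, if_pos (by ring), if_pos (by ring), neg_sub]
  have c : chi ϖ ((j - a) * (k - a) - half N * ((j - a) * (j - a - 1))) *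
      chi ϖ ((a - j) * (k - j) - half N * ((a - j) * (a - j - 1))) = 1 := by
    rw [← chi_add hϖ, ← chi_zero (N := N) (ϖ := ϖ)]; congr 1
    linear_combination (-(j - a) ^ 2) * two_mul_half hN
  linear_combination psiCoeff ϖ g h (j - a) * thetaCoeff ϖ g h (a - j) * c

/-- Raising `i` and `k` together adds `j - a` to one exponent and `c - j` to the other, in total `c
- a`, independently of `j`. -/
theorem eUpCoeff_mul_eLowCoeff_shift (hϖ : IsPrimitiveRoot ϖ N) (a c i j k : ZMod N) :
    eUpCoeff ϖ g h a (i + 1) j (k + 1) * eLowCoeff ϖ g h c (i + 1) j (k + 1) =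
      chi ϖ (c - a) * (eUpCoeff ϖ g h a i j k * eLowCoeff ϖ g h c i j k) := by
  rw [eUpCoeff, eLowCoeff, eUpCoeff, eLowCoeff]
  by_cases hk : k = i + j
  · have hk' : k + 1 = i + 1 + j := by linear_combination hk
    rw [if_pos hk, if_pos hk, if_pos hk', if_pos hk']
    have e : chi ϖ ((j - a) * (k + 1 - a) - half N * ((j - a) * (j - a - 1))) *
        chi ϖ ((c - j) * (i + 1) - half N * ((c - j) * (c - j - 1))) =
        chi ϖ (c - a) * (chi ϖ ((j - a) * (k - a) - half N * ((j - a) * (j - a - 1))) *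
        chi ϖ ((c - j) * i - half N * ((c - j) * (c - j - 1)))) := by
      rw [← chi_add hϖ, ← chi_add hϖ, ← chi_add hϖ]; congr 1; ring
    linear_combination psiCoeff ϖ g h (j - a) * thetaCoeff ϖ g h (c - j) * e
  · rw [if_neg hk, if_neg fun H => hk (by linear_combination H)]; ring

/-- For `a = c` this is `∑ ψ_m θ_{-m} = 1`. For `a ≠ c`, reading the scalar at `k = 0` and at `k =
1` gives two values whose ratio is `χ(c - a) ≠ 1`, so it vanishes. -/
theorem bracket_eUp_eLow (hh : h.x ≠ 0) (hl : l = g * h) (hlx : l.x ≠ 0) (a c : ZMod N) :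
    bracket ℂ (eUp hN hϖ hh hl a ≫ eLow hN hϖ hh hl c) = if a = c then 1 else 0 := by
  have H := bracket_comp hN hlx (eLow hN hϖ hh hl c) (eUp hN hϖ hh hl a)
  simp only [upCoord_eUp, lowCoord_eLow] at H
  split_ifs with hac
  · subst hac
    rw [H 0, Finset.sum_comm, ← sum_psiCoeff_mul_thetaCoeff hN hϖ hh (g := g) (hl ▸ hlx),
      ← Equiv.sum_comp (Equiv.subRight a)
        (fun m => psiCoeff ϖ g h m * thetaCoeff ϖ g h (-m))]
    refine Finset.sum_congr rfl fun j _ => ?_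
    rw [Finset.sum_eq_single (0 - j), eUpCoeff_mul_eLowCoeff_self hN hϖ, Equiv.subRight_apply]
    · intro i _ hi
      rw [eUpCoeff, if_neg, zero_mul]
      intro H; exact hi (by linear_combination -H)
    · simp
  · have h1 : bracket ℂ (eUp hN hϖ hh hl a ≫ eLow hN hϖ hh hl c) =
        chi ϖ (c - a) * bracket ℂ (eUp hN hϖ hh hl a ≫ eLow hN hϖ hh hl c) := by
      conv_rhs => rw [H 0]
      rw [H (0 + 1), ← Equiv.sum_comp (Equiv.addRight (1 : ZMod N)), Finset.mul_sum]
      refine Finset.sum_congr rfl fun i _ => ?_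
      rw [Finset.mul_sum]
      refine Finset.sum_congr rfl fun j _ => ?_
      rw [Equiv.coe_addRight, eUpCoeff_mul_eLowCoeff_shift hϖ]
    have h2 : chi ϖ (c - a) ≠ 1 := fun h2 => hac
      (sub_eq_zero.mp (chi_injective hϖ (h2.trans chi_zero.symm))).symm
    have h3 : (1 - chi ϖ (c - a)) *
        bracket ℂ (eUp hN hϖ hh hl a ≫ eLow hN hϖ hh hl c) = 0 := by linear_combination h1
    exact (mul_eq_zero.mp h3).resolve_left (sub_ne_zero.mpr h2.symm)

theorem eUp_comp_eLow (hh : h.x ≠ 0) (hl : l = g * h) (hlx : l.x ≠ 0) (a c : ZMod N) :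
    eUp hN hϖ hh hl a ≫ eLow hN hϖ hh hl c = if a = c then 𝟙 _ else 0 := by
  rw [eq_bracket_smul hN hlx (eUp hN hϖ hh hl a ≫ eLow hN hϖ hh hl c), bracket_eUp_eLow _ _ _ _ hlx]
  split_ifs <;> simp

theorem linMap_eUp (hh : h.x ≠ 0) (hl : l = g * h) (a : ZMod N) (x : ZMod N → ℂ) :
    linMap (eUp hN hϖ hh hl a) x = opS N ϖ g h (x ⊗ₜ[ℂ] basisVec a) := by
  have H : (linMap (eUp hN hϖ hh hl a) : (ZMod N → ℂ) →ₗ[ℂ] (ZMod N → ℂ) ⊗[ℂ] (ZMod N → ℂ)) =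
      opS N ϖ g h ∘ₗ (TensorProduct.mk ℂ (ZMod N → ℂ) (ZMod N → ℂ)).flip (basisVec a) := by
    refine ext_basisVec fun k => tensor_ext fun i j => ?_
    refine (upCoord_eUp hN hϖ hh hl a i j k).trans ?_
    rw [LinearMap.comp_apply, LinearMap.flip_apply, TensorProduct.mk_apply, opS_basisVec hN hϖ,
      -- The second tensor index of each term of `S_{g,h}` is `a + m`, so only `m = j - a`
      -- contributes at `j`.
      map_sum, Finset.sum_eq_single (j - a)]
    · rw [map_smul, tcoord_tmul, basisVec_apply, basisVec_apply, eUpCoeff, if_pos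
        (show j = a + (j - a) by ring)]
      by_cases hk : k = i + j
      · rw [if_pos hk, if_pos (by linear_combination -hk)]; simp
      · rw [if_neg hk, if_neg fun H => hk (by linear_combination -H)]; simp
    · intro m _ hm
      rw [map_smul, tcoord_tmul, basisVec_apply, basisVec_apply, if_neg
        (show j ≠ a + m from fun H => hm (by linear_combination -H))]
      simp
    · simp
  exact LinearMap.congr_fun H x

/-- The inverse of `S_{g,h}`. -/
noncomputable def opSInv (hh : h.x ≠ 0) (hl : l = g * h) :
    Module.End ℂ ((ZMod N → ℂ) ⊗[ℂ] (ZMod N → ℂ)) :=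
  ∑ c : ZMod N, (TensorProduct.mk ℂ (ZMod N → ℂ) (ZMod N → ℂ)).flip (basisVec c) ∘ₗ
    (linMap (eLow hN hϖ hh hl c) : (ZMod N → ℂ) ⊗[ℂ] (ZMod N → ℂ) →ₗ[ℂ] (ZMod N → ℂ))

theorem linMap_eLow_eUp (hh : h.x ≠ 0) (hl : l = g * h) (hlx : l.x ≠ 0) (a c : ZMod N)
    (x : ZMod N → ℂ) :
    (linMap (eLow hN hϖ hh hl c) : (ZMod N → ℂ) ⊗[ℂ] (ZMod N → ℂ) →ₗ[ℂ] (ZMod N → ℂ))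
      ((linMap (eUp hN hϖ hh hl a) : (ZMod N → ℂ) →ₗ[ℂ] (ZMod N → ℂ) ⊗[ℂ] (ZMod N → ℂ)) x) =
      if a = c then x else 0 := by
  have H := congrArg linMap (eUp_comp_eLow hN hϖ hh hl hlx a c)
  have H1 := LinearMap.congr_fun H x
  refine H1.trans ?_
  split_ifs <;> rfl

theorem opSInv_mul_opS (hh : h.x ≠ 0) (hl : l = g * h) (hlx : l.x ≠ 0) :
    opSInv hN hϖ hh hl * opS N ϖ g h = 1 := by
  refine ext_basisVec_tmul fun i j => ?_
  rw [Module.End.mul_apply, ← linMap_eUp hN hϖ hh hl, opSInv, LinearMap.sum_apply,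
    Finset.sum_eq_single j]
  · rw [LinearMap.comp_apply]
    erw [linMap_eLow_eUp hN hϖ hh hl hlx]
    rw [if_pos rfl]; rfl
  · intro c _ hc
    rw [LinearMap.comp_apply]
    erw [linMap_eLow_eUp hN hϖ hh hl hlx]
    rw [if_neg (Ne.symm hc), map_zero]
  · simp

/-- In finite dimension a left inverse is a right inverse; completeness of the `e_a` thus comes from
biorthogonality alone. -/
theorem opS_mul_opSInv (hh : h.x ≠ 0) (hl : l = g * h) (hlx : l.x ≠ 0) :
    opS N ϖ g h * opSInv hN hϖ hh hl = 1 :=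
  mul_eq_one_comm.mp (opSInv_mul_opS hN hϖ hh hl hlx)

theorem isUnit_opS (hN : Odd N) (hϖ : IsPrimitiveRoot ϖ N) (hh : h.x ≠ 0) (hl : l = g * h)
    (hlx : l.x ≠ 0) : IsUnit (opS N ϖ g h) :=
  ⟨⟨_, _, opS_mul_opSInv hN hϖ hh hl hlx, opSInv_mul_opS hN hϖ hh hl hlx⟩, rfl⟩

theorem linMap_eLow (hh : h.x ≠ 0) (hl : l = g * h) (hlx : l.x ≠ 0) (c : ZMod N)
    (x y : ZMod N → ℂ) :
    linMap (eLow hN hϖ hh hl c) (opS N ϖ g h (x ⊗ₜ[ℂ] y)) = y c • x := by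
  conv_lhs => rw [← sum_basisVec y, TensorProduct.tmul_sum, map_sum]
  erw [map_sum]
  rw [Finset.sum_eq_single c]
  · rw [TensorProduct.tmul_smul, map_smul, ← linMap_eUp hN hϖ hh hl]
    erw [map_smul, linMap_eLow_eUp hN hϖ hh hl hlx]
    rw [if_pos rfl]
  · intro a _ hc
    rw [TensorProduct.tmul_smul, map_smul, ← linMap_eUp hN hϖ hh hl]
    erw [map_smul, linMap_eLow_eUp hN hϖ hh hl hlx]
    rw [if_neg hc, smul_zero]
  · exact fun h0 => absurd (Finset.mem_univ c) h0

/-- This is `S S⁻¹ = 1` expanded over the second tensor factor, and gives the splitting axiom and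
both bases. -/
theorem sum_eLow_comp_eUp (hh : h.x ≠ 0) (hl : l = g * h) (hlx : l.x ≠ 0) :
    ∑ c, eLow hN hϖ hh hl c ≫ eUp hN hϖ hh hl c =
      𝟙 (cyclicMod N hϖ g ⊗ cyclicMod N hϖ h) := by
  let φ : ((cyclicMod N hϖ g ⊗ cyclicMod N hϖ h) ⟶ (cyclicMod N hϖ g ⊗ cyclicMod N hϖ h)) →+
      Module.End ℂ ((ZMod N → ℂ) ⊗[ℂ] (ZMod N → ℂ)) := ⟨⟨linMap, rfl⟩, fun _ _ => rfl⟩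
  refine hom_ext ?_
  change φ _ = 1
  rw [map_sum, ← opS_mul_opSInv hN hϖ hh hl hlx, opSInv, Finset.mul_sum]
  refine Finset.sum_congr rfl fun c _ => LinearMap.ext fun z => ?_
  exact linMap_eUp hN hϖ hh hl c _

/-- Insert the resolution of the identity; each `y ≫ e_c^*` is an endomorphism of a simple object,
hence a scalar. -/
theorem up_eq_sum (hh : h.x ≠ 0) (hl : l = g * h) (hlx : l.x ≠ 0)
    (y : cyclicMod N hϖ l ⟶ cyclicMod N hϖ g ⊗ cyclicMod N hϖ h) :
    y = ∑ c, bracket ℂ (y ≫ eLow hN hϖ hh hl c) • eUp hN hϖ hh hl c := by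
  conv_lhs => rw [← Category.comp_id y, ← sum_eLow_comp_eUp hN hϖ hh hl hlx,
    Preadditive.comp_sum]
  refine Finset.sum_congr rfl fun c _ => ?_
  rw [← Category.assoc, eq_bracket_smul hN hlx (y ≫ eLow hN hϖ hh hl c), Linear.smul_comp,
    Category.id_comp, ← eq_bracket_smul hN hlx (y ≫ eLow hN hϖ hh hl c)]

theorem low_eq_sum (hh : h.x ≠ 0) (hl : l = g * h) (hlx : l.x ≠ 0)
    (x : cyclicMod N hϖ g ⊗ cyclicMod N hϖ h ⟶ cyclicMod N hϖ l) :
    x = ∑ c, bracket ℂ (eUp hN hϖ hh hl c ≫ x) • eLow hN hϖ hh hl c := by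
  conv_lhs => rw [← Category.id_comp x, ← sum_eLow_comp_eUp hN hϖ hh hl hlx,
    Preadditive.sum_comp]
  refine Finset.sum_congr rfl fun c _ => ?_
  rw [Category.assoc, eq_bracket_smul hN hlx (eUp hN hϖ hh hl c ≫ x), Linear.comp_smul,
    Category.comp_id, ← eq_bracket_smul hN hlx (eUp hN hϖ hh hl c ≫ x)]

theorem bracket_add (hN : Odd N) (hlx : l.x ≠ 0) (f f' : cyclicMod N hϖ l ⟶ cyclicMod N hϖ l) :
    bracket ℂ (f + f') = bracket ℂ f + bracket ℂ f' := by
  rw [bracket_eq hN hlx _ 0, bracket_eq hN hlx _ 0, bracket_eq hN hlx _ 0]; rfl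

theorem bracket_smul (hN : Odd N) (hlx : l.x ≠ 0) (c : ℂ)
    (f : cyclicMod N hϖ l ⟶ cyclicMod N hϖ l) : bracket ℂ (c • f) = c * bracket ℂ f := by
  rw [bracket_eq hN hlx _ 0, bracket_eq hN hlx _ 0]; rfl

/-- `⟨·⟩` as a linear form on `End(V_l)`. -/
noncomputable def bracketLin (hlx : l.x ≠ 0) :
    (cyclicMod N hϖ l ⟶ cyclicMod N hϖ l) →ₗ[ℂ] ℂ where
  toFun f := bracket ℂ f
  map_add' := bracket_add hϖ hN hlx
  map_smul' := bracket_smul hϖ hN hlx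

/-- The basis `(e_a)` of `H^{g,h}_l`. -/
noncomputable def basisUp (hh : h.x ≠ 0) (hl : l = g * h) (hlx : l.x ≠ 0) :
    Module.Basis (ZMod N) ℂ (cyclicMod N hϖ l ⟶ cyclicMod N hϖ g ⊗ cyclicMod N hϖ h) :=
  Module.Basis.ofEquivFun
    { toFun := fun y c => bracket ℂ (y ≫ eLow hN hϖ hh hl c)
      map_add' := fun y y' => funext fun c => by
        rw [Preadditive.add_comp, bracket_add hϖ hN hlx]; rfl
      map_smul' := fun t y => funext fun c => by
        rw [Linear.smul_comp, bracket_smul hϖ hN hlx]; rfl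
      invFun := fun f => ∑ c, f c • eUp hN hϖ hh hl c
      left_inv := fun y => (up_eq_sum hN hϖ hh hl hlx y).symm
      right_inv := fun f => funext fun c => by
        change bracketLin hN hϖ hlx _ = _
        simp_rw [Preadditive.sum_comp, Linear.smul_comp]
        rw [map_sum]
        simp_rw [map_smul]
        change ∑ a, f a * bracket ℂ _ = _
        simp [bracket_eUp_eLow hN hϖ hh hl hlx] }

/-- The basis `(e_a^*)` of `H_{g,h}^l`. -/
noncomputable def basisLow (hh : h.x ≠ 0) (hl : l = g * h) (hlx : l.x ≠ 0) :
    Module.Basis (ZMod N) ℂ (cyclicMod N hϖ g ⊗ cyclicMod N hϖ h ⟶ cyclicMod N hϖ l) :=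
  Module.Basis.ofEquivFun
    { toFun := fun x c => bracket ℂ (eUp hN hϖ hh hl c ≫ x)
      map_add' := fun y y' => funext fun c => by
        rw [Preadditive.comp_add, bracket_add hϖ hN hlx]; rfl
      map_smul' := fun t y => funext fun c => by
        rw [Linear.comp_smul, bracket_smul hϖ hN hlx]; rfl
      invFun := fun f => ∑ c, f c • eLow hN hϖ hh hl c
      left_inv := fun y => (low_eq_sum hN hϖ hh hl hlx y).symm
      right_inv := fun f => funext fun c => by
        change bracketLin hN hϖ hlx _ = _
        simp_rw [Preadditive.comp_sum, Linear.comp_smul]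
        rw [map_sum]
        simp_rw [map_smul]
        change ∑ a, f a * bracket ℂ _ = _
        simp [bracket_eUp_eLow hN hϖ hh hl hlx] }

theorem basisUp_apply (hh : h.x ≠ 0) (hl : l = g * h) (hlx : l.x ≠ 0) (a : ZMod N) :
    basisUp hN hϖ hh hl hlx a = eUp hN hϖ hh hl a := by
  rw [basisUp, Module.Basis.coe_ofEquivFun]
  change ∑ c, (Pi.single a 1 : ZMod N → ℂ) c • eUp hN hϖ hh hl c = _
  simp [Pi.single_apply]

theorem basisLow_apply (hh : h.x ≠ 0) (hl : l = g * h) (hlx : l.x ≠ 0) (a : ZMod N) :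
    basisLow hN hϖ hh hl hlx a = eLow hN hϖ hh hl a := by
  rw [basisLow, Module.Basis.coe_ofEquivFun]
  change ∑ c, (Pi.single a 1 : ZMod N → ℂ) c • eLow hN hϖ hh hl c = _
  simp [Pi.single_apply]

/-- The phase of `e_a` is linear in `k` with slope `j - a`, so lowering `i` and `k` by one trades
the factor `χ(j)` for `χ(a)`. Hence every power of `r` is diagonal in this basis. -/
theorem rUp_eUp (hh : h.x ≠ 0) (hl : l = g * h) (a : ZMod N) :
    rUp (eUp hN hϖ hh hl a) = chi ϖ a • eUp hN hϖ hh hl a := by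
  refine up_ext fun i j k => ?_
  rw [upCoord_rUp, upCoord_smul, upCoord_eUp, upCoord_eUp, eUpCoeff, eUpCoeff]
  by_cases hk : k = i + j
  · rw [if_pos hk, if_pos (by linear_combination hk)]
    have e : chi ϖ j * chi ϖ ((j - a) * (k - 1 - a) - half N * ((j - a) * (j - a - 1))) =
        chi ϖ a * chi ϖ ((j - a) * (k - a) - half N * ((j - a) * (j - a - 1))) := by
      rw [← chi_add hϖ, ← chi_add hϖ]; congr 1; ring
    linear_combination psiCoeff ϖ g h (j - a) * e
  · rw [if_neg hk, if_neg fun H => hk (by linear_combination H)]; ring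

theorem rLow_eLow (hh : h.x ≠ 0) (hl : l = g * h) (a : ZMod N) :
    rLow (eLow hN hϖ hh hl a) = chi ϖ a • eLow hN hϖ hh hl a := by
  refine low_ext fun i j k => ?_
  rw [lowCoord_rLow, lowCoord_smul, lowCoord_eLow, lowCoord_eLow, eLowCoeff, eLowCoeff]
  by_cases hk : k = i + j
  · rw [if_pos hk, if_pos (by linear_combination hk)]
    have e : chi ϖ j * chi ϖ ((a - j) * (i + 1) - half N * ((a - j) * (a - j - 1))) =
        chi ϖ a * chi ϖ ((a - j) * i - half N * ((a - j) * (a - j - 1))) := by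
      rw [← chi_add hϖ, ← chi_add hϖ]; congr 1; ring
    linear_combination thetaCoeff ϖ g h (a - j) * e
  · rw [if_neg hk, if_neg fun H => hk (by linear_combination H)]; ring

end Basis

end Borel

namespace Borel

open BialgMod

variable {N : ℕ} [NeZero N] {ϖ : ℂ}

/-! ### The `Ψ`-system -/

/-! ### Vanishing of `H^{g,h}_l` for `l ≠ gh` -/

section Vanishing

variable {hϖ : IsPrimitiveRoot ϖ N} {g h l : HalfPlane}

/-- Needed for `r` to have an eigenvector. -/
instance : FiniteDimensional ℂ (cyclicMod N hϖ l ⟶ cyclicMod N hϖ g ⊗ cyclicMod N hϖ h) := by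
  let φ : (cyclicMod N hϖ l ⟶ cyclicMod N hϖ g ⊗ cyclicMod N hϖ h) →ₗ[ℂ]
      (ZMod N → ZMod N → ZMod N → ℂ) :=
    { toFun := upCoord
      map_add' := fun x y => by funext i j k; exact upCoord_add x y i j k
      map_smul' := fun c x => by funext i j k; exact upCoord_smul c x i j k }
  exact FiniteDimensional.of_injective φ fun x y hxy => up_ext fun i j k =>
    congrFun (congrFun (congrFun hxy i) j) k

/-- The eigenvalue equation expresses the entry at `(i - 1, j, k - 1)` through the one at `(i, j,
k)`, so the relation for `b` becomes a first-order recursion along the slice `k = 0`. Multiplied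
over all of `ℤ/N`, it gives `v_l^N - v_g^N = (u_g v_h)^N`, that is `l.x = g.x + g.y h.x`. The other
coordinate comes from weights. -/
theorem eq_mul_of_eigenvector (hN : Odd N) (hh : h.x ≠ 0)
    {f : cyclicMod N hϖ l ⟶ cyclicMod N hϖ g ⊗ cyclicMod N hϖ h} (hf : f ≠ 0) {μ : ℂ}
    (hμ : μ ^ N = 1) (hr : rUp f = μ • f) : l = g * h := by
  have hμ0 : μ ≠ 0 := by rintro rfl; simp [zero_pow (NeZero.ne N)] at hμ
  have Hr : ∀ i j k, chi ϖ j * upCoord f (i - 1) j (k - 1) = μ * upCoord f i j k := by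
    intro i j k
    rw [← upCoord_rUp, hr, upCoord_smul]
  have Hr' : ∀ i j k, upCoord f (i - 1) j (k - 1) = μ * chi ϖ (-j) * upCoord f i j k := by
    intro i j k
    have hj := chi_ne_zero hϖ j
    rw [chi_neg hϖ, mul_right_comm, ← Hr]
    field_simp
  -- The support condition makes these the only possibly nonzero entries with `k = 0`.
  let G : ZMod N → ℂ := fun j => upCoord f (-j) j 0
  have HG : ∀ j, ((l.rootV N : ℂ) - g.rootV N * μ * chi ϖ (-j)) * G j =
      (g.rootU N : ℂ) * h.rootV N * μ * chi ϖ (1 - 2 * j) * G (j - 1) := by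
    intro j
    have h1 := upCoord_b f (-j) j (0 - 1)
    have h2 := Hr' (-j) j 0
    have h3 := Hr' (-j + 1) (j - 1) 0
    have c : chi ϖ (-j) * chi ϖ (-(j - 1)) = chi ϖ (1 - 2 * j) := by
      rw [← chi_add hϖ]; congr 1; ring
    rw [add_sub_cancel_right] at h3
    rw [sub_add_cancel] at h1
    have e : -(j - 1) = -j + 1 := by ring
    change (_ - _) * upCoord f (-j) j 0 = _ * upCoord f (-(j - 1)) (j - 1) 0
    rw [← c]
    rw [e] at h3 ⊢
    linear_combination h1 + (g.rootV N : ℂ) * h2 + (g.rootU N : ℂ) * h.rootV N * chi ϖ (-j) * h3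
  -- If the slice `k = 0` vanished, the eigenvalue equation with `μ ≠ 0` would carry the vanishing
  -- to every `k`.
  have hG0 : ∃ j, G j ≠ 0 := by
    by_contra! hG
    apply hf
    have H0 : ∀ k i j, upCoord f i j k = 0 := by
      intro k
      have : ∀ n : ℕ, ∀ i j, upCoord f i j (n : ZMod N) = 0 := by
        intro n
        induction n with
        | zero =>
          intro i j
          by_contra hc
          rw [Nat.cast_zero] at hc
          have hs := (upCoord_support hc).1
          have hi : i = -j := by linear_combination -hs
          exact hc (hi ▸ hG j)
        | succ n ih =>
          intro i j
          have := Hr i j ((n + 1 : ℕ) : ZMod N)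
          rw [Nat.cast_succ, add_sub_cancel_right, ih, mul_zero] at this
          rw [Nat.cast_succ]
          exact (mul_eq_zero.mp this.symm).resolve_left hμ0
      simpa using this k.val
    exact up_ext fun i j k => by rw [H0, upCoord_zero]
  obtain ⟨j₀, hj₀⟩ := hG0
  -- The coefficient of `G j` in the recursion is nonzero, so one nonzero entry makes all of them
  -- nonzero and they can be cancelled from the cyclic product.
  have hstep : ∀ j, G j ≠ 0 → G (j + 1) ≠ 0 := by
    intro j hj h0
    have := HG (j + 1)
    rw [h0, mul_zero, add_sub_cancel_right] at this
    exact mul_ne_zero (mul_ne_zero (mul_ne_zero (mul_ne_zero (HalfPlane.rootU_ne N g)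
      (HalfPlane.rootV_ne hN hh)) hμ0) (chi_ne_zero hϖ _)) hj this.symm
  have hall : ∀ j, G j ≠ 0 := by
    have : ∀ n : ℕ, G (j₀ + n) ≠ 0 := by
      intro n
      induction n with
      | zero => simpa using hj₀
      | succ n ih => rw [Nat.cast_succ, ← add_assoc]; exact hstep _ ih
    intro j
    simpa using this (j - j₀).val
  have hG1 : ∏ j, G (j - 1) = ∏ j, G j := Equiv.prod_comp (Equiv.subRight (1 : ZMod N)) G
  have hG2 : ∏ j : ZMod N, ((l.rootV N : ℂ) - g.rootV N * μ * chi ϖ (-j)) =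
      ∏ j : ZMod N, ((l.rootV N : ℂ) - g.rootV N * μ * chi ϖ j) :=
    Equiv.prod_comp (Equiv.neg (ZMod N))
      (fun j => (l.rootV N : ℂ) - g.rootV N * μ * chi ϖ j)
  have hprod := Finset.prod_congr (rfl : (Finset.univ : Finset (ZMod N)) = Finset.univ)
    fun j _ => HG j
  rw [Finset.prod_mul_distrib, Finset.prod_mul_distrib, Finset.prod_mul_distrib,
    Finset.prod_const, Finset.card_univ, ZMod.card, prod_chi hϖ,
    hG1, hG2, prod_sub_mul_chi hϖ] at hprod
  -- The phases `χ(1 - 2j)` multiply to `1`: the residues sum to zero for odd `N`, and `N · 1 = 0`.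
  have hsum : ∑ j : ZMod N, (1 - 2 * j) = 0 := by
    rw [Finset.sum_sub_distrib, ← Finset.mul_sum, sum_univ_zmod hN]
    simp
  rw [hsum, chi_zero, mul_one] at hprod
  have hprod := mul_right_cancel₀ (Finset.prod_ne_zero_iff.mpr fun j _ => hall j) hprod
  rw [mul_pow, mul_pow, mul_pow, hμ, mul_one, mul_one, HalfPlane.rootV_pow' hN,
    HalfPlane.rootV_pow' hN, HalfPlane.rootV_pow' hN, HalfPlane.rootU_pow' hN] at hprod
  have hx : l.x = g.x + g.y * h.x := by
    have : l.x - g.x = g.y * h.x := by exact_mod_cast hprod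
    linarith
  have hu := (upCoord_support (hall 0)).2
  have hy : l.y = g.y * h.y := by
    rw [← HalfPlane.rootU_pow hN l, hu, mul_pow, HalfPlane.rootU_pow hN, HalfPlane.rootU_pow hN]
  exact HalfPlane.ext hx hy

/-- Over `ℂ`, `r` has an eigenvector on a nonzero finite-dimensional space, with eigenvalue an
`N`-th root of unity because `r^N = 1`. -/
theorem up_eq_zero (hN : Odd N) (hh : h.x ≠ 0) (hl : l ≠ g * h)
    (f : cyclicMod N hϖ l ⟶ cyclicMod N hϖ g ⊗ cyclicMod N hϖ h) : f = 0 := by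
  by_contra hf
  have : Nontrivial (cyclicMod N hϖ l ⟶ cyclicMod N hϖ g ⊗ cyclicMod N hϖ h) := ⟨f, 0, hf⟩
  obtain ⟨μ, hμ⟩ := Module.End.exists_eigenvalue
    (rUp (hϖ := hϖ) (g := g) (h := h) (l := l))
  obtain ⟨v, hv⟩ := hμ.exists_hasEigenvector
  have hp := hv.pow_apply N
  rw [rUp_pow, Module.End.one_apply] at hp
  have hμN : μ ^ N = 1 := by
    have : (1 - μ ^ N) • v = 0 := by rw [sub_smul, one_smul, ← hp, sub_self]
    exact (sub_eq_zero.mp ((smul_eq_zero.mp this).resolve_right hv.2)).symm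
  exact hl (eq_mul_of_eigenvector hN hh hv.2 hμN hv.apply_eq_smul)

end Vanishing

theorem tcoord_coevLin (i j : ZMod N) :
    tcoord i j (coevLin N ϖ 1) = if j = -i then (phi ϖ (-i))⁻¹ else 0 := by
  rw [coevLin_one, map_sum, Finset.sum_eq_single i]
  · rw [map_smul, tcoord_tmul, basisVec_apply, basisVec_apply, if_pos rfl]; simp
  · intro m _ hm
    rw [map_smul, tcoord_tmul, basisVec_apply, if_neg (Ne.symm hm)]; simp
  · simp

theorem psiSystem (hN : Odd N) (hϖ : IsPrimitiveRoot ϖ N) :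
    (psiData N hN hϖ).IsPsiSystem ℂ where
  ground := by
    constructor
    · intro c c' H
      have := LinearMap.congr_fun (congrArg linMap H) (1 : ℂ)
      change c * 1 = c' * 1 at this
      simpa using this
    · intro f
      let F : ℂ →ₗ[ℂ] ℂ := linMap f
      refine ⟨F 1, hom_ext (LinearMap.ext_ring ?_)⟩
      change F 1 * 1 = F 1
      rw [mul_one]
  simple g := by
    constructor
    · intro c c' H
      have := congrFun (LinearMap.congr_fun (congrArg linMap H) (basisVec 0 : ZMod N → ℂ)) 0
      change c * (basisVec 0 : ZMod N → ℂ) 0 = c' * (basisVec 0 : ZMod N → ℂ) 0 at this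
      simpa [basisVec_apply] using this
    · intro f
      obtain ⟨c, hc⟩ := exists_eq_smul_id hN g.2 f
      exact ⟨c, hc.symm⟩
  hom_eq_zero g h hgh f := hom_eq_zero_of_ne hN (fun H => hgh (Subtype.ext H)) f
  duality_left g := by
    refine hom_ext (ext_basisVec fun k => funext fun m => ?_)
    have H := ev_right_apply (ϖ := ϖ) (coevLin N ϖ 1) k m
    rw [tcoord_coevLin] at H
    have e : phi ϖ (-k) * (if -k = -m then (phi ϖ (-m))⁻¹ else 0) =
        (basisVec k : ZMod N → ℂ) m := by
      rw [basisVec_apply]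
      by_cases hm : m = k
      · subst hm; rw [if_pos rfl, if_pos rfl, mul_inv_cancel₀ (phi_ne_zero hϖ _)]
      · rw [if_neg hm, if_neg fun H => hm (neg_injective H).symm, mul_zero]
    refine Eq.trans ?_ (H.trans e)
    rw [linMap_comp, linMap_comp, linMap_comp, linMap_comp, linMap_whiskerLeft, linMap_dStar]
    rfl
  duality_right g := by
    refine hom_ext (ext_basisVec fun k => funext fun m => ?_)
    have H := ev_left_apply (ϖ := ϖ) (coevLin N ϖ 1) k m
    rw [tcoord_coevLin] at H
    have e : phi ϖ k * (if m = -(-k) then (phi ϖ (-(-k)))⁻¹ else 0) =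
        (basisVec k : ZMod N → ℂ) m := by
      rw [basisVec_apply, neg_neg]
      by_cases hm : m = k
      · rw [if_pos hm, if_pos hm, mul_inv_cancel₀ (phi_ne_zero hϖ _)]
      · rw [if_neg hm, if_neg hm, mul_zero]
    refine Eq.trans ?_ (H.trans e)
    rw [linMap_comp, linMap_comp, linMap_comp, linMap_comp, linMap_whiskerLeft, linMap_bStar]
    rfl
  splitting g h := by
    rintro ⟨l, x, hx⟩
    -- A nonzero morphism forces `l = gh`, and then the resolution of the identity by `e_c^*` and
    -- `e_c` is available.
    have hl : l.1 = g.1 * h.1 := by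
      by_contra hl
      exact hx (up_eq_zero hN h.2 hl x)
    have H := sum_eLow_comp_eUp hN hϖ h.2 hl l.2
    refine Eq.subst (motive := fun f => f ∈ Submodule.span ℂ _) H ?_
    exact Submodule.sum_mem _ fun c _ => Submodule.subset_span ⟨l, _, _, rfl⟩

end Borel

/-! ### Operators on `H` -/

namespace PsiData

variable {C : Type u} [Category.{v} C] [MonoidalCategory C] {I : Type w} [Preadditive C]
  {k : Type*} [Field k] [Linear k C]

theorem linearMap_ext {M : Type*} [AddCommMonoid M] [Module k M] {D : PsiData C I}
    {f f' : D.H →ₗ[k] M}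
    (hl : ∀ i j l x, f (D.inLow k i j l x) = f' (D.inLow k i j l x))
    (hu : ∀ i j l y, f (D.inUp k i j l y) = f' (D.inUp k i j l y)) : f = f' := by
  classical
  refine LinearMap.prod_ext ?_ ?_
  · refine DirectSum.linearMap_ext k fun t => LinearMap.ext fun x => ?_
    have := hl t.1 t.2.1 t.2.2 x
    simp only [inLow, LinearMap.comp_apply] at this ⊢
    convert this
  · refine DirectSum.linearMap_ext k fun t => LinearMap.ext fun x => ?_
    have := hu t.1 t.2.1 t.2.2 x
    simp only [inUp, LinearMap.comp_apply] at this ⊢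
    convert this

theorem inLow_fst (D : PsiData C I) (i j l : I) (x : D.V i ⊗ D.V j ⟶ D.V l) :
    (D.inLow k i j l x).1 (i, j, l) = x := by
  classical
  exact DirectSum.lof_apply (R := k) (M := D.HLow) (i, j, l) x

theorem inLow_fst_of_ne (D : PsiData C I) (i j l : I) (x : D.V i ⊗ D.V j ⟶ D.V l)
    {t : I × I × I} (ht : t ≠ (i, j, l)) : (D.inLow k i j l x).1 t = 0 := by
  classical
  exact DirectSum.of_eq_of_ne _ _ _ ht

theorem inLow_snd (D : PsiData C I) (i j l : I) (x : D.V i ⊗ D.V j ⟶ D.V l) :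
    (D.inLow k i j l x).2 = 0 := rfl

theorem inUp_snd (D : PsiData C I) (i j l : I) (y : D.V l ⟶ D.V i ⊗ D.V j) :
    (D.inUp k i j l y).2 (i, j, l) = y := by
  classical
  exact DirectSum.lof_apply (R := k) (M := D.HUp) (i, j, l) y

theorem inUp_snd_of_ne (D : PsiData C I) (i j l : I) (y : D.V l ⟶ D.V i ⊗ D.V j)
    {t : I × I × I} (ht : t ≠ (i, j, l)) : (D.inUp k i j l y).2 t = 0 := by
  classical
  exact DirectSum.of_eq_of_ne _ _ _ ht

theorem inUp_fst (D : PsiData C I) (i j l : I) (y : D.V l ⟶ D.V i ⊗ D.V j) :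
    (D.inUp k i j l y).1 = 0 := rfl

theorem endOfComponents_inLow (D : PsiData C I)
    (f : ∀ i j l : I, (D.V i ⊗ D.V j ⟶ D.V l) →ₗ[k] D.H)
    (g : ∀ i j l : I, (D.V l ⟶ D.V i ⊗ D.V j) →ₗ[k] D.H) (i j l : I)
    (x : D.V i ⊗ D.V j ⟶ D.V l) :
    D.endOfComponents k f g (D.inLow k i j l x) = f i j l x := by
  classical
  simp only [endOfComponents, inLow, LinearMap.comp_apply, LinearMap.coprod_apply,
    LinearMap.inl_apply, map_zero, add_zero]
  exact DirectSum.toModule_lof (φ := fun t : I × I × I => f t.1 t.2.1 t.2.2) k (i, j, l) x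

theorem endOfComponents_inUp (D : PsiData C I)
    (f : ∀ i j l : I, (D.V i ⊗ D.V j ⟶ D.V l) →ₗ[k] D.H)
    (g : ∀ i j l : I, (D.V l ⟶ D.V i ⊗ D.V j) →ₗ[k] D.H) (i j l : I)
    (y : D.V l ⟶ D.V i ⊗ D.V j) :
    D.endOfComponents k f g (D.inUp k i j l y) = g i j l y := by
  classical
  simp only [endOfComponents, inUp, LinearMap.comp_apply, LinearMap.coprod_apply,
    LinearMap.inr_apply, map_zero, zero_add]
  exact DirectSum.toModule_lof (φ := fun t : I × I × I => g t.1 t.2.1 t.2.2) k (i, j, l) y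

/-- The operator on `H` that acts on every summand by a given operator. -/
def gradedOp (D : PsiData C I) (f : ∀ t, Module.End k (D.HLow t))
    (g : ∀ t, Module.End k (D.HUp t)) : Module.End k D.H :=
  LinearMap.prodMap (DirectSum.lmap f) (DirectSum.lmap g)

section gradedOp

variable {D : PsiData C I} (f f' : ∀ t, Module.End k (D.HLow t))
    (g g' : ∀ t, Module.End k (D.HUp t))

theorem gradedOp_fst (z : D.H) (t : I × I × I) : (D.gradedOp f g z).1 t = f t (z.1 t) := rfl

theorem gradedOp_snd (z : D.H) (t : I × I × I) : (D.gradedOp f g z).2 t = g t (z.2 t) := rfl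

theorem gradedOp_inLow (i j l : I) (x : D.V i ⊗ D.V j ⟶ D.V l) :
    D.gradedOp f g (D.inLow k i j l x) = D.inLow k i j l (f (i, j, l) x) := by
  classical
  simp only [gradedOp, inLow, LinearMap.comp_apply, LinearMap.prodMap_apply, LinearMap.inl_apply,
    map_zero]
  congr 1
  exact DirectSum.lmap_lof f (i, j, l) x

theorem gradedOp_inUp (i j l : I) (y : D.V l ⟶ D.V i ⊗ D.V j) :
    D.gradedOp f g (D.inUp k i j l y) = D.inUp k i j l (g (i, j, l) y) := by
  classical
  simp only [gradedOp, inUp, LinearMap.comp_apply, LinearMap.prodMap_apply, LinearMap.inr_apply,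
    map_zero]
  congr 1
  exact DirectSum.lmap_lof g (i, j, l) y

theorem gradedOp_mul :
    D.gradedOp f g * D.gradedOp f' g' = D.gradedOp (fun t => f t * f' t) fun t => g t * g' t :=
  LinearMap.ext fun _ => Prod.ext (DFinsupp.ext fun _ => rfl) (DFinsupp.ext fun _ => rfl)

theorem gradedOp_one : D.gradedOp (fun _ => (1 : Module.End k _)) (fun _ => 1) = 1 :=
  LinearMap.ext fun _ => Prod.ext (DFinsupp.ext fun _ => rfl) (DFinsupp.ext fun _ => rfl)

theorem gradedOp_pow (n : ℕ) :
    D.gradedOp f g ^ n = D.gradedOp (fun t => f t ^ n) fun t => g t ^ n := by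
  induction n with
  | zero => exact gradedOp_one.symm
  | succ n ih =>
    rw [pow_succ, ih, gradedOp_mul]
    simp only [pow_succ]

end gradedOp

/-- Multiplication of the summands of `H` by given scalars. -/
def scalarOp (D : PsiData C I) : (I × I × I → k) →* Module.End k D.H where
  toFun c := D.gradedOp (fun t => c t • 1) (fun t => c t • 1)
  map_one' := by
    simp only [Pi.one_apply, one_smul]
    exact gradedOp_one
  map_mul' c c' := by
    rw [gradedOp_mul]
    simp only [Pi.mul_apply, smul_mul_smul_comm, one_mul]

theorem scalarOp_apply (D : PsiData C I) (c : I × I × I → k) :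
    D.scalarOp c = D.gradedOp (fun t => c t • 1) (fun t => c t • 1) := rfl

/-- Multiplication of the summands of `H` by given nonzero scalars. -/
def scalarUnit (D : PsiData C I) : (I × I × I → kˣ) →* (Module.End k D.H)ˣ :=
  (Units.map D.scalarOp).comp (MulEquiv.piUnits.symm : (I × I × I → kˣ) ≃* _).toMonoidHom

theorem coe_scalarUnit (D : PsiData C I) (c : I × I × I → kˣ) :
    (D.scalarUnit c : Module.End k D.H) = D.scalarOp fun t => (c t : k) := rfl

theorem scalarOp_inLow (D : PsiData C I) (c : I × I × I → k) (i j l : I)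
    (x : D.V i ⊗ D.V j ⟶ D.V l) :
    D.scalarOp c (D.inLow k i j l x) = c (i, j, l) • D.inLow k i j l x := by
  rw [scalarOp_apply, gradedOp_inLow, ← map_smul]; rfl

theorem scalarOp_inUp (D : PsiData C I) (c : I × I × I → k) (i j l : I)
    (y : D.V l ⟶ D.V i ⊗ D.V j) :
    D.scalarOp c (D.inUp k i j l y) = c (i, j, l) • D.inUp k i j l y := by
  rw [scalarOp_apply, gradedOp_inUp, ← map_smul]; rfl

theorem scalarOp_mul_gradedOp (D : PsiData C I) (c : I × I × I → k)
    (f : ∀ t, Module.End k (D.HLow t)) (g : ∀ t, Module.End k (D.HUp t)) :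
    D.scalarOp c * D.gradedOp f g = D.gradedOp (fun t => c t • f t) fun t => c t • g t := by
  rw [scalarOp_apply, gradedOp_mul]
  simp only [smul_mul_assoc, one_mul]

theorem gradedOp_mul_scalarOp (D : PsiData C I) (c : I × I × I → k)
    (f : ∀ t, Module.End k (D.HLow t)) (g : ∀ t, Module.End k (D.HUp t)) :
    D.gradedOp f g * D.scalarOp c = D.gradedOp (fun t => c t • f t) fun t => c t • g t := by
  rw [scalarOp_apply, gradedOp_mul]
  simp only [mul_smul_comm, mul_one]

/-! ### Passing scalars through `A` and `B` -/

section AB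

variable [MonoidalPreadditive C] [MonoidalLinear k C] (D : PsiData C I) (i j l : I)

theorem opA_inLow (x : D.V i ⊗ D.V j ⟶ D.V l) :
    D.opA k (D.inLow k i j l x) = D.inUp k (D.star i) l j (D.aLow k i j l x) :=
  D.endOfComponents_inLow _ _ i j l x

theorem opA_inUp (y : D.V l ⟶ D.V i ⊗ D.V j) :
    D.opA k (D.inUp k i j l y) = D.inLow k (D.star i) l j (D.aUp k i j l y) :=
  D.endOfComponents_inUp _ _ i j l y

theorem opB_inLow (x : D.V i ⊗ D.V j ⟶ D.V l) :
    D.opB k (D.inLow k i j l x) = D.inUp k l (D.star j) i (D.bLow k i j l x) :=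
  D.endOfComponents_inLow _ _ i j l x

theorem opB_inUp (y : D.V l ⟶ D.V i ⊗ D.V j) :
    D.opB k (D.inUp k i j l y) = D.inLow k l (D.star j) i (D.bUp k i j l y) :=
  D.endOfComponents_inUp _ _ i j l y

/-- The effect of `A` on indices. -/
def idxA (t : I × I × I) : I × I × I := (D.star t.1, t.2.2, t.2.1)

/-- The effect of `B` on indices. -/
def idxB (t : I × I × I) : I × I × I := (t.2.2, D.star t.2.1, t.1)

theorem idxB_idxB (t : I × I × I) : D.idxB (D.idxB t) = t := by
  simp [idxB, D.star_star]

/-- `A` sends the summand with index `t` to the one with index `idxA t`, and `idxA` is an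
involution. -/
theorem opA_mul_scalarOp (c : I × I × I → k) :
    D.opA k * D.scalarOp c = D.scalarOp (c ∘ D.idxA) * D.opA k := by
  refine linearMap_ext (fun i j l x => ?_) (fun i j l x => ?_)
  · rw [Module.End.mul_apply, Module.End.mul_apply, scalarOp_inLow, map_smul, opA_inLow,
      scalarOp_inUp]
    congr 1
    simp [idxA, D.star_star]
  · rw [Module.End.mul_apply, Module.End.mul_apply, scalarOp_inUp, map_smul, opA_inUp,
      scalarOp_inLow]
    congr 1
    simp [idxA, D.star_star]

theorem opB_mul_scalarOp (c : I × I × I → k) :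
    D.opB k * D.scalarOp c = D.scalarOp (c ∘ D.idxB) * D.opB k := by
  refine linearMap_ext (fun i j l x => ?_) (fun i j l x => ?_)
  · rw [Module.End.mul_apply, Module.End.mul_apply, scalarOp_inLow, map_smul, opB_inLow,
      scalarOp_inUp]
    congr 1
    simp [idxB, D.star_star]
  · rw [Module.End.mul_apply, Module.End.mul_apply, scalarOp_inUp, map_smul, opB_inUp,
      scalarOp_inLow]
    congr 1
    simp [idxB, D.star_star]

end AB

end PsiData

namespace Borel

open BialgMod PsiData

variable {N : ℕ} [NeZero N] {ϖ : ℂ} {hN : Odd N} {hϖ : IsPrimitiveRoot ϖ N}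

/-! ### The relations between `A`, `B`, `r` and `s` -/

section Relations

/-- Elements of summands whose indices agree only propositionally, as with `g** = g`, can still be
compared by coordinates. -/
theorem inLow_congr {g g' h h' l l' : BorelIdx} (eg : g = g') (eh : h = h') (el : l = l')
    {x : (psiData N hN hϖ).V g ⊗ (psiData N hN hϖ).V h ⟶ (psiData N hN hϖ).V l}
    {x' : (psiData N hN hϖ).V g' ⊗ (psiData N hN hϖ).V h' ⟶ (psiData N hN hϖ).V l'}
    (H : ∀ i j k, lowCoord x i j k = lowCoord x' i j k) :
    (psiData N hN hϖ).inLow ℂ g h l x = (psiData N hN hϖ).inLow ℂ g' h' l' x' := by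
  subst eg eh el
  rw [low_ext H]

theorem inUp_congr {g g' h h' l l' : BorelIdx} (eg : g = g') (eh : h = h') (el : l = l')
    {y : (psiData N hN hϖ).V l ⟶ (psiData N hN hϖ).V g ⊗ (psiData N hN hϖ).V h}
    {y' : (psiData N hN hϖ).V l' ⟶ (psiData N hN hϖ).V g' ⊗ (psiData N hN hϖ).V h'}
    (H : ∀ i j k, upCoord y i j k = upCoord y' i j k) :
    (psiData N hN hϖ).inUp ℂ g h l y = (psiData N hN hϖ).inUp ℂ g' h' l' y' := by
  subst eg eh el
  rw [up_ext H]

variable (hN hϖ)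

/-- The operator `r` on `H`. -/
noncomputable def opR : Module.End ℂ (psiData N hN hϖ).H :=
  (psiData N hN hϖ).gradedOp (fun _ => rLow) (fun _ => rUp)

/-- The operator `s` on `H`. -/
noncomputable def opSh : Module.End ℂ (psiData N hN hϖ).H :=
  (psiData N hN hϖ).gradedOp (fun _ => sLow) (fun _ => sUp)

theorem opR_pow_card : opR hN hϖ ^ N = 1 := by
  rw [opR, gradedOp_pow]
  exact (congrArg₂ (psiData N hN hϖ).gradedOp (funext fun _ => rLow_pow)
    (funext fun _ => rUp_pow)).trans gradedOp_one

theorem opSh_pow_card : opSh hN hϖ ^ N = 1 := by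
  rw [opSh, gradedOp_pow]
  exact (congrArg₂ (psiData N hN hϖ).gradedOp (funext fun _ => sLow_pow)
    (funext fun _ => sUp_pow)).trans gradedOp_one

theorem opA_mul_opA : (psiData N hN hϖ).opA ℂ * (psiData N hN hϖ).opA ℂ = 1 := by
  refine PsiData.linearMap_ext (fun g h l x => ?_) (fun g h l x => ?_)
  · rw [Module.End.mul_apply, opA_inLow, opA_inUp, Module.End.one_apply]
    refine inLow_congr (PsiData.star_star _ g) rfl rfl fun i j k => ?_
    rw [lowCoord_aUp, upCoord_aLow, neg_neg]
    exact mul_inv_cancel_left₀ (phi_ne_zero hϖ _) _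
  · rw [Module.End.mul_apply, opA_inUp, opA_inLow, Module.End.one_apply]
    refine inUp_congr (PsiData.star_star _ g) rfl rfl fun i j k => ?_
    rw [upCoord_aLow, lowCoord_aUp, neg_neg]
    exact inv_mul_cancel_left₀ (phi_ne_zero hϖ _) _

theorem opB_mul_opB : (psiData N hN hϖ).opB ℂ * (psiData N hN hϖ).opB ℂ = 1 := by
  refine PsiData.linearMap_ext (fun g h l x => ?_) (fun g h l x => ?_)
  · rw [Module.End.mul_apply, opB_inLow, opB_inUp, Module.End.one_apply]
    refine inLow_congr rfl (PsiData.star_star _ h) rfl fun i j k => ?_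
    rw [lowCoord_bUp, upCoord_bLow, neg_neg]
    exact mul_inv_cancel_left₀ (phi_ne_zero hϖ _) _
  · rw [Module.End.mul_apply, opB_inUp, opB_inLow, Module.End.one_apply]
    refine inUp_congr rfl (PsiData.star_star _ h) rfl fun i j k => ?_
    rw [upCoord_bLow, lowCoord_bUp, neg_neg]
    exact inv_mul_cancel_left₀ (phi_ne_zero hϖ _) _

theorem opSh_mul_opA_mul_opSh :
    opSh hN hϖ * (psiData N hN hϖ).opA ℂ * opSh hN hϖ = (psiData N hN hϖ).opA ℂ := by
  refine PsiData.linearMap_ext (fun g h l x => ?_) (fun g h l x => ?_)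
  · rw [Module.End.mul_apply, Module.End.mul_apply, opSh, gradedOp_inLow, opA_inLow, opA_inLow,
      gradedOp_inUp]
    refine inUp_congr rfl rfl rfl fun i j k => ?_
    rw [upCoord_sUp, upCoord_aLow, upCoord_aLow, lowCoord_sLow, sub_add_cancel, sub_add_cancel]
  · rw [Module.End.mul_apply, Module.End.mul_apply, opSh, gradedOp_inUp, opA_inUp, opA_inUp,
      gradedOp_inLow]
    refine inLow_congr rfl rfl rfl fun i j k => ?_
    rw [lowCoord_sLow, lowCoord_aUp, lowCoord_aUp, upCoord_sUp, add_sub_cancel_right,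
      add_sub_cancel_right]

theorem opR_mul_opB_mul_opR :
    opR hN hϖ * (psiData N hN hϖ).opB ℂ * opR hN hϖ = (psiData N hN hϖ).opB ℂ := by
  refine PsiData.linearMap_ext (fun g h l x => ?_) (fun g h l x => ?_)
  · rw [Module.End.mul_apply, Module.End.mul_apply, opR, gradedOp_inLow, opB_inLow, opB_inLow,
      gradedOp_inUp]
    refine inUp_congr rfl rfl rfl fun i j k => ?_
    rw [upCoord_rUp, upCoord_bLow, upCoord_bLow, lowCoord_rLow, sub_add_cancel, sub_add_cancel,
      chi_neg hϖ]
    have := chi_ne_zero hϖ j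
    field_simp
  · rw [Module.End.mul_apply, Module.End.mul_apply, opR, gradedOp_inUp, opB_inUp, opB_inUp,
      gradedOp_inLow]
    refine inLow_congr rfl rfl rfl fun i j k => ?_
    rw [lowCoord_rLow, lowCoord_bUp, lowCoord_bUp, upCoord_rUp, add_sub_cancel_right,
      add_sub_cancel_right, chi_neg hϖ]
    have := chi_ne_zero hϖ j
    field_simp

theorem phi_add_one_eq_chi_mul (hN : Odd N) (hϖ : IsPrimitiveRoot ϖ N) (i : ZMod N) :
    phi ϖ (i + 1) = chi ϖ i * phi ϖ i := phi_add_one hN hϖ i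

/-- Besides `φ(m + 1) = χ(m) φ(m)` this needs the support condition `k = i + j`, which relates the
`χ` factor of `r` before and after the permutation of indices by `A`. -/
theorem opA_mul_opR :
    (psiData N hN hϖ).opA ℂ * opR hN hϖ =
      opR hN hϖ * (psiData N hN hϖ).opA ℂ * opSh hN hϖ := by
  refine PsiData.linearMap_ext (fun g h l x => ?_) (fun g h l x => ?_)
  · rw [Module.End.mul_apply, Module.End.mul_apply, Module.End.mul_apply, opR, opSh,
      gradedOp_inLow, gradedOp_inLow, opA_inLow, opA_inLow, gradedOp_inUp]
    refine inUp_congr rfl rfl rfl fun i j k => ?_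
    rw [upCoord_rUp, upCoord_aLow, upCoord_aLow, lowCoord_rLow, lowCoord_sLow]
    have e : -(i - 1) = -i + 1 := by ring
    rw [e, sub_add_cancel, phi_add_one_eq_chi_mul hN hϖ]
    by_cases hc : lowCoord x (-i + 1) k (j + 1) = 0
    · rw [hc]; ring
    · have hj : chi ϖ j = chi ϖ (-i) * chi ϖ k := by
        rw [← chi_add hϖ]; congr 1; linear_combination (lowCoord_support hc).1
      rw [hj]
      have h1 := chi_ne_zero hϖ (-i)
      have h2 := phi_ne_zero hϖ (-i)
      field_simp
  · rw [Module.End.mul_apply, Module.End.mul_apply, Module.End.mul_apply, opR, opSh,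
      gradedOp_inUp, gradedOp_inUp, opA_inUp, opA_inUp, gradedOp_inLow]
    refine inLow_congr rfl rfl rfl fun i j k => ?_
    rw [lowCoord_rLow, lowCoord_aUp, lowCoord_aUp, upCoord_rUp, upCoord_sUp]
    have e : -(i + 1) = -i - 1 := by ring
    rw [e, add_sub_cancel_right, phi_add_one_eq_chi_mul hN hϖ]
    by_cases hc : upCoord x (-i - 1) k (j - 1) = 0
    · rw [hc]; ring
    · have hj : chi ϖ k = chi ϖ i * chi ϖ j := by
        rw [← chi_add hϖ]; congr 1; linear_combination -(upCoord_support hc).1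
      rw [hj]
      ring

/-- Here the recursion of `φ` alone suffices: the shift made by `s` changes the factor `φ` of `B` by
a value of `χ`, which is the one supplied by `r`. -/
theorem opB_mul_opSh :
    (psiData N hN hϖ).opB ℂ * opSh hN hϖ =
      opSh hN hϖ * (psiData N hN hϖ).opB ℂ * opR hN hϖ := by
  refine PsiData.linearMap_ext (fun g h l x => ?_) (fun g h l x => ?_)
  · rw [Module.End.mul_apply, Module.End.mul_apply, Module.End.mul_apply, opR, opSh,
      gradedOp_inLow, gradedOp_inLow, opB_inLow, opB_inLow, gradedOp_inUp]
    refine inUp_congr rfl rfl rfl fun i j k => ?_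
    rw [upCoord_sUp, upCoord_bLow, upCoord_bLow, lowCoord_rLow, lowCoord_sLow, sub_add_cancel]
    have e : -(j - 1) = -j + 1 := by ring
    have e2 : phi ϖ j = chi ϖ (j - 1) * phi ϖ (j - 1) := by
      rw [← phi_add_one_eq_chi_mul hN hϖ, sub_add_cancel]
    have e3 : chi ϖ (-j + 1) * chi ϖ (j - 1) = 1 := by
      rw [← chi_add hϖ, ← chi_zero (N := N) (ϖ := ϖ)]; congr 1; ring
    rw [e, e2, mul_inv, eq_inv_of_mul_eq_one_left e3]
    ring
  · rw [Module.End.mul_apply, Module.End.mul_apply, Module.End.mul_apply, opR, opSh,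
      gradedOp_inUp, gradedOp_inUp, opB_inUp, opB_inUp, gradedOp_inLow]
    refine inLow_congr rfl rfl rfl fun i j k => ?_
    rw [lowCoord_sLow, lowCoord_bUp, lowCoord_bUp, upCoord_rUp, upCoord_sUp, add_sub_cancel_right]
    have e : -(j + 1) = -j - 1 := by ring
    have e2 : phi ϖ (-j) = chi ϖ (-j - 1) * phi ϖ (-j - 1) := by
      rw [← phi_add_one_eq_chi_mul hN hϖ, sub_add_cancel]
    rw [e, e2]
    ring

/-- `(AB)³` restores the position of each entry and leaves a product of ratios `φ(m)/φ(-m) = χ(-m)`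
or their inverses, one for each of `i`, `j`, `k`. These cancel because `k = i + j` on the support.
-/
theorem opC_eq_one : (psiData N hN hϖ).opC ℂ = 1 := by
  have hp : ∀ m : ZMod N, phi ϖ m = chi ϖ (-m) * phi ϖ (-m) := by
    intro m
    rw [phi_eq hN hϖ, phi_eq hN hϖ, ← chi_add hϖ]; congr 1
    linear_combination (-m) * two_mul_half hN
  rw [opC, pow_succ, pow_two]
  refine PsiData.linearMap_ext (fun g h l x => ?_) (fun g h l x => ?_)
  · rw [Module.End.mul_apply, Module.End.mul_apply, Module.End.mul_apply, Module.End.mul_apply,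
      Module.End.mul_apply, opB_inLow, opA_inUp, opB_inLow, opA_inUp, opB_inLow, opA_inUp,
      Module.End.one_apply]
    refine inLow_congr (PsiData.star_star _ g) (PsiData.star_star _ h) (PsiData.star_star _ l)
      fun i j k => ?_
    rw [lowCoord_aUp, upCoord_bLow, lowCoord_aUp, upCoord_bLow, lowCoord_aUp, upCoord_bLow]
    simp only [neg_neg]
    by_cases hc : lowCoord x i j k = 0
    · rw [hc]; ring
    · have hk := (lowCoord_support hc).1
      have c : chi ϖ (-i) * chi ϖ (-j) = chi ϖ (-k) := by
        rw [← chi_add hϖ, hk, neg_add]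
      have := phi_ne_zero hϖ (-i)
      have := phi_ne_zero hϖ (-j)
      have := phi_ne_zero hϖ (-k)
      have := chi_ne_zero hϖ (-k)
      rw [hp i, hp j, hp k]
      field_simp
      linear_combination c
  · rw [Module.End.mul_apply, Module.End.mul_apply, Module.End.mul_apply, Module.End.mul_apply,
      Module.End.mul_apply, opB_inUp, opA_inLow, opB_inUp, opA_inLow, opB_inUp, opA_inLow,
      Module.End.one_apply]
    refine inUp_congr (PsiData.star_star _ g) (PsiData.star_star _ h) (PsiData.star_star _ l)
      fun i j k => ?_
    rw [upCoord_aLow, lowCoord_bUp, upCoord_aLow, lowCoord_bUp, upCoord_aLow, lowCoord_bUp]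
    simp only [neg_neg]
    by_cases hc : upCoord x i j k = 0
    · rw [hc]; ring
    · have hk := (upCoord_support hc).1
      have c : chi ϖ (-i) * chi ϖ (-j) = chi ϖ (-k) := by
        rw [← chi_add hϖ, hk, neg_add]
      have := phi_ne_zero hϖ (-i)
      have := phi_ne_zero hϖ (-j)
      have := phi_ne_zero hϖ (-k)
      have := chi_ne_zero hϖ (-k)
      rw [hp i, hp j, hp k]
      field_simp
      linear_combination c

theorem opR_mul_opSh : opR hN hϖ * opSh hN hϖ =
    (psiData N hN hϖ).diagOp ℂ ϖ⁻¹ ϖ * (opSh hN hϖ * opR hN hϖ) := by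
  rw [opR, opSh, gradedOp_mul, gradedOp_mul]
  refine (congrArg₂ (psiData N hN hϖ).gradedOp (funext fun _ => rLow_mul_sLow)
    (funext fun _ => rUp_mul_sUp)).trans ?_
  exact LinearMap.ext fun _ => Prod.ext (DFinsupp.ext fun _ => rfl) (DFinsupp.ext fun _ => rfl)

end Relations

/-- `A` embeds `H_{g,h}^l` into `H^{g*,l}_h`, which vanishes because `h ≠ g⁻¹ l`. -/
theorem low_eq_zero (hN : Odd N) {g h l : BorelIdx} (hl : l.1 ≠ g.1 * h.1)
    (x : (psiData N hN hϖ).V g ⊗ (psiData N hN hϖ).V h ⟶ (psiData N hN hϖ).V l) : x = 0 := by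
  have H : (psiData N hN hϖ).aLow ℂ g h l x = 0 :=
    up_eq_zero hN l.2 (fun H => hl (by
      change h.1 = g.1⁻¹ * l.1 at H
      rw [H, mul_inv_cancel_left])) _
  refine low_ext fun i j k => ?_
  have H1 := upCoord_aLow x (-i) k j
  rw [H, upCoord_zero, neg_neg] at H1
  rw [lowCoord_zero]
  exact (mul_eq_zero.mp H1.symm).resolve_left (inv_ne_zero (phi_ne_zero hϖ _))

/-- All summands with `l ≠ gh` are zero, so identities such as `u_l = u_g u_h` may be used freely
when comparing scalars. -/
theorem scalarOp_congr {c c' : BorelIdx × BorelIdx × BorelIdx → ℂ}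
    (H : ∀ g h l : BorelIdx, l.1 = g.1 * h.1 → c (g, h, l) = c' (g, h, l)) :
    (psiData N hN hϖ).scalarOp c = (psiData N hN hϖ).scalarOp c' := by
  refine PsiData.linearMap_ext (fun g h l x => ?_) (fun g h l y => ?_)
  · rw [scalarOp_inLow, scalarOp_inLow]
    by_cases hl : l.1 = g.1 * h.1
    · rw [H g h l hl]
    · rw [low_eq_zero hN hl x, map_zero, smul_zero, smul_zero]
  · rw [scalarOp_inUp, scalarOp_inUp]
    by_cases hl : l.1 = g.1 * h.1
    · rw [H g h l hl]
    · rw [up_eq_zero hN h.2 hl y, map_zero, smul_zero, smul_zero]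

end Borel

/-! ### Relations in a group -/

namespace HeisenbergRel

variable {G : Type*} [Group G] {a b r s z : G}

theorem conj_b_r (hb : b * b = 1) (hr : r * b * r = b) : b * r * b = r⁻¹ := by
  refine eq_inv_of_mul_eq_one_right ?_
  rw [← mul_assoc, ← mul_assoc, hr, hb]

theorem conj_b_s (hb : b * b = 1) (hr : r * b * r = b) (hs : b * s = s * b * r) :
    b * s * b = s * r⁻¹ := by
  rw [hs, mul_assoc s, mul_assoc s, conj_b_r hb hr]

theorem conj_a_r (ha : a * a = 1) (hs : s * a * s = a) (hr : a * r = r * a * s) :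
    a * r * a = r * s⁻¹ := by
  rw [hr, mul_assoc r, mul_assoc r, conj_b_r ha hs]

/-- Conjugation by `a` takes `r⁻¹` to `s r⁻¹`; conjugation by `b` then gives `(s r⁻¹) r = s`. This
is why `√L` is to `s` what `√R` is to `r`. -/
theorem conj_ba_r (ha : a * a = 1) (hb : b * b = 1) (hsa : s * a * s = a) (hrb : r * b * r = b)
    (har : a * r = r * a * s) (hbs : b * s = s * b * r) : b * a * r⁻¹ * a * b = s := by
  have ha' : a⁻¹ = a := inv_eq_of_mul_eq_one_left ha
  have hb' : b⁻¹ = b := inv_eq_of_mul_eq_one_left hb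
  have h1 : a * r⁻¹ * a = s * r⁻¹ := by
    have := congrArg (·⁻¹) (conj_a_r ha hsa har)
    simpa [mul_inv_rev, ha', mul_assoc] using this
  have h2 : b * r⁻¹ * b = r := by
    have := congrArg (·⁻¹) (conj_b_r hb hrb)
    simpa [mul_inv_rev, hb', mul_assoc] using this
  calc b * a * r⁻¹ * a * b = b * (a * r⁻¹ * a) * b := by group
    _ = b * s * (b * b) * r⁻¹ * b := by rw [h1, hb]; group
    _ = (b * s * b) * (b * r⁻¹ * b) := by group
    _ = s := by rw [conj_b_s hb hrb hbs, h2]; group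

/-- In the induction step one `r` moves past `s^{n+1}` and produces `z^{n+1}`; the exponents add up
to a triangular number. -/
theorem pow_mul_pow (hz : r * s = z * (s * r)) (hzr : Commute z r) (hzs : Commute z s) (n : ℕ) :
    r ^ n * (s * r⁻¹) ^ n * (s ^ n)⁻¹ = z ^ (n * (n + 1) / 2) := by
  have h1 : ∀ n : ℕ, r * s ^ n = z ^ n * s ^ n * r := by
    intro n
    induction n with
    | zero => simp
    | succ n ih =>
      rw [pow_succ s, ← mul_assoc, ih, mul_assoc, hz, pow_succ z, mul_assoc, mul_assoc, mul_assoc,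
        mul_assoc]
      congr 1
      rw [← mul_assoc, ← mul_assoc, ← (hzs.pow_right n).eq, mul_assoc, mul_assoc]
  induction n with
  | zero => simp
  | succ n ih =>
    have ih' : r ^ n * (s * r⁻¹) ^ n = z ^ (n * (n + 1) / 2) * s ^ n := by
      rw [← ih]; group
    have e : (n + 1) * (n + 1 + 1) / 2 = n * (n + 1) / 2 + (n + 1) := by
      have : (n + 1) * (n + 1 + 1) = n * (n + 1) + (n + 1) * 2 := by ring
      rw [this, Nat.add_mul_div_right _ _ two_pos]
    calc r ^ (n + 1) * (s * r⁻¹) ^ (n + 1) * (s ^ (n + 1))⁻¹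
        = r * (r ^ n * (s * r⁻¹) ^ n) * (s * r⁻¹) * (s ^ (n + 1))⁻¹ := by
          rw [pow_succ' r, pow_succ (s * r⁻¹)]; group
      _ = r * z ^ (n * (n + 1) / 2) * s ^ (n + 1) * r⁻¹ * (s ^ (n + 1))⁻¹ := by
          rw [ih', pow_succ s]; group
      _ = z ^ (n * (n + 1) / 2) * (r * s ^ (n + 1)) * r⁻¹ * (s ^ (n + 1))⁻¹ := by
          rw [← (hzr.pow_left _).eq]; group
      _ = z ^ ((n + 1) * (n + 1 + 1) / 2) := by
          rw [h1, e, pow_add]; group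

end HeisenbergRel

namespace Borel

open BialgMod PsiData

variable {N : ℕ} [NeZero N] {ϖ : ℂ} (hN : Odd N) (hϖ : IsPrimitiveRoot ϖ N)

/-! ### The operators `√R`, `√L` and `q` -/

/-- `A` as an invertible operator. -/
noncomputable def unitA : (Module.End ℂ (psiData N hN hϖ).H)ˣ :=
  ⟨(psiData N hN hϖ).opA ℂ, (psiData N hN hϖ).opA ℂ, opA_mul_opA hN hϖ, opA_mul_opA hN hϖ⟩

/-- `B` as an invertible operator. -/
noncomputable def unitB : (Module.End ℂ (psiData N hN hϖ).H)ˣ :=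
  ⟨(psiData N hN hϖ).opB ℂ, (psiData N hN hϖ).opB ℂ, opB_mul_opB hN hϖ, opB_mul_opB hN hϖ⟩

/-- `r` as an invertible operator. -/
noncomputable def unitR : (Module.End ℂ (psiData N hN hϖ).H)ˣ :=
  Units.ofPowEqOne (opR hN hϖ) N (opR_pow_card hN hϖ) (NeZero.ne N)

/-- `s` as an invertible operator. -/
noncomputable def unitSh : (Module.End ℂ (psiData N hN hϖ).H)ˣ :=
  Units.ofPowEqOne (opSh hN hϖ) N (opSh_pow_card hN hϖ) (NeZero.ne N)

theorem coe_unitB : (unitB hN hϖ : Module.End ℂ (psiData N hN hϖ).H) =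
    (psiData N hN hϖ).opB ℂ := rfl

theorem coe_unitR : (unitR hN hϖ : Module.End ℂ (psiData N hN hϖ).H) = opR hN hϖ := rfl

theorem coe_unitSh : (unitSh hN hϖ : Module.End ℂ (psiData N hN hϖ).H) = opSh hN hϖ := rfl

/-- The scalar `v_g / v_l`. -/
noncomputable def ratioR (t : BorelIdx × BorelIdx × BorelIdx) : ℂˣ :=
  Units.mk0 ((t.1.1.rootV N : ℂ) / t.2.2.1.rootV N)
    (div_ne_zero (HalfPlane.rootV_ne hN t.1.2) (HalfPlane.rootV_ne hN t.2.2.2))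

/-- The scalar `u_g v_h / v_l`. -/
noncomputable def ratioL (t : BorelIdx × BorelIdx × BorelIdx) : ℂˣ :=
  Units.mk0 ((t.1.1.rootU N : ℂ) * t.2.1.1.rootV N / t.2.2.1.rootV N)
    (div_ne_zero (mul_ne_zero (HalfPlane.rootU_ne N _) (HalfPlane.rootV_ne hN t.2.1.2))
      (HalfPlane.rootV_ne hN t.2.2.2))

/-- `√R`. -/
noncomputable def sqrtROp : (Module.End ℂ (psiData N hN hϖ).H)ˣ :=
  ((psiData N hN hϖ).scalarUnit (ratioR hN) * unitR hN hϖ) ^ ((N - 1) / 2)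

/-- `√L`. -/
noncomputable def sqrtLOp : (Module.End ℂ (psiData N hN hϖ).H)ˣ :=
  ((psiData N hN hϖ).scalarUnit (ratioL hN) * unitSh hN hϖ) ^ ((N - 1) / 2)

variable {hN hϖ}

theorem unitA_mul_self : unitA hN hϖ * unitA hN hϖ = 1 := Units.ext (opA_mul_opA hN hϖ)

theorem unitB_mul_self : unitB hN hϖ * unitB hN hϖ = 1 := Units.ext (opB_mul_opB hN hϖ)

theorem unitSh_unitA : unitSh hN hϖ * unitA hN hϖ * unitSh hN hϖ = unitA hN hϖ :=
  Units.ext (opSh_mul_opA_mul_opSh hN hϖ)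

theorem unitR_unitB : unitR hN hϖ * unitB hN hϖ * unitR hN hϖ = unitB hN hϖ :=
  Units.ext (opR_mul_opB_mul_opR hN hϖ)

theorem unitA_unitR : unitA hN hϖ * unitR hN hϖ = unitR hN hϖ * unitA hN hϖ * unitSh hN hϖ :=
  Units.ext (opA_mul_opR hN hϖ)

theorem unitB_unitSh : unitB hN hϖ * unitSh hN hϖ = unitSh hN hϖ * unitB hN hϖ * unitR hN hϖ :=
  Units.ext (opB_mul_opSh hN hϖ)

theorem commute_scalarUnit_unitR (c : BorelIdx × BorelIdx × BorelIdx → ℂˣ) :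
    Commute ((psiData N hN hϖ).scalarUnit c) (unitR hN hϖ) :=
  Units.ext ((scalarOp_mul_gradedOp _ _ _ _).trans (gradedOp_mul_scalarOp _ _ _ _).symm)

theorem commute_scalarUnit_unitSh (c : BorelIdx × BorelIdx × BorelIdx → ℂˣ) :
    Commute ((psiData N hN hϖ).scalarUnit c) (unitSh hN hϖ) :=
  Units.ext ((scalarOp_mul_gradedOp _ _ _ _).trans (gradedOp_mul_scalarOp _ _ _ _).symm)

theorem unitA_conj_scalarUnit (c : BorelIdx × BorelIdx × BorelIdx → ℂˣ) :
    unitA hN hϖ * (psiData N hN hϖ).scalarUnit c * unitA hN hϖ =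
      (psiData N hN hϖ).scalarUnit (c ∘ (psiData N hN hϖ).idxA) := by
  have h : unitA hN hϖ * (psiData N hN hϖ).scalarUnit c =
      (psiData N hN hϖ).scalarUnit (c ∘ (psiData N hN hϖ).idxA) * unitA hN hϖ :=
    Units.ext (opA_mul_scalarOp (psiData N hN hϖ) fun t => (c t : ℂ))
  rw [h, mul_assoc, unitA_mul_self, mul_one]

theorem unitB_conj_scalarUnit (c : BorelIdx × BorelIdx × BorelIdx → ℂˣ) :
    unitB hN hϖ * (psiData N hN hϖ).scalarUnit c * unitB hN hϖ =
      (psiData N hN hϖ).scalarUnit (c ∘ (psiData N hN hϖ).idxB) := by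
  have h : unitB hN hϖ * (psiData N hN hϖ).scalarUnit c =
      (psiData N hN hϖ).scalarUnit (c ∘ (psiData N hN hϖ).idxB) * unitB hN hϖ :=
    Units.ext (opB_mul_scalarOp (psiData N hN hϖ) fun t => (c t : ℂ))
  rw [h, mul_assoc, unitB_mul_self, mul_one]

theorem scalarUnit_congr {c c' : BorelIdx × BorelIdx × BorelIdx → ℂˣ}
    (H : ∀ g h l : BorelIdx, l.1 = g.1 * h.1 → (c (g, h, l) : ℂ) = c' (g, h, l)) :
    (psiData N hN hϖ).scalarUnit c = (psiData N hN hϖ).scalarUnit c' :=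
  Units.ext (scalarOp_congr H)

theorem conj_mul {G : Type*} [Group G] {b : G} (hb : b * b = 1) (x y : G) :
    b * (x * y) * b = (b * x * b) * (b * y * b) := by
  calc b * (x * y) * b = b * x * 1 * y * b := by group
    _ = _ := by rw [← hb]; group

theorem conj_pow' {G : Type*} [Group G] {b : G} (hb : b * b = 1) (x : G) (n : ℕ) :
    b * x ^ n * b = (b * x * b) ^ n := by
  induction n with
  | zero => simpa using hb
  | succ n ih => rw [pow_succ, conj_mul hb, ih, pow_succ]

/-- `B` exchanges the indices `g` and `l`, which inverts `v_g/v_l`, and it also inverts `r`. -/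
theorem unitB_conj_sqrtROp :
    unitB hN hϖ * sqrtROp hN hϖ * unitB hN hϖ = (sqrtROp hN hϖ)⁻¹ := by
  have h1 : (psiData N hN hϖ).scalarUnit (ratioR hN ∘ (psiData N hN hϖ).idxB) =
      ((psiData N hN hϖ).scalarUnit (ratioR hN))⁻¹ := by
    rw [← map_inv]
    congr 1
    funext t
    refine Units.ext ?_
    exact (inv_div _ _).symm
  rw [sqrtROp, conj_pow' unitB_mul_self, conj_mul unitB_mul_self, unitB_conj_scalarUnit, h1,
    HeisenbergRel.conj_b_r unitB_mul_self unitR_unitB, ← inv_pow, mul_inv_rev,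
    ((commute_scalarUnit_unitR _).inv_inv).eq]

/-- The scalar and the word are conjugated separately. The scalar becomes `v_{h*}/v_{l*}`, which is
`u_g v_h/v_l` since `v_{g*} = -v_g/u_g` and `u_l = u_g u_h`. -/
theorem unitBA_conj_sqrtROp :
    unitB hN hϖ * unitA hN hϖ * (sqrtROp hN hϖ)⁻¹ * unitA hN hϖ * unitB hN hϖ =
      sqrtLOp hN hϖ := by
  have h1 : unitB hN hϖ * (unitA hN hϖ * ((psiData N hN hϖ).scalarUnit (ratioR hN))⁻¹ *
      unitA hN hϖ) * unitB hN hϖ = (psiData N hN hϖ).scalarUnit (ratioL hN) := by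
    rw [← map_inv, unitA_conj_scalarUnit, unitB_conj_scalarUnit]
    refine scalarUnit_congr fun g h l hl => ?_
    change ((((l.1⁻¹).rootV N : ℂ) / (h.1⁻¹).rootV N))⁻¹ =
      (g.1.rootU N : ℂ) * h.1.rootV N / l.1.rootV N
    rw [HalfPlane.rootV_inv' l.2, HalfPlane.rootV_inv' h.2, hl, HalfPlane.rootU_mul hN, ← hl]
    have := HalfPlane.rootU_ne N g.1
    have := HalfPlane.rootU_ne N h.1
    have := HalfPlane.rootV_ne hN l.2
    have := HalfPlane.rootV_ne hN h.2
    push_cast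
    field_simp
  have h2 : unitB hN hϖ * (unitA hN hϖ * (unitR hN hϖ)⁻¹ * unitA hN hϖ) * unitB hN hϖ =
      unitSh hN hϖ := by
    have := HeisenbergRel.conj_ba_r (unitA_mul_self (hN := hN) (hϖ := hϖ)) unitB_mul_self
      unitSh_unitA unitR_unitB unitA_unitR unitB_unitSh
    rw [← this]; group
  have h3 : (sqrtROp hN hϖ)⁻¹ =
      (((psiData N hN hϖ).scalarUnit (ratioR hN))⁻¹ * (unitR hN hϖ)⁻¹) ^ ((N - 1) / 2) := by
    rw [sqrtROp, ← inv_pow, mul_inv_rev, ((commute_scalarUnit_unitR _).inv_inv).eq]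
  have h4 : unitB hN hϖ * unitA hN hϖ * (sqrtROp hN hϖ)⁻¹ * unitA hN hϖ * unitB hN hϖ =
      unitB hN hϖ * (unitA hN hϖ * (sqrtROp hN hϖ)⁻¹ * unitA hN hϖ) * unitB hN hϖ := by
    simp only [mul_assoc]
  rw [h4, h3, conj_pow' unitA_mul_self, conj_mul unitA_mul_self, conj_pow' unitB_mul_self,
    conj_mul unitB_mul_self, h1, h2, sqrtLOp]

theorem sqrtL_eq : (psiData N hN hϖ).sqrtL (sqrtROp hN hϖ) = sqrtLOp hN hϖ := by
  rw [← unitBA_conj_sqrtROp]; rfl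

theorem sqrtLInv_eq :
    (psiData N hN hϖ).sqrtLInv (sqrtROp hN hϖ) = ((sqrtLOp hN hϖ)⁻¹ : (Module.End ℂ _)ˣ) := by
  have ha : (unitA hN hϖ)⁻¹ = unitA hN hϖ := inv_eq_of_mul_eq_one_left unitA_mul_self
  have hb : (unitB hN hϖ)⁻¹ = unitB hN hϖ := inv_eq_of_mul_eq_one_left unitB_mul_self
  have h : (sqrtLOp hN hϖ)⁻¹ =
      unitB hN hϖ * unitA hN hϖ * sqrtROp hN hϖ * unitA hN hϖ * unitB hN hϖ := by
    rw [← unitBA_conj_sqrtROp]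
    simp only [mul_inv_rev, ha, hb, inv_inv, mul_assoc]
  rw [h]; rfl

theorem diagOp_mul (c c' d d' : ℂ) :
    (psiData N hN hϖ).diagOp ℂ c c' * (psiData N hN hϖ).diagOp ℂ d d' =
      (psiData N hN hϖ).diagOp ℂ (c * d) (c' * d') := by
  refine LinearMap.ext fun z => Prod.ext ?_ ?_
  · exact smul_smul c d z.1
  · exact smul_smul c' d' z.2

theorem diagOp_one : (psiData N hN hϖ).diagOp ℂ 1 1 = 1 :=
  LinearMap.ext fun z => Prod.ext (one_smul ℂ z.1) (one_smul ℂ z.2)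

theorem diagOp_pow (c c' : ℂ) (n : ℕ) :
    (psiData N hN hϖ).diagOp ℂ c c' ^ n = (psiData N hN hϖ).diagOp ℂ (c ^ n) (c' ^ n) := by
  induction n with
  | zero => rw [pow_zero, pow_zero, pow_zero, diagOp_one]
  | succ n ih => rw [pow_succ, ih, diagOp_mul, pow_succ, pow_succ]

theorem diagOp_mul_gradedOp (c c' : ℂ) (f : ∀ t, Module.End ℂ ((psiData N hN hϖ).HLow t))
    (g : ∀ t, Module.End ℂ ((psiData N hN hϖ).HUp t)) :
    (psiData N hN hϖ).diagOp ℂ c c' * (psiData N hN hϖ).gradedOp f g =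
      (psiData N hN hϖ).gradedOp f g * (psiData N hN hϖ).diagOp ℂ c c' := by
  refine LinearMap.ext fun z => Prod.ext ?_ ?_
  · exact (map_smul (DirectSum.lmap f) c z.1).symm
  · exact (map_smul (DirectSum.lmap g) c' z.2).symm

/-- `ϖ⁻¹ Id_Ĥ ⊕ ϖ Id_Ȟ` as an invertible operator. -/
noncomputable def unitZ (hN : Odd N) (hϖ : IsPrimitiveRoot ϖ N) :
    (Module.End ℂ (psiData N hN hϖ).H)ˣ where
  val := (psiData N hN hϖ).diagOp ℂ ϖ⁻¹ ϖ
  inv := (psiData N hN hϖ).diagOp ℂ ϖ ϖ⁻¹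
  val_inv := by
    have := root_ne_zero hϖ
    rw [diagOp_mul, inv_mul_cancel₀ this, mul_inv_cancel₀ this, diagOp_one]
  inv_val := by
    have := root_ne_zero hϖ
    rw [diagOp_mul, inv_mul_cancel₀ this, mul_inv_cancel₀ this, diagOp_one]

theorem unitB_conj_sqrtLOp :
    unitB hN hϖ * sqrtLOp hN hϖ * unitB hN hϖ =
      ((psiData N hN hϖ).scalarUnit (ratioL hN ∘ (psiData N hN hϖ).idxB) *
        (unitSh hN hϖ * (unitR hN hϖ)⁻¹)) ^ ((N - 1) / 2) := by
  rw [sqrtLOp, conj_pow' unitB_mul_self, conj_mul unitB_mul_self, unitB_conj_scalarUnit,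
    HeisenbergRel.conj_b_s unitB_mul_self unitR_unitB unitB_unitSh]

/-- After cancellation `u_l v_{h*}/(u_g v_h)` remains; the sign comes from `v_{h*} = -v_h/u_h`. -/
theorem scalarUnit_q : (psiData N hN hϖ).scalarUnit (ratioR hN) *
    (psiData N hN hϖ).scalarUnit (ratioL hN ∘ (psiData N hN hϖ).idxB) *
      ((psiData N hN hϖ).scalarUnit (ratioL hN))⁻¹ =
    (psiData N hN hϖ).scalarUnit fun _ => -1 := by
  rw [← map_inv, ← map_mul, ← map_mul]
  refine scalarUnit_congr fun g h l hl => ?_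
  change (g.1.rootV N : ℂ) / l.1.rootV N *
      ((l.1.rootU N : ℂ) * (h.1⁻¹).rootV N / g.1.rootV N) *
      ((g.1.rootU N : ℂ) * h.1.rootV N / l.1.rootV N)⁻¹ = -1
  rw [HalfPlane.rootV_inv' h.2, hl, HalfPlane.rootU_mul hN, ← hl]
  have := HalfPlane.rootU_ne N g.1
  have := HalfPlane.rootU_ne N h.1
  have := HalfPlane.rootV_ne hN l.2
  have := HalfPlane.rootV_ne hN h.2
  have := HalfPlane.rootV_ne hN g.2
  push_cast
  field_simp

/-- Scalars commute with `r`, `s` and each other, so the expression splits into the `M`-th power of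
`scalarUnit_q` and the word `r^M (s r⁻¹)^M s^{-M}`. -/
theorem units_q : sqrtROp hN hϖ * (unitB hN hϖ * sqrtLOp hN hϖ * unitB hN hϖ) *
    (sqrtLOp hN hϖ)⁻¹ = ((psiData N hN hϖ).scalarUnit fun _ => -1) ^ ((N - 1) / 2) *
      unitZ hN hϖ ^ ((N ^ 2 - 1) / 8) := by
  rw [unitB_conj_sqrtLOp, sqrtROp, sqrtLOp]
  set M := (N - 1) / 2 with hM
  set W := (psiData N hN hϖ).scalarUnit (ratioR hN)
  set W' := (psiData N hN hϖ).scalarUnit (ratioL hN ∘ (psiData N hN hϖ).idxB)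
  set W'' := (psiData N hN hϖ).scalarUnit (ratioL hN)
  have c1 : Commute W (unitR hN hϖ) := commute_scalarUnit_unitR _
  have c2 : Commute W' (unitSh hN hϖ * (unitR hN hϖ)⁻¹) :=
    (commute_scalarUnit_unitSh _).mul_right (commute_scalarUnit_unitR _).inv_right
  have c3 : Commute W'' (unitSh hN hϖ) := commute_scalarUnit_unitSh _
  have c4 : Commute (unitR hN hϖ) W' := (commute_scalarUnit_unitR _).symm
  have c5 : Commute (unitSh hN hϖ) W'' := c3.symm
  have c6 : Commute (unitR hN hϖ * (unitSh hN hϖ * (unitR hN hϖ)⁻¹)) W'' := by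
    have := (commute_scalarUnit_unitR (hN := hN) (hϖ := hϖ) (ratioL hN)).symm
    exact this.mul_left (c5.mul_left this.inv_left)
  have c7 : Commute W W' := by
    rw [Commute, SemiconjBy, ← map_mul, ← map_mul, mul_comm]
  have c8 : Commute (W * W') W''⁻¹ := by
    rw [← map_mul, ← map_inv, Commute, SemiconjBy, ← map_mul, ← map_mul, mul_comm]
  have c9 : Commute (unitR hN hϖ) W'' := (commute_scalarUnit_unitR _).symm
  have hz : unitR hN hϖ * unitSh hN hϖ = unitZ hN hϖ * (unitSh hN hϖ * unitR hN hϖ) :=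
    Units.ext (opR_mul_opSh hN hϖ)
  have hzr : Commute (unitZ hN hϖ) (unitR hN hϖ) := Units.ext (diagOp_mul_gradedOp _ _ _ _)
  have hzs : Commute (unitZ hN hϖ) (unitSh hN hϖ) := Units.ext (diagOp_mul_gradedOp _ _ _ _)
  -- For `N = 2M + 1`, `N² - 1 = 4M(M + 1)`; both divisions are exact.
  have hexp : (N ^ 2 - 1) / 8 = M * (M + 1) / 2 := by
    obtain ⟨m, hm⟩ := hN
    have hMm : M = m := by rw [hM, hm]; simp
    have h8 : N ^ 2 - 1 = 4 * (m * (m + 1)) := by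
      rw [hm]
      have : (2 * m + 1) ^ 2 = 4 * (m * (m + 1)) + 1 := by ring
      rw [this]; simp
    rw [h8, hMm]; omega
  rw [hexp, ← HeisenbergRel.pow_mul_pow hz hzr hzs, ← scalarUnit_q, c1.mul_pow, c2.mul_pow,
    c3.mul_pow, c8.mul_pow, c7.mul_pow, mul_inv_rev, inv_pow]
  set r := unitR hN hϖ
  set s := unitSh hN hϖ
  have d1 : r ^ M * W' ^ M = W' ^ M * r ^ M := (c4.pow_pow M M).eq
  have d2 : Commute (W'' ^ M)⁻¹ (r ^ M * (s * r⁻¹) ^ M * (s ^ M)⁻¹) := by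
    refine Commute.inv_left (Commute.mul_right (Commute.mul_right ?_ ?_) ?_)
    · exact (c9.pow_pow M M).symm
    · exact ((c5.mul_left c9.inv_left).pow_pow M M).symm
    · exact ((c5.pow_pow M M).symm).inv_right
  calc W ^ M * r ^ M * (W' ^ M * (s * r⁻¹) ^ M) * ((s ^ M)⁻¹ * (W'' ^ M)⁻¹)
      = W ^ M * (r ^ M * W' ^ M) * (s * r⁻¹) ^ M * ((s ^ M)⁻¹ * (W'' ^ M)⁻¹) := by
        simp only [mul_assoc]
    _ = W ^ M * W' ^ M * (r ^ M * (s * r⁻¹) ^ M * (s ^ M)⁻¹ * (W'' ^ M)⁻¹) := by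
        rw [d1]; simp only [mul_assoc]
    _ = _ := by rw [← d2.eq]; simp only [mul_assoc]

theorem opQ_eq : (psiData N hN hϖ).opQ 1 (sqrtROp hN hϖ) =
    (-1 : ℂ) ^ ((N - 1) / 2) • (psiData N hN hϖ).diagOp ℂ
      ((ϖ ^ ((N ^ 2 - 1) / 8))⁻¹) (ϖ ^ ((N ^ 2 - 1) / 8)) := by
  have h := congrArg Units.val (units_q (hN := hN) (hϖ := hϖ))
  have hm : ((psiData N hN hϖ).scalarUnit fun _ => -1 : (Module.End ℂ _)ˣ).val =
      (-1 : ℂ) • (1 : Module.End ℂ (psiData N hN hϖ).H) :=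
    LinearMap.ext fun z => Prod.ext (DFinsupp.ext fun _ => rfl) (DFinsupp.ext fun _ => rfl)
  rw [Units.val_mul, Units.val_mul, Units.val_mul, Units.val_mul, Units.val_mul, Units.val_pow_eq_pow_val,
    Units.val_pow_eq_pow_val, hm] at h
  have hz : (unitZ hN hϖ : Module.End ℂ (psiData N hN hϖ).H) =
    (psiData N hN hϖ).diagOp ℂ ϖ⁻¹ ϖ := rfl
  rw [hz, diagOp_pow, smul_pow, one_pow, smul_mul_assoc, one_mul, inv_pow] at h
  rw [← h, opQ, sqrtL_eq, sqrtLInv_eq, inv_one, Units.val_one, mul_one, coe_unitB]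
  simp only [mul_assoc]

end Borel

namespace Borel

open BialgMod PsiData

variable {N : ℕ} [NeZero N] {ϖ : ℂ} {hN : Odd N} {hϖ : IsPrimitiveRoot ϖ N}

/-! ### The pairing and the transpose of `B` -/

theorem coe_scalarUnit_mul_unitR_pow (c : BorelIdx × BorelIdx × BorelIdx → ℂˣ) (n : ℕ) :
    (((psiData N hN hϖ).scalarUnit c * unitR hN hϖ) ^ n : (Module.End ℂ _)ˣ).val =
      (psiData N hN hϖ).gradedOp (fun t => (c t : ℂ) ^ n • rLow ^ n)
        (fun t => (c t : ℂ) ^ n • rUp ^ n) := by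
  rw [Units.val_pow_eq_pow_val, Units.val_mul, coe_scalarUnit, coe_unitR, opR,
    scalarOp_mul_gradedOp, gradedOp_pow]
  exact congrArg₂ (psiData N hN hϖ).gradedOp (funext fun _ => smul_pow _ _ _)
    (funext fun _ => smul_pow _ _ _)

theorem coe_scalarUnit_mul_unitSh_pow (c : BorelIdx × BorelIdx × BorelIdx → ℂˣ) (n : ℕ) :
    (((psiData N hN hϖ).scalarUnit c * unitSh hN hϖ) ^ n : (Module.End ℂ _)ˣ).val =
      (psiData N hN hϖ).gradedOp (fun t => (c t : ℂ) ^ n • sLow ^ n)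
        (fun t => (c t : ℂ) ^ n • sUp ^ n) := by
  rw [Units.val_pow_eq_pow_val, Units.val_mul, coe_scalarUnit, coe_unitSh, opSh,
    scalarOp_mul_gradedOp, gradedOp_pow]
  exact congrArg₂ (psiData N hN hϖ).gradedOp (funext fun _ => smul_pow _ _ _)
    (funext fun _ => smul_pow _ _ _)

/-! ### Self-adjointness of `r` -/

section Bracket

variable {g h l : HalfPlane}

/-- Reading one scalar at `k = 0` and the other at `k = 1` absorbs the shift in `r`, while the
factor `χ(j)` is common. -/
theorem bracket_rLow (hN : Odd N) (hl : l.x ≠ 0)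
    (x : cyclicMod N hϖ g ⊗ cyclicMod N hϖ h ⟶ cyclicMod N hϖ l)
    (y : cyclicMod N hϖ l ⟶ cyclicMod N hϖ g ⊗ cyclicMod N hϖ h) :
    bracket ℂ (y ≫ rLow x) = bracket ℂ (rUp y ≫ x) := by
  rw [bracket_comp hN hl _ _ 0, bracket_comp hN hl _ _ (0 + 1)]
  refine (Fintype.sum_equiv (Equiv.addRight (1 : ZMod N)) _ _ fun i => ?_)
  refine Finset.sum_congr rfl fun j _ => ?_
  rw [lowCoord_rLow, upCoord_rUp, Equiv.coe_addRight, add_sub_cancel_right, add_sub_cancel_right]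
  ring

theorem bracket_rLow_pow (hN : Odd N) (hl : l.x ≠ 0) (n : ℕ)
    (x : cyclicMod N hϖ g ⊗ cyclicMod N hϖ h ⟶ cyclicMod N hϖ l)
    (y : cyclicMod N hϖ l ⟶ cyclicMod N hϖ g ⊗ cyclicMod N hϖ h) :
    bracket ℂ (y ≫ (rLow ^ n) x) = bracket ℂ ((rUp ^ n) y ≫ x) := by
  induction n generalizing x y with
  | zero => rfl
  | succ n ih =>
    rw [pow_succ', pow_succ, Module.End.mul_apply, Module.End.mul_apply, bracket_rLow hN hl, ih]

theorem bracket_zero (hN : Odd N) (hl : l.x ≠ 0) :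
    bracket ℂ (0 : cyclicMod N hϖ l ⟶ cyclicMod N hϖ l) = 0 :=
  map_zero (bracketLin hN hϖ hl)

end Bracket

/-! ### Computation of `B*B` -/

section Transpose

variable {g h l : BorelIdx}

/-- Two applications of `B` contribute `φ(-j)/φ(j) = χ(j)`, which reads `χ(-j)` after `j` is
replaced by `-j`. Compared with the ordinary pairing, the outer indices are exchanged and this
weight is new. -/
theorem bracket_bLow_comp_bUp_eq_sum
    (x : (psiData N hN hϖ).V g ⊗ (psiData N hN hϖ).V h ⟶ (psiData N hN hϖ).V l)
    (y : (psiData N hN hϖ).V l ⟶ (psiData N hN hϖ).V g ⊗ (psiData N hN hϖ).V h) (k : ZMod N) :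
    bracket ℂ ((psiData N hN hϖ).bLow ℂ g h l x ≫ (psiData N hN hϖ).bUp ℂ g h l y) =
      ∑ i, ∑ j, chi ϖ (-j) * (upCoord y k j i * lowCoord x k j i) := by
  refine (bracket_comp hN g.2 _ _ k).trans (Finset.sum_congr rfl fun i _ => ?_)
  refine Fintype.sum_equiv (Equiv.neg (ZMod N)) _ _ fun j => ?_
  rw [lowCoord_bUp, upCoord_bLow, Equiv.neg_apply, neg_neg]
  have hp : phi ϖ (-j) = chi ϖ j * phi ϖ j := by
    rw [phi_eq hN hϖ, phi_eq hN hϖ, ← chi_add hϖ]; congr 1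
    linear_combination j * two_mul_half hN
  rw [hp]
  have := phi_ne_zero hϖ j
  field_simp

/-- The same argument as for biorthogonality, with the weighted sum of `χ(-m) ψ_m θ_{-m}` on the
diagonal; the remaining `χ(-a)` comes from the substitution `j = m + a`. -/
theorem bracket_bLow_eLow_comp_bUp_eUp (hl : l.1 = g.1 * h.1) (a c : ZMod N) :
    bracket ℂ ((psiData N hN hϖ).bLow ℂ g h l (eLow hN hϖ h.2 hl c) ≫
      (psiData N hN hϖ).bUp ℂ g h l (eUp hN hϖ h.2 hl a)) =
      ((g.1.rootV N : ℂ) / l.1.rootV N) ^ (N - 1) * (chi ϖ (-a) * if a = c then 1 else 0) := by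
  have H := bracket_bLow_comp_bUp_eq_sum (hN := hN) (hϖ := hϖ) (g := g) (h := h) (l := l)
    (eLow hN hϖ h.2 hl c) (eUp hN hϖ h.2 hl a)
  have H' : ∀ k, bracket ℂ ((psiData N hN hϖ).bLow ℂ g h l (eLow hN hϖ h.2 hl c) ≫
      (psiData N hN hϖ).bUp ℂ g h l (eUp hN hϖ h.2 hl a)) =
      ∑ i, ∑ j, chi ϖ (-j) * (eUpCoeff ϖ g.1 h.1 a k j i * eLowCoeff ϖ g.1 h.1 c k j i) := by
    intro k
    rw [H k]
    refine Finset.sum_congr rfl fun i _ => Finset.sum_congr rfl fun j _ => ?_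
    rw [upCoord_eUp, lowCoord_eLow]
  split_ifs with hac
  · subst hac
    have hlx : (g.1 * h.1).x ≠ 0 := hl ▸ l.2
    rw [H' 0, Finset.sum_comm, hl, ← sum_chi_neg_mul_psiCoeff_mul_thetaCoeff hN hϖ h.2 hlx,
      mul_one, Finset.sum_mul]
    refine Fintype.sum_equiv (Equiv.subRight a) _ _ fun j => ?_
    rw [Finset.sum_eq_single j]
    · have := eUpCoeff_mul_eLowCoeff_self (g := g.1) (h := h.1) hN hϖ a j j
      rw [sub_self] at this
      rw [this, Equiv.subRight_apply]
      have e : chi ϖ (-j) = chi ϖ (-(j - a)) * chi ϖ (-a) := by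
        rw [← chi_add hϖ]; congr 1; ring
      rw [e]; ring
    · intro i _ hi
      rw [eUpCoeff, if_neg, zero_mul, mul_zero]
      intro H; exact hi (by linear_combination H)
    · simp
  · rw [mul_zero, mul_zero]
    have h2 : chi ϖ (c - a) ≠ 1 := fun h2 => hac
      (sub_eq_zero.mp (chi_injective hϖ (h2.trans chi_zero.symm))).symm
    have h1 := H' (0 + 1)
    rw [← Equiv.sum_comp (Equiv.addRight (1 : ZMod N))] at h1
    simp only [Equiv.coe_addRight, eUpCoeff_mul_eLowCoeff_shift hϖ] at h1
    simp only [mul_left_comm _ (chi ϖ (c - a)), ← Finset.mul_sum, ← H' 0] at h1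
    have h3 := sub_eq_zero.mpr h1
    rw [← one_sub_mul] at h3
    exact (mul_eq_zero.mp h3).resolve_left (sub_ne_zero.mpr h2.symm)

theorem rUp_pow_eUp (hl : l.1 = g.1 * h.1) (a : ZMod N) (n : ℕ) :
    (rUp ^ n) (eUp hN hϖ h.2 hl a) = chi ϖ a ^ n • eUp hN hϖ h.2 hl a := by
  induction n with
  | zero => rw [pow_zero, pow_zero, one_smul]; rfl
  | succ n ih => rw [pow_succ', Module.End.mul_apply, ih, map_smul, rUp_eUp, smul_smul, pow_succ]

/-- Both sides are bilinear and vanish for `l ≠ gh`; for `l = gh` they are compared on the two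
bases, where `r` is diagonal. -/
theorem bracket_bLow_comp_bUp
    (x : (psiData N hN hϖ).V g ⊗ (psiData N hN hϖ).V h ⟶ (psiData N hN hϖ).V l)
    (y : (psiData N hN hϖ).V l ⟶ (psiData N hN hϖ).V g ⊗ (psiData N hN hϖ).V h) :
    bracket ℂ ((psiData N hN hϖ).bLow ℂ g h l x ≫ (psiData N hN hϖ).bUp ℂ g h l y) =
      bracket ℂ ((((ratioR hN (g, h, l) : ℂ) ^ (N - 1)) • (rUp ^ (N - 1)) y :
        cyclicMod N hϖ l.1 ⟶ cyclicMod N hϖ g.1 ⊗ cyclicMod N hϖ h.1) ≫ x) := by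
  by_cases hl : l.1 = g.1 * h.1
  swap
  · rw [low_eq_zero hN hl x, map_zero, Limits.zero_comp, Limits.comp_zero]
    exact (bracket_zero hN g.2).trans (bracket_zero hN l.2).symm
  let L₁ := LinearMap.mk₂ ℂ
    (fun (x : (psiData N hN hϖ).V g ⊗ (psiData N hN hϖ).V h ⟶ (psiData N hN hϖ).V l)
      (y : (psiData N hN hϖ).V l ⟶ (psiData N hN hϖ).V g ⊗ (psiData N hN hϖ).V h) =>
      bracket ℂ ((psiData N hN hϖ).bLow ℂ g h l x ≫ (psiData N hN hϖ).bUp ℂ g h l y))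
    (fun x x' y => by rw [map_add, Preadditive.add_comp]; exact bracket_add hϖ hN g.2 _ _)
    (fun c x y => by rw [map_smul, Linear.smul_comp]; exact bracket_smul hϖ hN g.2 _ _)
    (fun x y y' => by rw [map_add, Preadditive.comp_add]; exact bracket_add hϖ hN g.2 _ _)
    (fun c x y => by rw [map_smul, Linear.comp_smul]; exact bracket_smul hϖ hN g.2 _ _)
  let L₂ := LinearMap.mk₂ ℂ
    (fun (x : (psiData N hN hϖ).V g ⊗ (psiData N hN hϖ).V h ⟶ (psiData N hN hϖ).V l)
      (y : (psiData N hN hϖ).V l ⟶ (psiData N hN hϖ).V g ⊗ (psiData N hN hϖ).V h) =>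
      bracket ℂ ((((ratioR hN (g, h, l) : ℂ) ^ (N - 1)) • (rUp ^ (N - 1)) y :
        cyclicMod N hϖ l.1 ⟶ cyclicMod N hϖ g.1 ⊗ cyclicMod N hϖ h.1) ≫ x))
    (fun x x' y => by erw [Preadditive.comp_add]; exact bracket_add hϖ hN l.2 _ _)
    (fun c x y => by erw [Linear.comp_smul]; exact bracket_smul hϖ hN l.2 _ _)
    (fun x y y' => by
      erw [map_add, smul_add, Preadditive.add_comp]; exact bracket_add hϖ hN l.2 _ _)
    (fun c x y => by
      erw [map_smul, smul_comm, Linear.smul_comp]; exact bracket_smul hϖ hN l.2 _ _)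
  suffices L₁ = L₂ from LinearMap.congr_fun₂ this x y
  refine LinearMap.ext_basis (basisLow hN hϖ h.2 hl l.2) (basisUp hN hϖ h.2 hl l.2) fun c a => ?_
  rw [basisLow_apply, basisUp_apply]
  refine (bracket_bLow_eLow_comp_bUp_eUp hl a c).trans ?_
  change _ = bracket ℂ ((((ratioR hN (g, h, l) : ℂ) ^ (N - 1)) •
    (rUp ^ (N - 1)) (eUp hN hϖ h.2 hl a)) ≫ eLow hN hϖ h.2 hl c)
  rw [rUp_pow_eUp hl, Linear.smul_comp, Linear.smul_comp, bracket_smul hϖ hN l.2, bracket_smul hϖ hN l.2,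
    bracket_eUp_eLow hN hϖ h.2 hl l.2]
  -- The eigenvalue `χ(a)⁻¹` is rewritten as an `(N - 1)`-st power, which has the square root
  -- `χ(a)^{(N-1)/2}`.
  have hc : chi ϖ (-a) = chi ϖ a ^ (N - 1) := by
    have h1 : chi ϖ a ^ (N - 1) * chi ϖ a = 1 := by
      rw [← pow_succ, Nat.sub_add_cancel (NeZero.one_le), chi_pow_card hϖ]
    rw [chi_neg hϖ, eq_inv_of_mul_eq_one_left h1]
  rw [hc]; rfl

end Transpose

end Borel

namespace Borel

open BialgMod PsiData

variable {N : ℕ} [NeZero N] {ϖ : ℂ} {hN : Odd N} {hϖ : IsPrimitiveRoot ϖ N}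

/-! ### The pairing as a bilinear form and the transpose of `B` -/

section Pairing

theorem bracket_zero_comp {g h l : BorelIdx}
    (x : (psiData N hN hϖ).V g ⊗ (psiData N hN hϖ).V h ⟶ (psiData N hN hϖ).V l) :
    bracket ℂ ((0 : (psiData N hN hϖ).V l ⟶ (psiData N hN hϖ).V g ⊗ (psiData N hN hϖ).V h) ≫ x) =
      0 := by
  rw [Limits.zero_comp]; exact bracket_zero hN l.2

theorem bracket_comp_zero {g h l : BorelIdx}
    (y : (psiData N hN hϖ).V l ⟶ (psiData N hN hϖ).V g ⊗ (psiData N hN hϖ).V h) :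
    bracket ℂ (y ≫ (0 : (psiData N hN hϖ).V g ⊗ (psiData N hN hϖ).V h ⟶ (psiData N hN hϖ).V l)) =
      0 := by
  rw [Limits.comp_zero]; exact bracket_zero hN l.2

theorem pairing_comm (x y : (psiData N hN hϖ).H) :
    (psiData N hN hϖ).pairing ℂ x y = (psiData N hN hϖ).pairing ℂ y x :=
  finsum_congr fun _ => add_comm _ _

/-- Required for additivity, since `∑ᶠ` takes the value `0` on infinite supports. -/
theorem finite_support_pairing (x y : (psiData N hN hϖ).H) :
    (Function.support fun t => bracket ℂ (y.2 t ≫ x.1 t) + bracket ℂ (x.2 t ≫ y.1 t)).Finite := by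
  classical
  refine ((DFinsupp.finite_support x.1).union (DFinsupp.finite_support x.2)).subset fun t ht => ?_
  by_contra hc
  simp only [Set.mem_union, Set.mem_ofPred_eq, not_or, not_not] at hc
  refine ht ?_
  change bracket ℂ (y.2 t ≫ x.1 t) + bracket ℂ (x.2 t ≫ y.1 t) = 0
  rw [hc.1, hc.2]
  erw [bracket_comp_zero, bracket_zero_comp, add_zero]

theorem pairing_add_left (x x' y : (psiData N hN hϖ).H) :
    (psiData N hN hϖ).pairing ℂ (x + x') y =
      (psiData N hN hϖ).pairing ℂ x y + (psiData N hN hϖ).pairing ℂ x' y := by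
  rw [pairing, pairing, pairing,
    ← finsum_add_distrib (finite_support_pairing x y) (finite_support_pairing x' y)]
  refine finsum_congr fun t => ?_
  have h1 : bracket ℂ (y.2 t ≫ (x + x').1 t) =
      bracket ℂ (y.2 t ≫ x.1 t) + bracket ℂ (y.2 t ≫ x'.1 t) :=
    (congrArg (bracket ℂ) (Preadditive.comp_add _ _ _ _ _ _)).trans
      (bracket_add hϖ hN t.2.2.2 _ _)
  have h2 : bracket ℂ ((x + x').2 t ≫ y.1 t) =
      bracket ℂ (x.2 t ≫ y.1 t) + bracket ℂ (x'.2 t ≫ y.1 t) :=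
    (congrArg (bracket ℂ) (Preadditive.add_comp _ _ _ _ _ _)).trans
      (bracket_add hϖ hN t.2.2.2 _ _)
  rw [h1, h2]; ring

theorem pairing_smul_left (c : ℂ) (x y : (psiData N hN hϖ).H) :
    (psiData N hN hϖ).pairing ℂ (c • x) y = c * (psiData N hN hϖ).pairing ℂ x y := by
  rw [pairing, pairing, ← smul_eq_mul, smul_finsum]
  refine finsum_congr fun t => ?_
  have h1 : bracket ℂ (y.2 t ≫ (c • x).1 t) = c * bracket ℂ (y.2 t ≫ x.1 t) :=
    (congrArg (bracket ℂ) (Linear.comp_smul _ _ _ _ _ _)).trans (bracket_smul hϖ hN t.2.2.2 _ _)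
  have h2 : bracket ℂ ((c • x).2 t ≫ y.1 t) = c * bracket ℂ (x.2 t ≫ y.1 t) :=
    (congrArg (bracket ℂ) (Linear.smul_comp _ _ _ _ _ _)).trans (bracket_smul hϖ hN t.2.2.2 _ _)
  rw [h1, h2, smul_eq_mul]; ring

variable (hN hϖ) in
/-- The pairing on `H` as a bilinear form. -/
noncomputable def pairingLin : (psiData N hN hϖ).H →ₗ[ℂ] (psiData N hN hϖ).H →ₗ[ℂ] ℂ :=
  LinearMap.mk₂ ℂ (fun x y => (psiData N hN hϖ).pairing ℂ x y) pairing_add_left pairing_smul_left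
    (fun x y y' => by
      rw [pairing_comm, pairing_add_left, pairing_comm y, pairing_comm y'])
    (fun c x y => by rw [pairing_comm, pairing_smul_left, pairing_comm y]; rfl)

theorem pairing_inLow (g h l : BorelIdx)
    (x : (psiData N hN hϖ).V g ⊗ (psiData N hN hϖ).V h ⟶ (psiData N hN hϖ).V l)
    (y : (psiData N hN hϖ).H) :
    (psiData N hN hϖ).pairing ℂ ((psiData N hN hϖ).inLow ℂ g h l x) y =
      bracket ℂ ((y.2 (g, h, l) : (psiData N hN hϖ).V l ⟶
        (psiData N hN hϖ).V g ⊗ (psiData N hN hϖ).V h) ≫ x) := by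
  rw [pairing, finsum_eq_single _ (g, h, l)]
  · rw [inLow_fst, inLow_snd]
    exact (congrArg _ (bracket_zero_comp _)).trans (add_zero _)
  · intro t ht
    rw [inLow_fst_of_ne _ _ _ _ _ ht, inLow_snd]
    exact (congrArg₂ _ (bracket_comp_zero _) (bracket_zero_comp _)).trans (add_zero _)

theorem pairing_inUp (g h l : BorelIdx)
    (y : (psiData N hN hϖ).V l ⟶ (psiData N hN hϖ).V g ⊗ (psiData N hN hϖ).V h)
    (x : (psiData N hN hϖ).H) :
    (psiData N hN hϖ).pairing ℂ ((psiData N hN hϖ).inUp ℂ g h l y) x =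
      bracket ℂ (y ≫ (x.1 (g, h, l) : (psiData N hN hϖ).V g ⊗ (psiData N hN hϖ).V h ⟶
        (psiData N hN hϖ).V l)) := by
  rw [pairing, finsum_eq_single _ (g, h, l)]
  · rw [inUp_fst, inUp_snd]
    exact (congrArg (· + _) (bracket_comp_zero _)).trans (zero_add _)
  · intro t ht
    rw [inUp_snd_of_ne _ _ _ _ _ ht, inUp_fst]
    exact (congrArg₂ _ (bracket_comp_zero _) (bracket_zero_comp _)).trans (add_zero _)

theorem sqrtROp_mul_self : ((sqrtROp hN hϖ : Module.End ℂ (psiData N hN hϖ).H) *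
    (sqrtROp hN hϖ : Module.End ℂ (psiData N hN hϖ).H)) =
    (psiData N hN hϖ).gradedOp (fun t => (ratioR hN t : ℂ) ^ (N - 1) • rLow ^ (N - 1))
      (fun t => (ratioR hN t : ℂ) ^ (N - 1) • rUp ^ (N - 1)) := by
  have e : (N - 1) / 2 + (N - 1) / 2 = N - 1 := by
    obtain ⟨m, rfl⟩ := hN; omega
  rw [← Units.val_mul, sqrtROp, ← pow_add, e, coe_scalarUnit_mul_unitR_pow]

theorem isTranspose_sqrtROp :
    (psiData N hN hϖ).IsTranspose ℂ (sqrtROp hN hϖ).val (sqrtROp hN hϖ).val := by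
  intro x y
  rw [sqrtROp, coe_scalarUnit_mul_unitR_pow]
  refine finsum_congr fun t => ?_
  rw [gradedOp_fst, gradedOp_snd, gradedOp_fst, gradedOp_snd]
  have H : ∀ (a : (psiData N hN hϖ).HLow t) (b : (psiData N hN hϖ).HUp t) (c : ℂ) (n : ℕ),
      bracket ℂ (b ≫ ((c • rLow ^ n : Module.End ℂ ((psiData N hN hϖ).HLow t)) a)) =
      bracket ℂ (((c • rUp ^ n : Module.End ℂ ((psiData N hN hϖ).HUp t)) b) ≫ a) := by
    intro a b c n
    rw [LinearMap.smul_apply, LinearMap.smul_apply, Linear.comp_smul, Linear.smul_comp]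
    refine (bracket_smul hϖ hN t.2.2.2 _ _).trans
      (Eq.trans ?_ (bracket_smul hϖ hN t.2.2.2 _ _).symm)
    exact congrArg _ (bracket_rLow_pow hN t.2.2.2 n a b)
  exact congrArg₂ _ (H _ _ _ _) (H _ _ _ _).symm

/-- This is `B*B = (√R)²` in a form that does not presuppose a transpose. By bilinearity it is
checked on homogeneous elements, where only opposite types with the same index contribute. -/
theorem pairing_opB_opB (x y : (psiData N hN hϖ).H) :
    (psiData N hN hϖ).pairing ℂ ((psiData N hN hϖ).opB ℂ x) ((psiData N hN hϖ).opB ℂ y) =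
      (psiData N hN hϖ).pairing ℂ x
        (((sqrtROp hN hϖ).val * (sqrtROp hN hϖ).val : Module.End ℂ _) y) := by
  suffices (pairingLin hN hϖ).compl₁₂ ((psiData N hN hϖ).opB ℂ) ((psiData N hN hϖ).opB ℂ) =
      (pairingLin hN hϖ).compl₂ ((sqrtROp hN hϖ).val * (sqrtROp hN hϖ).val : Module.End ℂ _) from
    LinearMap.congr_fun₂ this x y
  -- `B` acts injectively on index triples, so distinct summands stay orthogonal after applying it.
  have hB : ∀ {g h l g' h' l' : BorelIdx}, (g, h, l) ≠ (g', h', l') →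
      (l, (psiData N hN hϖ).star h, g) ≠ (l', (psiData N hN hϖ).star h', g') := by
    intro g h l g' h' l' hne H
    have H' : (psiData N hN hϖ).idxB (g, h, l) = (psiData N hN hϖ).idxB (g', h', l') := H
    rw [← idxB_idxB (psiData N hN hϖ) (g, h, l), H', idxB_idxB] at hne
    exact hne rfl
  rw [sqrtROp_mul_self]
  refine PsiData.linearMap_ext (fun g h l x => ?_) (fun g h l y => ?_)
  · refine PsiData.linearMap_ext (fun g' h' l' x' => ?_) (fun g' h' l' y => ?_)
    · change (psiData N hN hϖ).pairing ℂ _ _ = (psiData N hN hϖ).pairing ℂ _ _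
      rw [opB_inLow, opB_inLow, gradedOp_inLow, pairing_inUp, pairing_inLow, inUp_fst, inLow_snd]
      exact (bracket_comp_zero _).trans (bracket_zero_comp _).symm
    · change (psiData N hN hϖ).pairing ℂ _ _ = (psiData N hN hϖ).pairing ℂ _ _
      rw [opB_inLow, opB_inUp, gradedOp_inUp, pairing_inUp, pairing_inLow]
      by_cases ht : (g, h, l) = (g', h', l')
      · obtain ⟨rfl, rfl, rfl⟩ : g = g' ∧ h = h' ∧ l = l' := by simpa using ht
        rw [inLow_fst, inUp_snd]
        exact bracket_bLow_comp_bUp x y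
      · rw [inUp_snd_of_ne _ _ _ _ _ ht, inLow_fst_of_ne _ _ _ _ _ (hB ht)]
        exact (bracket_comp_zero _).trans (bracket_zero_comp _).symm
  · refine PsiData.linearMap_ext (fun g' h' l' x => ?_) (fun g' h' l' y' => ?_)
    · change (psiData N hN hϖ).pairing ℂ _ _ = (psiData N hN hϖ).pairing ℂ _ _
      rw [opB_inLow, opB_inUp, gradedOp_inLow, pairing_inUp, pairing_inLow]
      by_cases ht : (g, h, l) = (g', h', l')
      · obtain ⟨rfl, rfl, rfl⟩ : g = g' ∧ h = h' ∧ l = l' := by simpa using ht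
        rw [inLow_fst, inUp_snd]
        refine (bracket_bLow_comp_bUp x y).trans ?_
        rw [LinearMap.smul_apply, Linear.comp_smul, Linear.smul_comp]
        refine (bracket_smul hϖ hN l.2 _ _).trans
          (Eq.trans ?_ (bracket_smul hϖ hN l.2 _ _).symm)
        exact congrArg _ (bracket_rLow_pow hN l.2 (N - 1) x y).symm
      · rw [inUp_snd_of_ne _ _ _ _ _ (hB ht), inLow_fst_of_ne _ _ _ _ _ ht]
        exact (bracket_zero_comp _).trans (bracket_comp_zero _).symm
    · change (psiData N hN hϖ).pairing ℂ _ _ = (psiData N hN hϖ).pairing ℂ _ _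
      rw [opB_inUp, opB_inUp, gradedOp_inUp, pairing_inUp, pairing_inLow, inUp_fst, inLow_snd]
      exact (bracket_zero_comp _).trans (bracket_comp_zero _).symm

theorem exists_transpose_opB : ∃ Bt : Module.End ℂ (psiData N hN hϖ).H,
    (psiData N hN hϖ).IsTranspose ℂ ((psiData N hN hϖ).opB ℂ) Bt ∧
    ((sqrtROp hN hϖ).val * (sqrtROp hN hϖ).val : Module.End ℂ (psiData N hN hϖ).H) =
      Bt * (psiData N hN hϖ).opB ℂ := by
  -- Since `B² = 1`, the only candidate for `B*` is `R B`.
  refine ⟨(sqrtROp hN hϖ).val * (sqrtROp hN hϖ).val * (psiData N hN hϖ).opB ℂ, fun x y => ?_, ?_⟩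
  · rw [Module.End.mul_apply, ← pairing_opB_opB, ← Module.End.mul_apply, opB_mul_opB]
    rfl
  · rw [mul_assoc, opB_mul_opB, mul_one]

end Pairing

end Borel

namespace Borel

open BialgMod PsiData

variable {N : ℕ} [NeZero N] {ϖ : ℂ} {hN : Odd N} {hϖ : IsPrimitiveRoot ϖ N}

/-! ### The tetrahedral form -/

section Tet

variable {i j p l m n : HalfPlane}

/-- The scalar `⟨u (v ⊗ Id) (Id ⊗ x) y⟩`. -/
noncomputable def tetBracket (u : cyclicMod N hϖ p ⊗ cyclicMod N hϖ l ⟶ cyclicMod N hϖ m)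
    (v : cyclicMod N hϖ i ⊗ cyclicMod N hϖ j ⟶ cyclicMod N hϖ p)
    (x : cyclicMod N hϖ n ⟶ cyclicMod N hϖ j ⊗ cyclicMod N hϖ l)
    (y : cyclicMod N hϖ m ⟶ cyclicMod N hϖ i ⊗ cyclicMod N hϖ n) : ℂ :=
  bracket ℂ (y ≫ cyclicMod N hϖ i ◁ x ≫ (α_ _ _ _).inv ≫ v ▷ cyclicMod N hϖ l ≫ u)

/-- The free choice of the diagonal position `k` lets a shift of the outer index be absorbed in the
three rules below. -/
theorem tetBracket_eq_sum (hN : Odd N) (hm : m.x ≠ 0)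
    (u : cyclicMod N hϖ p ⊗ cyclicMod N hϖ l ⟶ cyclicMod N hϖ m)
    (v : cyclicMod N hϖ i ⊗ cyclicMod N hϖ j ⟶ cyclicMod N hϖ p)
    (x : cyclicMod N hϖ n ⟶ cyclicMod N hϖ j ⊗ cyclicMod N hϖ l)
    (y : cyclicMod N hϖ m ⟶ cyclicMod N hϖ i ⊗ cyclicMod N hϖ n) (k : ZMod N) :
    tetBracket u v x y = ∑ a, ∑ d, upCoord y a d k * ∑ b, ∑ c, upCoord x b c d *
      ∑ e, lowCoord v a b e * lowCoord u e c k := by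
  rw [tetBracket, bracket_eq hN hm _ k]
  let v' : (ZMod N → ℂ) ⊗[ℂ] (ZMod N → ℂ) →ₗ[ℂ] (ZMod N → ℂ) := linMap v
  let u' : (ZMod N → ℂ) ⊗[ℂ] (ZMod N → ℂ) →ₗ[ℂ] (ZMod N → ℂ) := linMap u
  let x' : (ZMod N → ℂ) →ₗ[ℂ] (ZMod N → ℂ) ⊗[ℂ] (ZMod N → ℂ) := linMap x
  let y' : (ZMod N → ℂ) →ₗ[ℂ] (ZMod N → ℂ) ⊗[ℂ] (ZMod N → ℂ) := linMap y
  change u' (TensorProduct.map v' LinearMap.id ((TensorProduct.assoc ℂ _ _ _).symm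
    (TensorProduct.map LinearMap.id x' (y' (basisVec k))))) k = _
  have h1 : ∀ a b c : ZMod N, u' (v' (basisVec a ⊗ₜ basisVec b) ⊗ₜ basisVec c) k =
      ∑ e, lowCoord v a b e * lowCoord u e c k := by
    intro a b c
    rw [← sum_basisVec (v' (basisVec a ⊗ₜ basisVec b)), TensorProduct.sum_tmul, map_sum,
      Finset.sum_apply]
    refine Finset.sum_congr rfl fun e _ => ?_
    rw [← TensorProduct.smul_tmul', map_smul]
    rfl
  have h2 : ∀ a d : ZMod N, u' (TensorProduct.map v' LinearMap.id
      ((TensorProduct.assoc ℂ _ _ _).symm ((basisVec a : ZMod N → ℂ) ⊗ₜ x' (basisVec d)))) k =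
      ∑ b, ∑ c, upCoord x b c d * ∑ e, lowCoord v a b e * lowCoord u e c k := by
    intro a d
    rw [← sum_tcoord (x' (basisVec d))]
    simp only [TensorProduct.tmul_sum, map_sum, TensorProduct.tmul_smul, map_smul,
      Finset.sum_apply, Pi.smul_apply, TensorProduct.assoc_symm_tmul, TensorProduct.map_tmul,
      LinearMap.id_apply, h1, smul_eq_mul]
    rfl
  rw [← sum_tcoord (y' (basisVec k))]
  simp only [map_sum, map_smul, Finset.sum_apply, Pi.smul_apply, TensorProduct.map_tmul,
    LinearMap.id_apply, h2, smul_eq_mul]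
  rfl

variable (u : cyclicMod N hϖ p ⊗ cyclicMod N hϖ l ⟶ cyclicMod N hϖ m)
    (v : cyclicMod N hϖ i ⊗ cyclicMod N hϖ j ⟶ cyclicMod N hϖ p)
    (x : cyclicMod N hϖ n ⟶ cyclicMod N hϖ j ⊗ cyclicMod N hϖ l)
    (y : cyclicMod N hϖ m ⟶ cyclicMod N hϖ i ⊗ cyclicMod N hϖ n)

theorem tetBracket_smul_u (hN : Odd N) (hm : m.x ≠ 0) (c : ℂ) :
    tetBracket (c • u) v x y = c * tetBracket u v x y := by
  rw [tetBracket, Linear.comp_smul, Linear.comp_smul, Linear.comp_smul, Linear.comp_smul,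
    bracket_smul hϖ hN hm, tetBracket]

theorem tetBracket_smul_v (hN : Odd N) (hm : m.x ≠ 0) (c : ℂ) :
    tetBracket u (c • v) x y = c * tetBracket u v x y := by
  rw [tetBracket, MonoidalLinear.smul_whiskerRight, Linear.smul_comp, Linear.comp_smul,
    Linear.comp_smul, Linear.comp_smul, bracket_smul hϖ hN hm, tetBracket]

theorem tetBracket_smul_x (hN : Odd N) (hm : m.x ≠ 0) (c : ℂ) :
    tetBracket u v (c • x) y = c * tetBracket u v x y := by
  rw [tetBracket, MonoidalLinear.whiskerLeft_smul, Linear.smul_comp, Linear.comp_smul,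
    bracket_smul hϖ hN hm, tetBracket]

theorem tetBracket_smul_y (hN : Odd N) (hm : m.x ≠ 0) (c : ℂ) :
    tetBracket u v x (c • y) = c * tetBracket u v x y := by
  rw [tetBracket, Linear.smul_comp, bracket_smul hϖ hN hm, tetBracket]

/-- The indices `a`, `e` and `k` are shifted together. The factors `χ(b) χ(c)` from the two copies
of `r` match `χ(d)` on the right, because `d = b + c` on the support of `x`. -/
theorem tetBracket_rr (hN : Odd N) (hm : m.x ≠ 0) :
    tetBracket (rLow u) (rLow v) x y = tetBracket u v x (rUp y) := by
  rw [tetBracket_eq_sum hN hm _ _ _ _ 0, tetBracket_eq_sum hN hm _ _ _ _ (0 + 1)]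
  refine Fintype.sum_equiv (Equiv.addRight (1 : ZMod N)) _ _ fun a => ?_
  refine Finset.sum_congr rfl fun d _ => ?_
  rw [upCoord_rUp, Equiv.coe_addRight, add_sub_cancel_right, add_sub_cancel_right,
    mul_comm (chi ϖ d), mul_assoc, Finset.mul_sum (a := chi ϖ d)]
  congr 1
  refine Finset.sum_congr rfl fun b _ => ?_
  rw [Finset.mul_sum]
  refine Finset.sum_congr rfl fun c _ => ?_
  by_cases hx : upCoord x b c d = 0
  · rw [hx, zero_mul, zero_mul, mul_zero]
  rw [(upCoord_support hx).1, chi_add hϖ, mul_left_comm]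
  congr 1
  rw [Finset.mul_sum]
  refine Fintype.sum_equiv (Equiv.addRight (1 : ZMod N)) _ _ fun e => ?_
  rw [lowCoord_rLow, lowCoord_rLow, Equiv.coe_addRight]
  ring

/-- Here `b`, `d`, `e` and `k` are shifted together, and the single factor `χ(c)` passes from `u` to
`x`. -/
theorem tetBracket_rs (hN : Odd N) (hm : m.x ≠ 0) :
    tetBracket (rLow u) (sLow v) x y = tetBracket u v (rUp x) (sUp y) := by
  rw [tetBracket_eq_sum hN hm _ _ _ _ 0, tetBracket_eq_sum hN hm _ _ _ _ (0 + 1)]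
  refine Finset.sum_congr rfl fun a _ => ?_
  refine Fintype.sum_equiv (Equiv.addRight (1 : ZMod N)) _ _ fun d => ?_
  rw [upCoord_sUp, Equiv.coe_addRight, add_sub_cancel_right, add_sub_cancel_right]
  congr 1
  refine Fintype.sum_equiv (Equiv.addRight (1 : ZMod N)) _ _ fun b => ?_
  refine Finset.sum_congr rfl fun c _ => ?_
  rw [upCoord_rUp, Equiv.coe_addRight, add_sub_cancel_right, add_sub_cancel_right,
    mul_comm (chi ϖ c), mul_assoc, Finset.mul_sum (a := chi ϖ c)]
  congr 1
  refine Fintype.sum_equiv (Equiv.addRight (1 : ZMod N)) _ _ fun e => ?_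
  rw [lowCoord_rLow, lowCoord_sLow, Equiv.coe_addRight]
  ring

/-- Here `c`, `d` and `k` are shifted together; no phase appears. -/
theorem tetBracket_s (hN : Odd N) (hm : m.x ≠ 0) :
    tetBracket (sLow u) v x y = tetBracket u v (sUp x) (sUp y) := by
  rw [tetBracket_eq_sum hN hm _ _ _ _ 0, tetBracket_eq_sum hN hm _ _ _ _ (0 + 1)]
  refine Finset.sum_congr rfl fun a _ => ?_
  refine Fintype.sum_equiv (Equiv.addRight (1 : ZMod N)) _ _ fun d => ?_
  rw [upCoord_sUp, Equiv.coe_addRight, add_sub_cancel_right, add_sub_cancel_right]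
  congr 1
  refine Finset.sum_congr rfl fun b _ => ?_
  refine Fintype.sum_equiv (Equiv.addRight (1 : ZMod N)) _ _ fun c => ?_
  rw [upCoord_sUp, Equiv.coe_addRight, add_sub_cancel_right, add_sub_cancel_right]
  congr 1
  refine Finset.sum_congr rfl fun e _ => ?_
  rw [lowCoord_sLow]

theorem tetBracket_rr_pow (hN : Odd N) (hm : m.x ≠ 0) (t : ℕ) :
    tetBracket ((rLow ^ t) u) ((rLow ^ t) v) x y = tetBracket u v x ((rUp ^ t) y) := by
  induction t generalizing y with
  | zero => rfl
  | succ t ih =>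
    rw [pow_succ', pow_succ' rLow, pow_succ rUp, Module.End.mul_apply, Module.End.mul_apply,
      Module.End.mul_apply, tetBracket_rr _ _ _ _ hN hm, ih]

theorem tetBracket_rs_pow (hN : Odd N) (hm : m.x ≠ 0) (t : ℕ) :
    tetBracket ((rLow ^ t) u) ((sLow ^ t) v) x y =
      tetBracket u v ((rUp ^ t) x) ((sUp ^ t) y) := by
  induction t generalizing x y with
  | zero => rfl
  | succ t ih =>
    rw [pow_succ' rLow, pow_succ' sLow, pow_succ rUp, pow_succ sUp, Module.End.mul_apply,
      Module.End.mul_apply, Module.End.mul_apply, Module.End.mul_apply,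
      tetBracket_rs _ _ _ _ hN hm, ih]

theorem tetBracket_s_pow (hN : Odd N) (hm : m.x ≠ 0) (t : ℕ) :
    tetBracket ((sLow ^ t) u) v x y = tetBracket u v ((sUp ^ t) x) ((sUp ^ t) y) := by
  induction t generalizing x y with
  | zero => rfl
  | succ t ih =>
    rw [pow_succ' sLow, pow_succ sUp, pow_succ sUp, Module.End.mul_apply,
      Module.End.mul_apply, Module.End.mul_apply, tetBracket_s _ _ _ _ hN hm, ih]

end Tet

/-! ### The identities for `T` summed over all indices -/

section TetForm

variable (u v x y : (psiData N hN hϖ).H)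

theorem tetForm_congr {u v x y u' v' x' y' : (psiData N hN hϖ).H}
    (H : ∀ i j p l m n : BorelIdx,
      tetBracket (hϖ := hϖ) (u.1 (p, l, m)) (v.1 (i, j, p)) (x.2 (j, l, n)) (y.2 (i, n, m)) =
      tetBracket (hϖ := hϖ) (u'.1 (p, l, m)) (v'.1 (i, j, p)) (x'.2 (j, l, n)) (y'.2 (i, n, m))) :
    (psiData N hN hϖ).tetForm ℂ u v x y = (psiData N hN hϖ).tetForm ℂ u' v' x' y' :=
  finsum_congr fun _ => H _ _ _ _ _ _

/-- The scalars telescope: `(v_p/v_m)(v_i/v_p) = v_i/v_m`. -/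
theorem tetForm_sqrtR_sqrtR : (psiData N hN hϖ).tetForm ℂ ((sqrtROp hN hϖ).val u)
    ((sqrtROp hN hϖ).val v) x y = (psiData N hN hϖ).tetForm ℂ u v x ((sqrtROp hN hϖ).val y) := by
  rw [sqrtROp, coe_scalarUnit_mul_unitR_pow]
  refine tetForm_congr fun i j p l m n => ?_
  rw [gradedOp_fst, gradedOp_fst, gradedOp_snd]
  refine (tetBracket_smul_u _ _ _ _ hN m.2 _).trans ?_
  refine (congrArg _ (tetBracket_smul_v _ _ _ _ hN m.2 _)).trans ?_
  refine Eq.trans ?_ (tetBracket_smul_y _ _ _ _ hN m.2 _).symm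
  rw [← mul_assoc, ← mul_pow]
  refine congrArg₂ _ (congrArg (· ^ _) ?_) (tetBracket_rr_pow _ _ _ _ hN m.2 _)
  change (p.1.rootV N : ℂ) / m.1.rootV N * (i.1.rootV N / p.1.rootV N) =
    i.1.rootV N / m.1.rootV N
  have := HalfPlane.rootV_ne hN p.2
  have := HalfPlane.rootV_ne hN m.2
  field_simp

theorem tetForm_sqrtR_sqrtL : (psiData N hN hϖ).tetForm ℂ ((sqrtROp hN hϖ).val u)
    ((sqrtLOp hN hϖ).val v) x y = (psiData N hN hϖ).tetForm ℂ u v ((sqrtROp hN hϖ).val x)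
      ((sqrtLOp hN hϖ).val y) := by
  rw [sqrtROp, coe_scalarUnit_mul_unitR_pow, sqrtLOp, coe_scalarUnit_mul_unitSh_pow]
  refine tetForm_congr fun i j p l m n => ?_
  rw [gradedOp_fst, gradedOp_fst, gradedOp_snd, gradedOp_snd]
  refine (tetBracket_smul_u _ _ _ _ hN m.2 _).trans ?_
  refine (congrArg _ (tetBracket_smul_v _ _ _ _ hN m.2 _)).trans ?_
  refine Eq.trans ?_ (tetBracket_smul_x _ _ _ _ hN m.2 _).symm
  refine Eq.trans ?_ (congrArg _ (tetBracket_smul_y _ _ _ _ hN m.2 _).symm)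
  rw [← mul_assoc, ← mul_assoc, ← mul_pow, ← mul_pow]
  refine congrArg₂ _ (congrArg (· ^ _) ?_) (tetBracket_rs_pow _ _ _ _ hN m.2 _)
  change (p.1.rootV N : ℂ) / m.1.rootV N * (i.1.rootU N * j.1.rootV N / p.1.rootV N) =
    j.1.rootV N / n.1.rootV N * (i.1.rootU N * n.1.rootV N / m.1.rootV N)
  have := HalfPlane.rootV_ne hN p.2
  have := HalfPlane.rootV_ne hN m.2
  have := HalfPlane.rootV_ne hN n.2
  field_simp

theorem tetForm_sqrtL : (psiData N hN hϖ).tetForm ℂ ((sqrtLOp hN hϖ).val u) v x y =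
    (psiData N hN hϖ).tetForm ℂ u v ((sqrtLOp hN hϖ).val x) ((sqrtLOp hN hϖ).val y) := by
  rw [sqrtLOp, coe_scalarUnit_mul_unitSh_pow]
  refine tetForm_congr fun i j p l m n => ?_
  rw [gradedOp_fst, gradedOp_snd, gradedOp_snd]
  refine (tetBracket_smul_u _ _ _ _ hN m.2 _).trans ?_
  refine Eq.trans ?_ (tetBracket_smul_x _ _ _ _ hN m.2 _).symm
  refine Eq.trans ?_ (congrArg _ (tetBracket_smul_y _ _ _ _ hN m.2 _).symm)
  rw [← mul_assoc, ← mul_pow]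
  refine (congrArg _ (tetBracket_s_pow _ _ _ _ hN m.2 _)).trans ?_
  -- The scalars now match only if `u_p = u_i u_j`; when `p ≠ ij` the component of `v` is zero and
  -- both sides vanish.
  by_cases hp : p.1 = i.1 * j.1
  · refine congrArg (· * _) (congrArg (· ^ _) ?_)
    change (p.1.rootU N : ℂ) * l.1.rootV N / m.1.rootV N =
      j.1.rootU N * l.1.rootV N / n.1.rootV N * (i.1.rootU N * n.1.rootV N / m.1.rootV N)
    rw [hp, HalfPlane.rootU_mul hN]
    have := HalfPlane.rootV_ne hN m.2
    have := HalfPlane.rootV_ne hN n.2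
    push_cast
    field_simp
  · have hv : v.1 (i, j, p) = (0 : ℂ) • v.1 (i, j, p) :=
      (low_eq_zero hN hp (v.1 (i, j, p))).trans (zero_smul _ _).symm
    rw [hv]
    refine (congrArg _ (tetBracket_smul_v _ _ _ _ hN m.2 _)).trans ?_
    refine Eq.trans ?_ (congrArg _ (tetBracket_smul_v _ _ _ _ hN m.2 _).symm)
    rw [zero_mul, mul_zero, mul_zero]

end TetForm

end Borel

namespace Borel

open BialgMod PsiData

variable {N : ℕ} [NeZero N] {ϖ : ℂ} {hN : Odd N} {hϖ : IsPrimitiveRoot ϖ N}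

/-! ### The `Ψ̂`-system and its algebraic data -/

theorem isPsiHatSystem : (psiData N hN hϖ).IsPsiHatSystem 1 (sqrtROp hN hϖ) where
  isPsiSystem := psiSystem hN hϖ
  symm_C _ _ := rfl
  symm_R := isTranspose_sqrtROp
  grading_C := ⟨fun _ _ _ x => ⟨x, rfl⟩, fun _ _ _ x => ⟨x, rfl⟩⟩
  grading_R := by
    rw [sqrtROp, coe_scalarUnit_mul_unitR_pow]
    exact ⟨fun i j l x => ⟨_, gradedOp_inLow _ _ _ _ _ x⟩,
      fun i j l x => ⟨_, gradedOp_inUp _ _ _ _ _ x⟩⟩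
  sq_C := by rw [Units.val_one, one_mul, opC_eq_one]
  conjA_C := by rw [inv_one, Units.val_one, mul_one, opA_mul_opA]
  conjB_C := by rw [inv_one, Units.val_one, mul_one, opB_mul_opB]
  sq_R := exists_transpose_opB
  conjB_R := congrArg Units.val (unitB_conj_sqrtROp (hN := hN) (hϖ := hϖ))
  comm := by rw [mul_one, one_mul]
  T_CC _ _ _ _ := rfl
  T_RL u v x y := by rw [sqrtL_eq]; exact tetForm_sqrtR_sqrtL u v x y
  T_RR u v x y := tetForm_sqrtR_sqrtR u v x y
  T_L u v x y := by rw [sqrtL_eq]; exact tetForm_sqrtL u v x y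

/-- The exponents `(N - 1)/2` and `(N + 1)/2` add up to `N`, so `χ(i)^{(N-1)/2}` is the inverse of
`χ(i)^{(N+1)/2}`. -/
theorem sqrtREigen_eq (hN : Odd N) (hϖ : IsPrimitiveRoot ϖ N) (g l : HalfPlane) (i : ZMod N) :
    sqrtREigen N ϖ g l i =
      ((g.rootV N : ℂ) / l.rootV N) ^ ((N - 1) / 2) * chi ϖ i ^ ((N - 1) / 2) := by
  have e : (N - 1) / 2 + (N + 1) / 2 = N := by obtain ⟨m, rfl⟩ := hN; omega
  have h1 : chi ϖ i ^ ((N - 1) / 2) * ϖ ^ ((N + 1) / 2 * i.val) = 1 := by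
    rw [mul_comm ((N + 1) / 2), pow_mul]
    change chi ϖ i ^ _ * chi ϖ i ^ _ = 1
    rw [← pow_add, e, chi_pow_card hϖ]
  rw [sqrtREigen, ← eq_inv_of_mul_eq_one_left h1, mul_comm]
  push_cast
  rfl

section

variable {g h l : BorelIdx}

theorem rLow_pow_eLow (hl : l.1 = g.1 * h.1) (a : ZMod N) (n : ℕ) :
    (rLow ^ n) (eLow hN hϖ h.2 hl a) = chi ϖ a ^ n • eLow hN hϖ h.2 hl a := by
  induction n with
  | zero => rw [pow_zero, pow_zero, one_smul]; rfl
  | succ n ih => rw [pow_succ', Module.End.mul_apply, ih, map_smul, rLow_eLow, smul_smul, pow_succ]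

theorem sqrtROp_inUp (hl : l.1 = g.1 * h.1) (a : ZMod N) :
    (sqrtROp hN hϖ).val ((psiData N hN hϖ).inUp ℂ g h l (eUp hN hϖ h.2 hl a)) =
      sqrtREigen N ϖ g.1 l.1 a •
        (psiData N hN hϖ).inUp ℂ g h l (eUp hN hϖ h.2 hl a) := by
  rw [sqrtROp, coe_scalarUnit_mul_unitR_pow, gradedOp_inUp, ← map_smul, LinearMap.smul_apply,
    sqrtREigen_eq hN hϖ, mul_smul]
  exact congrArg _ (congrArg _ (rUp_pow_eUp hl a _))

theorem sqrtROp_inLow (hl : l.1 = g.1 * h.1) (a : ZMod N) :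
    (sqrtROp hN hϖ).val ((psiData N hN hϖ).inLow ℂ g h l (eLow hN hϖ h.2 hl a)) =
      sqrtREigen N ϖ g.1 l.1 a •
        (psiData N hN hϖ).inLow ℂ g h l (eLow hN hϖ h.2 hl a) := by
  rw [sqrtROp, coe_scalarUnit_mul_unitR_pow, gradedOp_inLow, ← map_smul, LinearMap.smul_apply,
    sqrtREigen_eq hN hϖ, mul_smul]
  exact congrArg _ (congrArg _ (rLow_pow_eLow hl a _))

end

/-! ### The sets `I_g` and the weights -/

theorem mem_fiber {g : HalfPlane} {i : BorelIdx} : i ∈ fiber g ↔ i.1 = g := by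
  unfold fiber
  split_ifs with hg
  · rw [Finset.mem_singleton, Subtype.ext_iff]
  · simp only [Finset.notMem_empty, false_iff]
    rintro rfl
    exact hg i.2

theorem fiber_coe (i : BorelIdx) : fiber i.1 = {i} := by
  ext j; rw [mem_fiber, Finset.mem_singleton, Subtype.ext_iff]

theorem isAlgebraicData :
    (psiData N hN hϖ).IsAlgebraicData fiber (fun _ => (1 / N : ℂ)) where
  star_mem g i hi := by
    rw [mem_fiber] at hi ⊢
    exact congrArg (·⁻¹) hi
  hom_eq_zero g₁ g₂ i₁ h₁ i₂ h₂ l hl f := by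
    rw [mem_fiber] at h₁ h₂ hl
    subst h₁ h₂
    exact up_eq_zero hN i₂.2 hl f
  exists_hom g₁ g₂ i₁ h₁ i₂ h₂ := by
    rw [mem_fiber] at h₁ h₂
    subst h₁ h₂
    refine (Finset.eq_empty_or_nonempty _).imp_right fun ⟨l, hl⟩ => ⟨l, hl, ?_⟩
    exact ⟨_, (basisUp hN hϖ i₂.2 (mem_fiber.mp hl) l.2).ne_zero 0⟩
  exists_translate s := by
    classical
    -- Left multiplication by `(t, 1)` adds `t` to the first coordinate, so only finitely many
    -- values of `t` are excluded.
    obtain ⟨t, ht⟩ := Infinite.exists_notMem_finset (s.image fun h => -h.x)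
    refine ⟨⟨t, 1, one_pos⟩, fun h hh => ?_⟩
    refine ⟨⟨⟨t, 1, one_pos⟩ * h, fun H => ht (Finset.mem_image.mpr ⟨h, hh, ?_⟩)⟩, mem_fiber.mpr rfl⟩
    rw [HalfPlane.mul_x] at H
    change t + 1 * h.x = 0 at H
    linarith
  weight_star _ := rfl
  weight_sum g₁ g₂ l hl h₁ h₂ := by
    obtain ⟨i₁, h₁⟩ := h₁
    obtain ⟨i₂, h₂⟩ := h₂
    rw [mem_fiber] at h₁ h₂ hl
    subst h₁ h₂
    rw [fiber_coe, fiber_coe, Finset.sum_singleton, Finset.sum_singleton]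
    have hd : Module.finrank ℂ ((psiData N hN hϖ).V l ⟶
        (psiData N hN hϖ).V i₁ ⊗ (psiData N hN hϖ).V i₂) = N :=
      (Module.finrank_eq_card_basis (basisUp hN hϖ i₂.2 hl l.2)).trans (ZMod.card N)
    rw [hd]
    have : (N : ℂ) ≠ 0 := Nat.cast_ne_zero.mpr (NeZero.ne N)
    field_simp

end Borel

/-! ### Assembly -/

theorem mainTheorem2 (N : ℕ) [NeZero N] (hN : Odd N) (ϖ : ℂ) (hϖ : IsPrimitiveRoot ϖ N) :
    -- the modules `V_g`, `g ∈ I`, form a `Ψ`-system, and `H^{g,h}_l = 0` unless `l = gh`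
    (Borel.psiData N hN hϖ).IsPsiSystem ℂ ∧
    (∀ g h l : BorelIdx, l.1 ≠ g.1 * h.1 →
      ∀ f : (Borel.psiData N hN hϖ).V l ⟶
        (Borel.psiData N hN hϖ).V g ⊗ (Borel.psiData N hN hϖ).V h, f = 0) ∧
    -- the bases `e_i` of `H^{g,h}_{gh}` and `e_i^*` of `H_{g,h}^{gh}`, and the operator `√R`
    ∃ (e : ∀ g h l : BorelIdx, l.1 = g.1 * h.1 → Module.Basis (ZMod N) ℂ
          ((Borel.psiData N hN hϖ).V l ⟶
            (Borel.psiData N hN hϖ).V g ⊗ (Borel.psiData N hN hϖ).V h))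
      (e' : ∀ g h l : BorelIdx, l.1 = g.1 * h.1 → Module.Basis (ZMod N) ℂ
          ((Borel.psiData N hN hϖ).V g ⊗ (Borel.psiData N hN hϖ).V h ⟶
            (Borel.psiData N hN hϖ).V l))
      (sR : (Module.End ℂ (Borel.psiData N hN hϖ).H)ˣ),
      -- `e_i(x) = S_{g,h}(x ⊗ e_i)` and `e_i^*(S_{g,h}(x ⊗ y)) = y_i x`, with `S_{g,h}` invertible
      (∀ g h l (hl : l.1 = g.1 * h.1), IsUnit (Borel.opS N ϖ g.1 h.1) ∧
        (∀ (i : ZMod N) (x : ZMod N → ℂ), BialgMod.linMap (e g h l hl i) x =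
          Borel.opS N ϖ g.1 h.1 (x ⊗ₜ[ℂ] Borel.basisVec i)) ∧
        (∀ (i : ZMod N) (x y : ZMod N → ℂ),
          BialgMod.linMap (e' g h l hl i) (Borel.opS N ϖ g.1 h.1 (x ⊗ₜ[ℂ] y)) = y i • x)) ∧
      -- `√R` is diagonal in these bases
      (∀ g h l (hl : l.1 = g.1 * h.1) (i : ZMod N),
        sR.val ((Borel.psiData N hN hϖ).inUp ℂ g h l (e g h l hl i)) =
          Borel.sqrtREigen N ϖ g.1 l.1 i •
            (Borel.psiData N hN hϖ).inUp ℂ g h l (e g h l hl i) ∧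
        sR.val ((Borel.psiData N hN hϖ).inLow ℂ g h l (e' g h l hl i)) =
          Borel.sqrtREigen N ϖ g.1 l.1 i •
            (Borel.psiData N hN hϖ).inLow ℂ g h l (e' g h l hl i)) ∧
      -- `√C = Id` and `√R` extend the `Ψ`-system to a `Ψ̂`-system
      (Borel.psiData N hN hϖ).IsPsiHatSystem 1 sR ∧
      -- the algebraic data `I_g = {g}` or `∅`, `β = 1/N`
      (Borel.psiData N hN hϖ).IsAlgebraicData Borel.fiber (fun _ => (1 / N : ℂ)) ∧
      -- the operator `q`
      (Borel.psiData N hN hϖ).opQ 1 sR =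
        (-1 : ℂ) ^ ((N - 1) / 2) • (Borel.psiData N hN hϖ).diagOp ℂ
          ((ϖ ^ ((N ^ 2 - 1) / 8))⁻¹) (ϖ ^ ((N ^ 2 - 1) / 8)) ∧
      -- hence `q` is `T`-equal to `q̃ Id_Ĥ ⊕ q̃⁻¹ Id_Ȟ` for a scalar `q̃`
      ∃ q' : ℂ, q' ≠ 0 ∧ (Borel.psiData N hN hϖ).TEq ℂ ((Borel.psiData N hN hϖ).opQ 1 sR)
        ((Borel.psiData N hN hϖ).diagOp ℂ q' q'⁻¹) := by
  refine ⟨Borel.psiSystem hN hϖ, fun g h l hl f => Borel.up_eq_zero hN h.2 hl f,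
    fun g h l hl => Borel.basisUp hN hϖ h.2 hl l.2,
    fun g h l hl => Borel.basisLow hN hϖ h.2 hl l.2, Borel.sqrtROp hN hϖ,
    fun g h l hl => ⟨Borel.isUnit_opS hN hϖ h.2 hl l.2, fun i x => ?_, fun i x y => ?_⟩,
    fun g h l hl i => ⟨?_, ?_⟩, Borel.isPsiHatSystem, Borel.isAlgebraicData, Borel.opQ_eq,
    (-1) ^ ((N - 1) / 2) * (ϖ ^ ((N ^ 2 - 1) / 8))⁻¹, ?_, ?_⟩
  · rw [Borel.basisUp_apply]
    exact Borel.linMap_eUp hN hϖ h.2 hl i x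
  · rw [Borel.basisLow_apply]
    exact Borel.linMap_eLow hN hϖ h.2 hl l.2 i x y
  · rw [Borel.basisUp_apply]
    exact Borel.sqrtROp_inUp hl i
  · rw [Borel.basisLow_apply]
    exact Borel.sqrtROp_inLow hl i
  · exact mul_ne_zero (pow_ne_zero _ (neg_ne_zero.mpr one_ne_zero))
      (inv_ne_zero (pow_ne_zero _ (Borel.root_ne_zero hϖ)))
  -- The sign is its own inverse, so it fits both components of `q̃ Id ⊕ q̃⁻¹ Id`. The operators are
  -- then equal, and `T`-equality is immediate.
  · have hq : (Borel.psiData N hN hϖ).opQ 1 (Borel.sqrtROp hN hϖ) =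
        (Borel.psiData N hN hϖ).diagOp ℂ ((-1) ^ ((N - 1) / 2) * (ϖ ^ ((N ^ 2 - 1) / 8))⁻¹)
          ((-1) ^ ((N - 1) / 2) * (ϖ ^ ((N ^ 2 - 1) / 8))⁻¹)⁻¹ := by
      rw [Borel.opQ_eq, mul_inv, inv_inv, ← inv_pow (-1 : ℂ), inv_neg, inv_one]
      exact LinearMap.ext fun z => Prod.ext (smul_smul _ _ z.1) (smul_smul _ _ z.2)
    rw [hq]
    exact fun _ _ _ _ => ⟨rfl, rfl, rfl, rfl⟩
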